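/- Let $\pi\colon E\to M$ be a smooth real vector bundle of rank $m$ over an $n$-dimensional smooth manifold, with adapted coordinates $x_i,u^j_\sigma$ on the infinite jet space $J^\infty(\pi)$ and total derivatives $D_i$. Smooth functions on $J^\infty(\pi)\times\mathbb{R}$ are those which in each adapted coordinate system are $C^\infty$ functions of $x$, $t$ and finitely many $u^j_\sigma$. Let $\kappa$ be the module of ($t$-dependent) smooth sections of $\pi_\infty^*(E)$ and $\hat\kappa=\operatorname{Hom}(\kappa,\bar\Lambda^n)$, where $\bar\Lambda^n$ denotes the horizontal $n$-forms. For $\varphi\in\kappa$ let $\partial_\varphi=\sum_{j,\sigma}D_\sigma(\varphi^j)\,\partial/\partial u^j_\sigma$ be the evolutionary field of $\varphi$, and let $\ell_p(\varphi)=\partial_\varphi(p)$ be the linearization. A variational bivector (resp. 2-form) is a $t$-dependent skew-adjoint operator $\hat\kappa\to\kappa$ (resp. $\kappa\to\hat\kappa$) which in coordinates is a matrix total-derivative operator $\sum_\sigma a^\sigma_{ij}D_\sigma$ of finite order with smooth coefficients. For such an operator $A$ put $\ell_{A,\psi}=\ell_{A(\psi)}-A\circ\ell_\psi$. The variational Schouten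 bracket of bivectors is $$[\![A,B]\!](\psi_1,\psi_2)=\ell_{A,\psi_1}(B\psi_2)-\ell_{A,\psi_2}(B\psi_1)+\ell_{B,\psi_1}(A\psi_2)-\ell_{B,\psi_2}(A\psi_1)-A(\ell_{B,\psi_2}^*\psi_1)-B(\ell_{A,\psi_2}^*\psi_1),$$ and the differential of a 2-form is $$(d\omega)(\varphi_1,\varphi_2)=\ell_{\omega,\varphi_2}(\varphi_1)-\ell_{\omega,\varphi_1}(\varphi_2)+\ell_{\omega,\varphi_1}^*(\varphi_2).$$ Let $u_t=f$, $f\in\kappa$, be an evolution equation, regarded as $\mathcal{E}^\infty=J^\infty(\pi)\times\mathbb{R}$ with $D_t=\partial/\partial t+\partial_f$. Put $L_{D_t}=D_t-\ell_f$ on $\kappa$ and $L_{D_t}=D_t+\ell_f^*$ on $\hat\kappa$. A variational bivector or 2-form $A$ is *on the equation* if $L_{D_t}\circ A=A\circ L_{D_t}$. A bivector $A$ on the equation is a *Hamiltonian structure* if $[\![A,A]\!]=0$; Hamiltonian structures $A,B$ are *compatible* if $[\![A,B]\!]=0$; a *symplectic structure* is a variational 2-form $\omega$ on the equation with $d\omega=0$.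 **Theorem.** Suppose that the operator $\ell_f$ has order $l>1$ and that its symbol, the matrix $\lambda(\theta)=\bigl(\sum_{|\sigma|=l}\frac{\partial f^i}{\partial u^j_\sigma}\theta^\sigma\bigr)_{i,j}$, is nonsingular (i.e. $\det\lambda(\theta)$ is a nonzero polynomial in the covector $\theta$) at every point of a dense open subset of $\mathcal{E}^\infty$. Then 1. every variational bivector on the equation is Hamiltonian; 2. any two Hamiltonian structures on the equation are compatible; 3. every variational 2-form on the equation is closed, hence symplectic. -/

import Mathlib

open scoped Manifold ContDiff Topology Matrix
open Set Bundle

noncomputable section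

namespace VarCalc

/-! Conventions.  `n` is the dimension of the base `M`, `m` is the rank of the vector bundle `E`.
A geometric object on `J^∞(π) × ℝ` is given by its components in all adapted coordinate systems
(a chart of `M` together with a vector bundle trivialization of `E`), subject to the
transformation law of the object.  Components are functions on the coordinate space `Pt n m`; only
their values over the image `c.Ω` of the coordinate domain are meaningful. -/

/-! ### Calculus in the jet coordinates `(x, u, t)` -/

/-- Symmetric multi-indices `σ`; the length `|σ|` is `σ.degree`. -/
abbrev MI (n : ℕ) := Fin n →₀ ℕ

/-- Coordinate space of `J^∞(π) × ℝ`: points `(x, u, t)`, where `u (j, σ)` is the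
coordinate `u^j_σ`.  It carries the product topology. -/
abbrev Pt (n m : ℕ) := EuclideanSpace ℝ (Fin n) × (Fin m × MI n → ℝ) × ℝ

/-- Tuples of `m` component functions. -/
abbrev Field (n m : ℕ) := Pt n m → Fin m → ℝ

/-- For operators `D 0, …, D (n-1)` on functions, the composition of the `(D i)^(σ i)`. -/
def iter {n : ℕ} {X : Type*} (D : Fin n → (X → ℝ) → X → ℝ) (σ : MI n) (F : X → ℝ) : X → ℝ :=
  (List.finRange n).foldr (fun i G => (D i)^[σ i] G) F

/-- The partial derivative `∂_σ` of a function on `ℝⁿ`. -/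
def pderiv {n : ℕ} (σ : MI n) (F : EuclideanSpace ℝ (Fin n) → ℝ) :
    EuclideanSpace ℝ (Fin n) → ℝ :=
  iter (fun i G y => fderiv ℝ G y (EuclideanSpace.single i 1)) σ F

variable {n m : ℕ}

/-- `F` is smooth over `Ω ⊆ ℝⁿ`: there, it is a `C^∞` function of `x`, `t` and finitely many of
the `u^j_σ`. -/
def SmoothOver (Ω : Set (EuclideanSpace ℝ (Fin n))) (F : Pt n m → ℝ) : Prop :=
  ∃ (S : Finset (Fin m × MI n)) (G : EuclideanSpace ℝ (Fin n) × (S → ℝ) × ℝ → ℝ),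
    ContDiffOn ℝ ∞ G (Ω ×ˢ univ) ∧
      ∀ p : Pt n m, p.1 ∈ Ω → F p = G (p.1, fun a => p.2.1 a, p.2.2)

/-- Componentwise smoothness over `Ω`. -/
def SmoothField (Ω : Set (EuclideanSpace ℝ (Fin n))) (φ : Field n m) : Prop :=
  ∀ i, SmoothOver Ω (fun p => φ p i)

/-- `∂F/∂x_i`. -/
def dX (i : Fin n) (F : Pt n m → ℝ) (p : Pt n m) : ℝ :=
  deriv (fun s : ℝ => F (p.1 + s • EuclideanSpace.single i 1, p.2)) 0

/-- `∂F/∂u^j_σ`. -/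
def dU (j : Fin m) (σ : MI n) (F : Pt n m → ℝ) (p : Pt n m) : ℝ :=
  deriv (fun s : ℝ => F (p.1, Function.update p.2.1 (j, σ) s, p.2.2)) (p.2.1 (j, σ))

/-- `∂F/∂t`. -/
def dT (F : Pt n m → ℝ) (p : Pt n m) : ℝ :=
  deriv (fun s : ℝ => F (p.1, p.2.1, s)) p.2.2

/-- The total derivative `D_i = ∂/∂x_i + ∑ u^j_{σi} ∂/∂u^j_σ`.  For `F` smooth over `Ω` and `p`
over `Ω`, the sum has finitely many nonzero terms. -/
def totalD (i : Fin n) (F : Pt n m → ℝ) (p : Pt n m) : ℝ :=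
  dX i F p + ∑ᶠ σ : MI n, ∑ j, p.2.1 (j, σ + Finsupp.single i 1) * dU j σ F p

/-- The iterated total derivative `D_σ`. -/
def totalDσ (σ : MI n) (F : Pt n m → ℝ) : Pt n m → ℝ := iter totalD σ F

/-- The evolutionary field `∑ D_σ(φ^j) ∂/∂u^j_σ` of `φ`, applied to `F`. -/
def evol (φ : Field n m) (F : Pt n m → ℝ) (p : Pt n m) : ℝ :=
  ∑ᶠ σ : MI n, ∑ j, totalDσ σ (fun q => φ q j) p * dU j σ F p

/-- `D_t = ∂/∂t + (evolutionary field of f)`, applied to each component of `φ`. -/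
def Dt (f φ : Field n m) : Field n m :=
  fun p i => dT (fun q => φ q i) p + evol f (fun q => φ q i) p

/-- Matrix `𝓒`-differential operators `∑_σ a_{ij}^σ D_σ`; `A σ i j` is `a_{ij}^σ`. -/
abbrev COp (n m : ℕ) := MI n → Fin m → Fin m → Pt n m → ℝ

/-- Over `Ω`, the operator has finite order and smooth coefficients. -/
def COp.IsCDiffOver (Ω : Set (EuclideanSpace ℝ (Fin n))) (A : COp n m) : Prop :=
  (∃ T : Finset (MI n), ∀ σ, σ ∉ T → ∀ i j, ∀ p : Pt n m, p.1 ∈ Ω → A σ i j p = 0) ∧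
    ∀ σ i j, SmoothOver Ω (A σ i j)

/-- `(A ξ)_i = ∑ a_{ij}^σ D_σ(ξ_j)`. -/
def COp.act (A : COp n m) (ξ : Field n m) : Field n m :=
  fun p i => ∑ᶠ σ : MI n, ∑ j, A σ i j p * totalDσ σ (fun q => ξ q j) p

/-- The adjoint operator: `(A^* ξ)_i = ∑ (-1)^{|σ|} D_σ(a_{ji}^σ ξ_j)`. -/
def COp.adj (A : COp n m) (ξ : Field n m) : Field n m :=
  fun p i => ∑ᶠ σ : MI n, ∑ j, (-1 : ℝ) ^ σ.degree * totalDσ σ (fun q => A σ j i q * ξ q j) p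

/-- The linearization `ℓ_φ`, with coefficients `∂φ^i/∂u^j_σ`; `ℓ_φ(α)` is the evolutionary field
of `α` applied to `φ`. -/
def lin (φ : Field n m) : COp n m := fun σ i j => dU j σ (fun q => φ q i)

/-- The operator `ℓ_{A,ψ} = ℓ_{A(ψ)} - A ∘ ℓ_ψ`: it sends `φ` to the result of applying to `ψ` the
operator whose coefficients are those of `A` differentiated along the evolutionary field of `φ`. -/
def linOf (A : COp n m) (ψ : Field n m) : COp n m :=
  fun τ i j p => ∑ᶠ σ : MI n, ∑ k, dU j τ (A σ i k) p * totalDσ σ (fun q => ψ q k) p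

/-- The Lie derivative `L_{D_t} = D_t - ℓ_f` on `κ`. -/
def lieVec (f φ : Field n m) : Field n m := Dt f φ - (lin f).act φ

/-- The Lie derivative `L_{D_t} = D_t + ℓ_f^*` on `κ̂`. -/
def lieCov (f ψ : Field n m) : Field n m := Dt f ψ + (lin f).adj ψ

/-- The variational Schouten bracket `⟦A,B⟧(ψ₁,ψ₂)` of two bivectors. -/
def bracket (A B : COp n m) (ψ₁ ψ₂ : Field n m) : Field n m :=
  (linOf A ψ₁).act (B.act ψ₂) - (linOf A ψ₂).act (B.act ψ₁)
    + (linOf B ψ₁).act (A.act ψ₂) - (linOf B ψ₂).act (A.act ψ₁)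
    - A.act ((linOf B ψ₂).adj ψ₁) - B.act ((linOf A ψ₂).adj ψ₁)

/-- The variational differential `(dΦ)(φ₁,φ₂)` of a 2-form.  Up to total divergences, its pairing
with `φ₃` is the cyclic sum over `1, 2, 3` of the pairings of `(E_{φ₁} Φ)(φ₂)` with `φ₃`, where
`E_φ Φ` is `Φ` with its coefficients differentiated along the evolutionary field of `φ`. -/
def diffForm (Φ : COp n m) (φ₁ φ₂ : Field n m) : Field n m :=
  (linOf Φ φ₂).act φ₁ - (linOf Φ φ₁).act φ₂ + (linOf Φ φ₁).adj φ₂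

/-- The matrix `λ(θ)` at `p` of the degree `l` part of the symbol of an operator. -/
def COp.symbol (A : COp n m) (l : ℕ) (p : Pt n m) (θ : Fin n → ℝ) :
    Matrix (Fin m) (Fin m) ℝ :=
  fun i j => ∑ σ ∈ Finset.finsuppAntidiag (Finset.univ : Finset (Fin n)) l,
    A σ i j p * ∏ k, θ k ^ σ k

/-! ### Adapted coordinates and transformation laws -/

/-- An adapted coordinate system: a smooth chart of `M` and a vector bundle trivialization. -/
structure BundleChart (n m : ℕ) {M : Type*} [TopologicalSpace M]
    [ChartedSpace (EuclideanSpace ℝ (Fin n)) M] (E : M → Type*)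
    [TopologicalSpace (TotalSpace (Fin m → ℝ) E)] [∀ x, TopologicalSpace (E x)]
    [FiberBundle (Fin m → ℝ) E] where
  base : OpenPartialHomeomorph M (EuclideanSpace ℝ (Fin n))
  base_mem : base ∈ IsManifold.maximalAtlas (𝓡 n) ∞ M
  triv : Trivialization (Fin m → ℝ) (TotalSpace.proj : TotalSpace (Fin m → ℝ) E → M)
  triv_mem : MemTrivializationAtlas triv

variable {M : Type*} [TopologicalSpace M] [ChartedSpace (EuclideanSpace ℝ (Fin n)) M]
  {E : M → Type*} [TopologicalSpace (TotalSpace (Fin m → ℝ) E)] [∀ x, TopologicalSpace (E x)]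
  [FiberBundle (Fin m → ℝ) E]

/-- The part of `M` on which the coordinates are defined. -/
def BundleChart.dom (c : BundleChart n m E) : Set M := c.base.source ∩ c.triv.baseSet

/-- The image of `c.dom` in `ℝⁿ`. -/
def BundleChart.Ω (c : BundleChart n m E) : Set (EuclideanSpace ℝ (Fin n)) :=
  c.base '' c.dom

/-- The image in the coordinates `c` of the common domain of `c` and `c'`. -/
def BundleChart.overlap (c c' : BundleChart n m E) : Set (EuclideanSpace ℝ (Fin n)) :=
  c.base '' (c.dom ∩ c'.dom)

/-- Fibre components of a vector `w ∈ E x`. -/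
def BundleChart.comp (c : BundleChart n m E) {x : M} (w : E x) : Fin m → ℝ :=
  (c.triv ⟨x, w⟩).2

/-- `s` is a smooth section of `E` near `x`. -/
def IsSectionNear (n m : ℕ) {M : Type*} [TopologicalSpace M]
    [ChartedSpace (EuclideanSpace ℝ (Fin n)) M] {E : M → Type*}
    [TopologicalSpace (TotalSpace (Fin m → ℝ) E)] [∀ x, TopologicalSpace (E x)]
    [FiberBundle (Fin m → ℝ) E] (s : ∀ x, E x) (x : M) : Prop :=
  ∀ᶠ y in 𝓝 x, ContMDiffAt (𝓡 n) ((𝓡 n).prod 𝓘(ℝ, Fin m → ℝ)) ∞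
    (fun z => TotalSpace.mk' (Fin m → ℝ) z (s z)) y

/-- Coordinates of the point `(j^∞_x s, t)`, i.e. `u^j_σ = ∂_σ s^j (x)`. -/
def BundleChart.jet (c : BundleChart n m E) (s : ∀ x, E x) (x : M) (t : ℝ) : Pt n m :=
  (c.base x, fun a => pderiv a.2 (fun y => c.comp (s (c.base.symm y)) a.1) (c.base x), t)

/-- `φ` in the coordinates `c` and `φ'` in the coordinates `c'` represent the same (possibly
`t`-dependent) element of `κ`, i.e. section of `π_∞^*(E)`: at each `(j^∞_x s, t)` both are the
components of the same vector of `E x`. -/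
def VecRel (c c' : BundleChart n m E) (φ φ' : Field n m) : Prop :=
  ∀ (s : ∀ x, E x) (x : M) (t : ℝ), x ∈ c.dom → x ∈ c'.dom → IsSectionNear n m s x →
    ∃ w : E x, φ (c.jet s x t) = c.comp w ∧ φ' (c'.jet s x t) = c'.comp w

/-- `ψ` in the coordinates `c` and `ψ'` in the coordinates `c'` represent the same (possibly
`t`-dependent) element of `κ̂ = Hom(κ, Λ̄ⁿ)`, where `ψ` stands for
`φ ↦ (∑ ψ_i φ^i) dx_1 ∧ … ∧ dx_n`. -/
def CovRel (c c' : BundleChart n m E) (ψ ψ' : Field n m) : Prop :=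
  ∀ (s : ∀ x, E x) (x : M) (t : ℝ), x ∈ c.dom → x ∈ c'.dom → IsSectionNear n m s x →
    ∀ w : E x, ψ (c.jet s x t) ⬝ᵥ c.comp w =
      (fderiv ℝ (c'.base ∘ c.base.symm) (c.base x)).det * (ψ' (c'.jet s x t) ⬝ᵥ c'.comp w)

/-! ### Evolution equations, bivectors and 2-forms -/

section Structures

variable (n m) (E)

/-- The right-hand side `f` of an evolution equation `u_t = f`: a `t`-dependent element of `κ`. -/
structure EvolutionEq where
  rhs : BundleChart n m E → Field n m
  smooth : ∀ c, SmoothField c.Ω (rhs c)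
  compat : ∀ c c', VecRel c c' (rhs c) (rhs c')

/-- A (possibly `t`-dependent) variational bivector: a skew-adjoint `𝓒`-differential operator
`κ̂ → κ`. -/
structure Bivector where
  op : BundleChart n m E → COp n m
  isCDiff : ∀ c, (op c).IsCDiffOver c.Ω
  compat : ∀ c c' ψ ψ', SmoothField (c.overlap c') ψ → SmoothField (c'.overlap c) ψ' →
    CovRel c c' ψ ψ' → VecRel c c' ((op c).act ψ) ((op c').act ψ')
  skew : ∀ c ψ, SmoothField c.Ω ψ → ∀ p : Pt n m, p.1 ∈ c.Ω →
    (op c).adj ψ p = - (op c).act ψ p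

/-- A (possibly `t`-dependent) variational 2-form: a skew-adjoint `𝓒`-differential operator
`κ → κ̂`. -/
structure TwoForm where
  op : BundleChart n m E → COp n m
  isCDiff : ∀ c, (op c).IsCDiffOver c.Ω
  compat : ∀ c c' φ φ', SmoothField (c.overlap c') φ → SmoothField (c'.overlap c) φ' →
    VecRel c c' φ φ' → CovRel c c' ((op c).act φ) ((op c').act φ')
  skew : ∀ c φ, SmoothField c.Ω φ → ∀ p : Pt n m, p.1 ∈ c.Ω →
    (op c).adj φ p = - (op c).act φ p

end Structures

/-- The order of the operator `ℓ_f` is `l`. -/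
def EvolutionEq.HasOrder (f : EvolutionEq n m E) (l : ℕ) : Prop :=
  IsGreatest {k : ℕ | ∃ (c : BundleChart n m E) (σ : MI n) (i j : Fin m) (p : Pt n m),
    p.1 ∈ c.Ω ∧ σ.degree = k ∧ lin (f.rhs c) σ i j p ≠ 0} l

/-- The degree `l` symbol of `ℓ_f` is nonsingular (its determinant is a nonzero polynomial in the
covector `θ`) on a dense open subset of `J^∞(π) × ℝ`. -/
def EvolutionEq.GenericallyNondegenerate (f : EvolutionEq n m E) (l : ℕ) : Prop :=
  ∀ c : BundleChart n m E, ∃ U : Set (Pt n m), IsOpen U ∧ U ⊆ {p | p.1 ∈ c.Ω} ∧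
    {p : Pt n m | p.1 ∈ c.Ω} ⊆ closure U ∧
    ∀ p ∈ U, ∃ θ : Fin n → ℝ, ((lin (f.rhs c)).symbol l p θ).det ≠ 0

/-- `A` is a variational bivector on the equation: `L_{D_t}(A) = 0`. -/
def Bivector.IsOn (A : Bivector n m E) (f : EvolutionEq n m E) : Prop :=
  ∀ c ψ, SmoothField c.Ω ψ → ∀ p : Pt n m, p.1 ∈ c.Ω →
    lieVec (f.rhs c) ((A.op c).act ψ) p - (A.op c).act (lieCov (f.rhs c) ψ) p = 0

/-- `Φ` is a variational 2-form on the equation: `L_{D_t}(Φ) = 0`. -/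
def TwoForm.IsOn (Φ : TwoForm n m E) (f : EvolutionEq n m E) : Prop :=
  ∀ c φ, SmoothField c.Ω φ → ∀ p : Pt n m, p.1 ∈ c.Ω →
    lieCov (f.rhs c) ((Φ.op c).act φ) p - (Φ.op c).act (lieVec (f.rhs c) φ) p = 0

/-- Compatibility: `⟦A,B⟧ = 0`. -/
def Bivector.Compatible (A B : Bivector n m E) : Prop :=
  ∀ c ψ₁ ψ₂, SmoothField c.Ω ψ₁ → SmoothField c.Ω ψ₂ → ∀ p : Pt n m, p.1 ∈ c.Ω →
    bracket (A.op c) (B.op c) ψ₁ ψ₂ p = 0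

/-- A Hamiltonian structure on the equation: a bivector on it with `⟦A,A⟧ = 0`. -/
def Bivector.IsHamiltonian (A : Bivector n m E) (f : EvolutionEq n m E) : Prop :=
  A.IsOn f ∧ A.Compatible A

/-- `dΦ = 0`. -/
def TwoForm.IsClosed (Φ : TwoForm n m E) : Prop :=
  ∀ c φ₁ φ₂, SmoothField c.Ω φ₁ → SmoothField c.Ω φ₂ → ∀ p : Pt n m, p.1 ∈ c.Ω →
    diffForm (Φ.op c) φ₁ φ₂ p = 0

/-- A symplectic structure on the equation: a closed variational 2-form on it. -/
def TwoForm.IsSymplectic (Φ : TwoForm n m E) (f : EvolutionEq n m E) : Prop :=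
  Φ.IsOn f ∧ Φ.IsClosed

end VarCalc

end

/-!
Let `f` be the right-hand side of the equation and `L` the Lie derivative along
`D_t = ∂_t + ∂_f`. Everything happens in one coordinate system, in the algebra of smooth functions
over the coordinate domain. The argument has two halves.

*Invariance.* The Schouten bracket `C` of two bivectors on the equation, and the differential `C`
of a 2-form on it, are again invariant: `L(C(ψ₁, ψ₂)) = C(Lψ₁, ψ₂) + C(ψ₁, Lψ₂)`. Writing
`A'[φ]` for the operator `A` with coefficients differentiated along the evolutionary derivation
of `φ`, one pairs `C(ψ₁, ψ₂)` with a third argument modulo total divergences. The result is an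
alternating sum of terms `⟨A'[φ]ψ, χ⟩`. Each of these fails to be invariant by terms in the second
variation `f''[φ]χ` of `f` (`quotDer_DT_pair_vary`), and these cancel because `f''` is symmetric
(`lie_bracket`, `lie_diffForm`). The identity is recovered from its pairings because the pairing
modulo total divergences is nondegenerate (`eq_zero_of_mul_mem_divs`, by the Euler operator).

*Symbols.* An invariant bidifferential operator `C` vanishes (`eq_zero_of_invariant`). Inserting
`exp(s θ₁·x) v₁` and `exp(s θ₂·x) v₂` and comparing the leading powers of `s`, its leading
symbol `c` satisfies
`p(θ₁ + θ₂) c(v₁, v₂) = c(r(θ₁) v₁, v₂) + c(v₁, r(θ₂) v₂)`,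
where, up to signs and transposition, `p` and `r` are the symbol `λ` of `ℓ_f`. For `θ₁ = θ` and
`θ₂ = s θ` the three terms are commuting operators with coefficients `(1 + s)^l`, `1`, `s^l`. If
this system were singular for every `s`, then common eigenvectors would give eigenvalues with
`(1 + s)^l ζ = ξ + s^l υ`, for one triple and infinitely many `s`; as `l > 1`, the coefficient of
`s` gives `ζ = 0`, which contradicts the nonsingularity of `p(θ)`. So the linear system for `c` is
nonsingular for some `(θ₁, θ₂)`, hence on an open set, and the polynomial `c` vanishes at each
point where the symbol of `ℓ_f` is nonsingular. By density and continuity `c` is zero, and one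
descends on the order of `C`.
-/

noncomputable section

namespace VarCalc

section

/-! ### Smooth functions of finitely many jet coordinates -/

variable {n m : ℕ}

/-- The linear projection of the coordinate space to the coordinates `x`, `t` and those `u^j_σ`
with `(j, σ) ∈ S`. -/
def jetProj (S : Finset (Fin m × MI n)) (p : Pt n m) :
    EuclideanSpace ℝ (Fin n) × (S → ℝ) × ℝ :=
  (p.1, fun a => p.2.1 a, p.2.2)

theorem continuous_jetProj (S : Finset (Fin m × MI n)) : Continuous (jetProj S) := by
  unfold jetProj
  fun_prop

/-- The function `F` is represented over `Ω` by a smooth function `G` of `x`, `t` and the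
`u^j_σ`, `(j, σ) ∈ S`. -/
def SmoothRep (Ω : Set (EuclideanSpace ℝ (Fin n))) (F : Pt n m → ℝ) (S : Finset (Fin m × MI n))
    (G : EuclideanSpace ℝ (Fin n) × (S → ℝ) × ℝ → ℝ) : Prop :=
  ContDiffOn ℝ ∞ G (Ω ×ˢ univ) ∧ ∀ p : Pt n m, p.1 ∈ Ω → F p = G (jetProj S p)

theorem SmoothRep.mono {Ω : Set (EuclideanSpace ℝ (Fin n))} {F : Pt n m → ℝ}
    {S S' : Finset (Fin m × MI n)} {G} (h : SmoothRep Ω F S G) (hS : S ⊆ S') :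
    ∃ G', SmoothRep Ω F S' G' := by
  refine ⟨fun y => G (y.1, fun a => y.2.1 ⟨a, hS a.2⟩, y.2.2), ?_, fun p hp => h.2 p hp⟩
  refine h.1.comp (t := Ω ×ˢ univ) (f := fun y : EuclideanSpace ℝ (Fin n) × (S' → ℝ) × ℝ =>
    (y.1, (fun a : S => y.2.1 ⟨a, hS a.2⟩), y.2.2)) ?_ ?_
  · apply ContDiff.contDiffOn
    fun_prop
  · rintro y ⟨hy, -⟩
    exact ⟨hy, mem_univ _⟩

/-- Any two functions smooth over `Ω` depend on a common finite set of jet coordinates. -/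
theorem SmoothOver.common {Ω : Set (EuclideanSpace ℝ (Fin n))} {F F' : Pt n m → ℝ}
    (h : SmoothOver Ω F) (h' : SmoothOver Ω F') :
    ∃ S G G', SmoothRep Ω F S G ∧ SmoothRep Ω F' S G' := by
  classical
  obtain ⟨S, G, hG⟩ := h
  obtain ⟨S', G', hG'⟩ := h'
  obtain ⟨G₁, h₁⟩ := SmoothRep.mono (F := F) hG (Finset.subset_union_left (s₂ := S'))
  obtain ⟨G₂, h₂⟩ := SmoothRep.mono (F := F') hG' (Finset.subset_union_right (s₁ := S))
  exact ⟨_, G₁, G₂, h₁, h₂⟩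

theorem SmoothOver.add {Ω : Set (EuclideanSpace ℝ (Fin n))} {F F' : Pt n m → ℝ}
    (h : SmoothOver Ω F) (h' : SmoothOver Ω F') : SmoothOver Ω (F + F') := by
  obtain ⟨S, G, G', hG, hG'⟩ := h.common h'
  exact ⟨S, G + G', hG.1.add hG'.1, fun p hp => congrArg₂ (· + ·) (hG.2 p hp) (hG'.2 p hp)⟩

theorem SmoothOver.mul {Ω : Set (EuclideanSpace ℝ (Fin n))} {F F' : Pt n m → ℝ}
    (h : SmoothOver Ω F) (h' : SmoothOver Ω F') : SmoothOver Ω (F * F') := by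
  obtain ⟨S, G, G', hG, hG'⟩ := h.common h'
  exact ⟨S, G * G', hG.1.mul hG'.1, fun p hp => congrArg₂ (· * ·) (hG.2 p hp) (hG'.2 p hp)⟩

theorem SmoothOver.const (Ω : Set (EuclideanSpace ℝ (Fin n))) (r : ℝ) :
    SmoothOver Ω (fun _ : Pt n m => r) :=
  ⟨∅, fun _ => r, contDiffOn_const, fun _ _ => rfl⟩

theorem SmoothOver.congr {Ω : Set (EuclideanSpace ℝ (Fin n))} {F F' : Pt n m → ℝ}
    (h : SmoothOver Ω F) (hF : ∀ p : Pt n m, p.1 ∈ Ω → F' p = F p) : SmoothOver Ω F' := by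
  obtain ⟨S, G, hG⟩ := h
  exact ⟨S, G, hG.1, fun p hp => (hF p hp).trans (hG.2 p hp)⟩

theorem smoothOver_coord (Ω : Set (EuclideanSpace ℝ (Fin n))) (a : Fin m × MI n) :
    SmoothOver Ω (fun p : Pt n m => p.2.1 a) := by
  refine ⟨{a}, fun y => y.2.1 ⟨a, Finset.mem_singleton_self a⟩, ?_, fun _ _ => rfl⟩
  apply ContDiff.contDiffOn
  fun_prop

theorem smoothOver_exp (Ω : Set (EuclideanSpace ℝ (Fin n))) (θ : Fin n → ℝ) :
    SmoothOver Ω (fun p : Pt n m => Real.exp (∑ i, θ i * p.1 i)) := by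
  refine ⟨∅, fun y => Real.exp (∑ i, θ i * y.1 i), ?_, fun _ _ => rfl⟩
  apply ContDiff.contDiffOn
  fun_prop

theorem SmoothOver.continuousOn {Ω : Set (EuclideanSpace ℝ (Fin n))} {F : Pt n m → ℝ}
    (h : SmoothOver Ω F) : ContinuousOn F {p | p.1 ∈ Ω} := by
  obtain ⟨S, G, hG, hF⟩ := h
  have hc : ContinuousOn (G ∘ jetProj S) {p : Pt n m | p.1 ∈ Ω} :=
    hG.continuousOn.comp (continuous_jetProj S).continuousOn fun p hp => ⟨hp, mem_univ _⟩
  exact hc.congr hF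

variable {Ω : Set (EuclideanSpace ℝ (Fin n))}

/-- A line through a point over the open set `Ω` stays over `Ω` for small times. -/
theorem eventually_mem_of_isOpen (hΩ : IsOpen Ω) {p : Pt n m} (hp : p.1 ∈ Ω) (v : Pt n m) :
    ∀ᶠ s : ℝ in 𝓝 0, (p + s • v).1 ∈ Ω := by
  have hc : Continuous fun s : ℝ => (p + s • v).1 := by fun_prop
  apply hc.continuousAt.eventually_mem
  simpa using hΩ.mem_nhds hp

theorem SmoothRep.hasLineDerivAt (hΩ : IsOpen Ω) {F : Pt n m → ℝ} {S : Finset (Fin m × MI n)} {G}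
    (h : SmoothRep Ω F S G) {p : Pt n m} (hp : p.1 ∈ Ω) (v : Pt n m) :
    HasLineDerivAt ℝ F (fderiv ℝ G (jetProj S p) (jetProj S v)) p v := by
  have hmem : Ω ×ˢ univ ∈ 𝓝 (jetProj S p) :=
    (hΩ.prod isOpen_univ).mem_nhds ⟨hp, mem_univ _⟩
  have hd : DifferentiableAt ℝ G (jetProj S p) :=
    (h.1.differentiableOn (by simp)).differentiableAt hmem
  have hl := hd.hasFDerivAt.hasLineDerivAt (jetProj S v)
  refine HasDerivAt.congr_of_eventuallyEq hl ?_
  filter_upwards [eventually_mem_of_isOpen hΩ hp v] with s hs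
  exact h.2 _ hs

theorem SmoothRep.lineDeriv (hΩ : IsOpen Ω) {F : Pt n m → ℝ} {S : Finset (Fin m × MI n)} {G}
    (h : SmoothRep Ω F S G) (v : Pt n m) :
    SmoothRep Ω (fun p => lineDeriv ℝ F p v) S (fun y => fderiv ℝ G y (jetProj S v)) := by
  refine ⟨?_, fun p hp => (h.hasLineDerivAt hΩ hp v).lineDeriv⟩
  exact (h.1.fderiv_of_isOpen (hΩ.prod isOpen_univ) (by simp)).clm_apply contDiffOn_const

theorem SmoothOver.hasLineDerivAt (hΩ : IsOpen Ω) {F : Pt n m → ℝ} (h : SmoothOver Ω F)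
    {p : Pt n m} (hp : p.1 ∈ Ω) (v : Pt n m) :
    HasLineDerivAt ℝ F (lineDeriv ℝ F p v) p v := by
  obtain ⟨S, G, hG⟩ := h
  have := SmoothRep.hasLineDerivAt (F := F) hΩ hG hp v
  rwa [this.lineDeriv]

theorem SmoothOver.lineDeriv (hΩ : IsOpen Ω) {F : Pt n m → ℝ} (h : SmoothOver Ω F)
    (v : Pt n m) : SmoothOver Ω (fun p => lineDeriv ℝ F p v) := by
  obtain ⟨S, G, hG⟩ := h
  exact ⟨S, _, SmoothRep.lineDeriv (F := F) hΩ hG v⟩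

theorem SmoothOver.lineDeriv_comm (hΩ : IsOpen Ω) {F : Pt n m → ℝ} (h : SmoothOver Ω F)
    (v w : Pt n m) {p : Pt n m} (hp : p.1 ∈ Ω) :
    _root_.lineDeriv ℝ (fun q => _root_.lineDeriv ℝ F q v) p w =
      _root_.lineDeriv ℝ (fun q => _root_.lineDeriv ℝ F q w) p v := by
  obtain ⟨S, G, hG⟩ := h
  have hG : SmoothRep Ω F S G := hG
  rw [((hG.lineDeriv hΩ v).hasLineDerivAt hΩ hp w).lineDeriv,
    ((hG.lineDeriv hΩ w).hasLineDerivAt hΩ hp v).lineDeriv]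
  have hmem : Ω ×ˢ univ ∈ 𝓝 (jetProj S p) :=
    (hΩ.prod isOpen_univ).mem_nhds ⟨hp, mem_univ _⟩
  have hat : ContDiffAt ℝ ∞ G (jetProj S p) := hG.1.contDiffAt hmem
  have hd : DifferentiableAt ℝ (fderiv ℝ G) (jetProj S p) :=
    (hat.fderiv_right (m := 1) (by norm_cast)).differentiableAt (by simp)
  have hs := (hat.isSymmSndFDerivAt (by
    simpa using WithTop.coe_le_coe.2 (le_top (a := (2 : ℕ∞))))).eq (jetProj S v) (jetProj S w)
  rw [fderiv_clm_apply hd (differentiableAt_const _), fderiv_clm_apply hd (differentiableAt_const _)]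
  simpa using hs.symm

theorem SmoothOver.lineDeriv_single_eq_zero (hΩ : IsOpen Ω) {F : Pt n m → ℝ}
    (h : SmoothOver Ω F) : {a : Fin m × MI n | ∃ p : Pt n m, p.1 ∈ Ω ∧
      _root_.lineDeriv ℝ F p (0, Pi.single a 1, 0) ≠ 0}.Finite := by
  classical
  obtain ⟨S, G, hG⟩ := h
  refine S.finite_toSet.subset ?_
  rintro a ⟨p, hp, ha⟩
  by_contra hS
  apply ha
  rw [(SmoothRep.hasLineDerivAt (F := F) hΩ hG hp _).lineDeriv]
  have : jetProj S ((0, Pi.single a 1, 0) : Pt n m) = 0 := by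
    refine Prod.ext rfl (Prod.ext (funext fun b => ?_) rfl)
    have hb : (b : Fin m × MI n) ≠ a := fun e => hS (e ▸ b.2)
    simp [jetProj, Pi.single_eq_of_ne hb]
  rw [this, map_zero]

theorem lineDeriv_congr_over (hΩ : IsOpen Ω) {F F' : Pt n m → ℝ}
    (h : ∀ p : Pt n m, p.1 ∈ Ω → F p = F' p) {p : Pt n m} (hp : p.1 ∈ Ω) (v : Pt n m) :
    lineDeriv ℝ F p v = lineDeriv ℝ F' p v := by
  apply Filter.EventuallyEq.deriv_eq
  filter_upwards [eventually_mem_of_isOpen hΩ hp v] with s hs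
  exact h _ hs

theorem dX_eq_lineDeriv (i : Fin n) (F : Pt n m → ℝ) (p : Pt n m) :
    dX i F p = lineDeriv ℝ F p (EuclideanSpace.single i 1, 0, 0) := by
  unfold dX lineDeriv
  congr 1
  funext s
  congr 1
  ext <;> simp

theorem dU_eq_lineDeriv (j : Fin m) (σ : MI n) (F : Pt n m → ℝ) (p : Pt n m) :
    dU j σ F p = lineDeriv ℝ F p (0, Pi.single (j, σ) 1, 0) := by
  classical
  unfold dU lineDeriv
  have := deriv_comp_const_add
    (fun s : ℝ => F (p.1, Function.update p.2.1 (j, σ) s, p.2.2)) (p.2.1 (j, σ)) 0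
  rw [add_zero] at this
  rw [← this]
  congr 1
  funext s
  congr 1
  refine Prod.ext (by simp) (Prod.ext (funext fun a => ?_) (by simp))
  by_cases ha : a = (j, σ)
  · subst ha; simp
  · simp [Function.update_of_ne ha, Pi.single_eq_of_ne ha]

theorem dT_eq_lineDeriv (F : Pt n m → ℝ) (p : Pt n m) :
    dT F p = lineDeriv ℝ F p (0, 0, 1) := by
  unfold dT lineDeriv
  have := deriv_comp_const_add (fun s : ℝ => F (p.1, p.2.1, s)) p.2.2 0
  rw [add_zero] at this
  rw [← this]
  congr 1
  funext s
  congr 1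
  ext <;> simp

/-! ### The algebra of smooth functions on the jet space over an open set -/

/-- The algebra of functions on the part of the coordinate space over `Ω` that are smooth, i.e.
`C^∞` functions of `x`, `t` and finitely many `u^j_σ`. -/
def jetFun (m : ℕ) (Ω : TopologicalSpace.Opens (EuclideanSpace ℝ (Fin n))) :
    Subalgebra ℝ ({p : Pt n m // p.1 ∈ Ω} → ℝ) where
  carrier := {g | ∃ F : Pt n m → ℝ, SmoothOver (Ω : Set _) F ∧ ∀ p, g p = F p}
  mul_mem' := by
    rintro g g' ⟨F, hF, h⟩ ⟨F', hF', h'⟩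
    exact ⟨F * F', hF.mul hF', fun p => congrArg₂ (· * ·) (h p) (h' p)⟩
  add_mem' := by
    rintro g g' ⟨F, hF, h⟩ ⟨F', hF', h'⟩
    exact ⟨F + F', hF.add hF', fun p => congrArg₂ (· + ·) (h p) (h' p)⟩
  algebraMap_mem' := fun r => ⟨fun _ => r, SmoothOver.const _ r, fun _ => rfl⟩

variable {Ω : TopologicalSpace.Opens (EuclideanSpace ℝ (Fin n))}

/-- The function `F` on the coordinate space restricts over `Ω` to the element `g`. -/
def Represents (F : Pt n m → ℝ) (g : jetFun m Ω) : Prop :=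
  ∀ p : {p : Pt n m // p.1 ∈ Ω}, F p = g.1 p

theorem Represents.smoothOver {F : Pt n m → ℝ} {g : jetFun m Ω} (h : Represents F g) :
    SmoothOver (Ω : Set _) F := by
  obtain ⟨F', hF', h'⟩ := g.2
  exact hF'.congr fun p hp => (h ⟨p, hp⟩).trans (h' ⟨p, hp⟩)

theorem exists_represents (g : jetFun m Ω) : ∃ F : Pt n m → ℝ, Represents F g :=
  ⟨_, fun p => (g.2.choose_spec.2 p).symm⟩

theorem SmoothOver.exists_represents {F : Pt n m → ℝ} (h : SmoothOver (Ω : Set _) F) :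
    ∃ g : jetFun m Ω, Represents F g :=
  ⟨⟨fun p => F p, F, h, fun _ => rfl⟩, fun _ => rfl⟩

theorem Represents.unique {F : Pt n m → ℝ} {g g' : jetFun m Ω} (h : Represents F g)
    (h' : Represents F g') : g = g' :=
  Subtype.ext (funext fun p => (h p).symm.trans (h' p))

theorem Represents.add {F F' : Pt n m → ℝ} {g g' : jetFun m Ω} (h : Represents F g)
    (h' : Represents F' g') : Represents (fun p => F p + F' p) (g + g') :=
  fun p => congrArg₂ (· + ·) (h p) (h' p)

theorem Represents.mul {F F' : Pt n m → ℝ} {g g' : jetFun m Ω} (h : Represents F g)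
    (h' : Represents F' g') : Represents (fun p => F p * F' p) (g * g') :=
  fun p => congrArg₂ (· * ·) (h p) (h' p)

theorem Represents.const (r : ℝ) :
    Represents (fun _ : Pt n m => r) (algebraMap ℝ (jetFun m Ω) r) := fun _ => rfl

theorem Represents.sum {ι : Type*} (s : Finset ι) {F : ι → Pt n m → ℝ} {g : ι → jetFun m Ω}
    (h : ∀ a ∈ s, Represents (F a) (g a)) :
    Represents (fun p => ∑ a ∈ s, F a p) (∑ a ∈ s, g a) := by
  intro p
  rw [AddSubmonoidClass.coe_finsetSum, Finset.sum_apply]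
  exact Finset.sum_congr rfl fun a ha => h a ha p

/-- The derivative of a smooth function along a constant vector. -/
def jetDerivFun (v : Pt n m) (g : jetFun m Ω) : jetFun m Ω :=
  ⟨fun p => lineDeriv ℝ (exists_represents g).choose p v, _,
    (exists_represents g).choose_spec.smoothOver.lineDeriv Ω.2 v, fun _ => rfl⟩

theorem Represents.lineDeriv_fun {F : Pt n m → ℝ} {g : jetFun m Ω} (h : Represents F g)
    (v : Pt n m) : Represents (fun p => lineDeriv ℝ F p v) (jetDerivFun v g) := by
  intro p
  refine lineDeriv_congr_over Ω.2 (fun q hq => ?_) p.2 v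
  exact (h ⟨q, hq⟩).trans ((exists_represents g).choose_spec ⟨q, hq⟩).symm

theorem jetDerivFun_add (v : Pt n m) (g g' : jetFun m Ω) :
    jetDerivFun v (g + g') = jetDerivFun v g + jetDerivFun v g' := by
  obtain ⟨F, h⟩ := exists_represents g
  obtain ⟨F', h'⟩ := exists_represents g'
  refine ((h.add h').lineDeriv_fun v).unique fun p => ?_
  rw [← ((h.lineDeriv_fun v).add (h'.lineDeriv_fun v)) p]
  exact HasLineDerivAt.lineDeriv (HasDerivAt.add (h.smoothOver.hasLineDerivAt Ω.2 p.2 v)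
    (h'.smoothOver.hasLineDerivAt Ω.2 p.2 v))

theorem jetDerivFun_mul (v : Pt n m) (g g' : jetFun m Ω) :
    jetDerivFun v (g * g') = g * jetDerivFun v g' + g' * jetDerivFun v g := by
  obtain ⟨F, h⟩ := exists_represents g
  obtain ⟨F', h'⟩ := exists_represents g'
  refine ((h.mul h').lineDeriv_fun v).unique fun p => ?_
  rw [← ((h.mul (h'.lineDeriv_fun v)).add (h'.mul (h.lineDeriv_fun v))) p]
  have hd : HasLineDerivAt ℝ (fun q => F q * F' q) _ p.1 v :=
    HasDerivAt.mul (h.smoothOver.hasLineDerivAt Ω.2 p.2 v)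
      (h'.smoothOver.hasLineDerivAt Ω.2 p.2 v)
  refine hd.lineDeriv.trans ?_
  simp only [zero_smul, add_zero]
  ring

theorem jetDerivFun_smul (v : Pt n m) (r : ℝ) (g : jetFun m Ω) :
    jetDerivFun v (r • g) = r • jetDerivFun v g := by
  obtain ⟨F, h⟩ := exists_represents g
  have hr : Represents (fun p => r * F p) (r • g) := fun p => congrArg (r * ·) (h p)
  refine (hr.lineDeriv_fun v).unique fun p => ?_
  have h₀ : HasDerivAt (fun s : ℝ => F (p.1 + s • v)) _ 0 :=
    h.smoothOver.hasLineDerivAt Ω.2 p.2 v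
  have hd : HasLineDerivAt ℝ (fun q => r * F q) _ p.1 v := h₀.const_mul r
  refine hd.lineDeriv.trans ?_
  exact congrArg (r * ·) (h.lineDeriv_fun v p)

/-- The derivative along a constant vector, as a derivation of the algebra of smooth functions. -/
def jetDeriv (v : Pt n m) : Derivation ℝ (jetFun m Ω) (jetFun m Ω) :=
  Derivation.mk'
    { toFun := jetDerivFun v
      map_add' := jetDerivFun_add v
      map_smul' := jetDerivFun_smul v } (jetDerivFun_mul v)

theorem Represents.lineDeriv {F : Pt n m → ℝ} {g : jetFun m Ω} (h : Represents F g)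
    (v : Pt n m) : Represents (fun p => lineDeriv ℝ F p v) (jetDeriv v g) :=
  h.lineDeriv_fun v

theorem jetDeriv_comm (v w : Pt n m) (g : jetFun m Ω) :
    jetDeriv v (jetDeriv w g) = jetDeriv w (jetDeriv v g) := by
  obtain ⟨F, hF⟩ := exists_represents g
  refine Subtype.ext (funext fun p => ?_)
  rw [← (hF.lineDeriv w).lineDeriv v p, ← (hF.lineDeriv v).lineDeriv w p]
  exact hF.smoothOver.lineDeriv_comm Ω.2 w v p.2

theorem jetDeriv_single_finite (g : jetFun m Ω) :
    {a : Fin m × MI n | jetDeriv (0, Pi.single a 1, 0) g ≠ 0}.Finite := by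
  obtain ⟨F, hF⟩ := exists_represents g
  refine (hF.smoothOver.lineDeriv_single_eq_zero Ω.2).subset ?_
  intro a ha
  by_contra hn
  apply ha
  refine Subtype.ext (funext fun p => ?_)
  rw [← hF.lineDeriv _ p]
  by_contra h0
  exact hn ⟨p, p.2, h0⟩

/-- The coordinate `u^j_σ`. -/
def jetCoord (a : Fin m × MI n) : jetFun m Ω :=
  ⟨fun p => p.1.2.1 a, _, smoothOver_coord _ a, fun _ => rfl⟩

/-- The function `exp (∑ θ_i x_i)`. -/
def jetExp (θ : Fin n → ℝ) : jetFun m Ω :=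
  ⟨fun p => Real.exp (∑ i, θ i * p.1.1 i), _, smoothOver_exp _ θ, fun _ => rfl⟩

theorem jetDeriv_jetCoord (v : Pt n m) (a : Fin m × MI n) :
    jetDeriv v (jetCoord a : jetFun m Ω) = algebraMap ℝ _ (v.2.1 a) := by
  have h : Represents (fun p : Pt n m => p.2.1 a) (jetCoord a : jetFun m Ω) := fun _ => rfl
  refine (h.lineDeriv v).unique fun p => ?_
  refine HasLineDerivAt.lineDeriv ?_
  have : HasDerivAt (fun s : ℝ => p.1.2.1 a + s * v.2.1 a) (1 * v.2.1 a) 0 :=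
    ((hasDerivAt_id (0 : ℝ)).mul_const _).const_add _
  rw [one_mul] at this
  exact this

theorem jetDeriv_jetExp (v : Pt n m) (θ : Fin n → ℝ) :
    jetDeriv v (jetExp θ : jetFun m Ω) =
      algebraMap ℝ _ (∑ i, θ i * v.1 i) * jetExp θ := by
  have h : Represents (fun p : Pt n m => Real.exp (∑ i, θ i * p.1 i))
    (jetExp θ : jetFun m Ω) := fun _ => rfl
  refine (h.lineDeriv v).unique fun p => ?_
  refine HasLineDerivAt.lineDeriv ?_
  have h1 : HasDerivAt (fun s : ℝ => ∑ i, θ i * (p.1.1 i + s * v.1 i))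
      (∑ i, θ i * (1 * v.1 i)) 0 :=
    HasDerivAt.fun_sum fun i _ =>
      (((hasDerivAt_id (0 : ℝ)).mul_const _).const_add _).const_mul _
  refine h1.exp.congr_deriv ?_
  simp only [zero_mul, add_zero, one_mul]
  rw [mul_comm]
  rfl

end

section

/-! ### Jet algebras and their evolutionary derivations -/

/-- The algebraic structure of the functions on the jet space in one coordinate system: commuting
partial derivatives `dx`, `dt`, `du` such that each function depends on finitely many of the
coordinates `u`, the exponentials of linear functions of `x`, and real points separating the
functions. Here `dx i`, `dt` and `du σ j` are `∂/∂x_i`, `∂/∂t` and `∂/∂u^j_σ`, `u σ j` is the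
coordinate `u^j_σ`, and `ex θ` is `exp (∑ θ_i x_i)`. -/
class JetAlgebra (n m : outParam ℕ) (F : Type*) [CommRing F] [Algebra ℝ F] where
  dx : Fin n → Derivation ℝ F F
  dt : Derivation ℝ F F
  du : MI n → Fin m → Derivation ℝ F F
  u : MI n → Fin m → F
  ex : (Fin n → ℝ) → F
  dx_dx : ∀ i k g, dx i (dx k g) = dx k (dx i g)
  dt_dx : ∀ i g, dt (dx i g) = dx i (dt g)
  dx_du : ∀ i σ j g, dx i (du σ j g) = du σ j (dx i g)
  dt_du : ∀ σ j g, dt (du σ j g) = du σ j (dt g)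
  du_du : ∀ σ j τ k g, du σ j (du τ k g) = du τ k (du σ j g)
  exists_du_eq_zero : ∀ g, ∃ T : Finset (MI n), ∀ σ, σ ∉ T → ∀ j, du σ j g = 0
  dx_u : ∀ i σ j, dx i (u σ j) = 0
  dt_u : ∀ σ j, dt (u σ j) = 0
  du_u : ∀ σ j τ k, du σ j (u τ k) = if τ = σ ∧ k = j then 1 else 0
  dx_ex : ∀ i θ, dx i (ex θ) = algebraMap ℝ F (θ i) * ex θ
  dt_ex : ∀ θ, dt (ex θ) = 0
  du_ex : ∀ σ j θ, du σ j (ex θ) = 0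
  ex_add : ∀ θ θ', ex (θ + θ') = ex θ * ex θ'
  ex_zero : ex 0 = 1
  ext_points : ∀ g : F, (∀ ev : F →ₐ[ℝ] ℝ, ev g = 0) → g = 0

open JetAlgebra

variable {n m : ℕ} {F : Type*} [CommRing F] [Algebra ℝ F] [JetAlgebra n m F]

/-- A finite set of multi-indices containing all those on which `g` depends. -/
def orders (g : F) : Finset (MI n) := (exists_du_eq_zero (n := n) (m := m) g).choose

theorem du_eq_zero {g : F} {σ : MI n} (h : σ ∉ orders g) (j : Fin m) : du σ j g = 0 :=
  (exists_du_eq_zero (n := n) (m := m) g).choose_spec σ h j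

/-- The vertical vector field `∑ X σ j ∂/∂u^j_σ` applied to `g`. -/
def vertFun (X : MI n → Fin m → F) (g : F) : F := ∑ᶠ σ : MI n, ∑ j, X σ j * du σ j g

theorem vertFun_eq_sum (X : MI n → Fin m → F) {g : F} {T : Finset (MI n)}
    (hT : ∀ σ, σ ∉ T → ∀ j, du σ j g = 0) :
    vertFun X g = ∑ σ ∈ T, ∑ j, X σ j * du σ j g := by
  refine finsum_eq_sum_of_support_subset _ fun σ hσ => ?_
  by_contra h
  apply hσ
  exact Finset.sum_eq_zero fun j _ => by rw [hT σ h j, mul_zero]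

/-- Two functions depend on a common finite set of jet coordinates. -/
theorem exists_common_orders (g g' : F) : ∃ T : Finset (MI n),
    (∀ σ, σ ∉ T → ∀ j, du σ j g = 0) ∧ ∀ σ, σ ∉ T → ∀ j, du σ j g' = 0 := by
  classical
  refine ⟨orders g ∪ orders g', fun σ h j => ?_, fun σ h j => ?_⟩ <;>
    rw [Finset.mem_union, not_or] at h
  · exact du_eq_zero h.1 j
  · exact du_eq_zero h.2 j

/-- The vertical vector field `∑ X σ j ∂/∂u^j_σ`. -/
def vert (X : MI n → Fin m → F) : Derivation ℝ F F :=
  Derivation.mk'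
    { toFun := vertFun X
      map_add' := by
        intro g g'
        obtain ⟨T, h, h'⟩ := exists_common_orders g g'
        rw [vertFun_eq_sum X h, vertFun_eq_sum X h', vertFun_eq_sum X (T := T)
          (fun σ hσ j => by rw [map_add, h σ hσ, h' σ hσ, add_zero])]
        simp only [map_add, mul_add, Finset.sum_add_distrib]
      map_smul' := by
        intro r g
        have h : ∀ σ, σ ∉ orders g → ∀ j, du σ j g = 0 := fun σ h j => du_eq_zero h j
        rw [vertFun_eq_sum X h, vertFun_eq_sum X (T := orders g)
          (fun σ hσ j => by rw [Derivation.map_smul, h σ hσ, smul_zero])]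
        simp only [Derivation.map_smul, mul_smul_comm, Finset.smul_sum, RingHom.id_apply] }
    (by
      intro g g'
      obtain ⟨T, h, h'⟩ := exists_common_orders g g'
      change vertFun X _ = g • vertFun X _ + g' • vertFun X _
      rw [vertFun_eq_sum X h, vertFun_eq_sum X h', vertFun_eq_sum X (T := T)
        (fun σ hσ j => by rw [Derivation.leibniz, h σ hσ, h' σ hσ, smul_zero, smul_zero, add_zero])]
      simp only [Derivation.leibniz, smul_eq_mul, Finset.mul_sum, ← Finset.sum_add_distrib]
      refine Finset.sum_congr rfl fun σ _ => Finset.sum_congr rfl fun j _ => ?_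
      ring)

theorem vert_eq_sum (X : MI n → Fin m → F) {g : F} {T : Finset (MI n)}
    (hT : ∀ σ, σ ∉ T → ∀ j, du σ j g = 0) :
    vert X g = ∑ σ ∈ T, ∑ j, X σ j * du σ j g := vertFun_eq_sum X hT

theorem vert_add (X Y : MI n → Fin m → F) (g : F) :
    vert (fun σ j => X σ j + Y σ j) g = vert X g + vert Y g := by
  have h : ∀ σ, σ ∉ orders g → ∀ j, du σ j g = 0 := fun σ h j => du_eq_zero h j
  rw [vert_eq_sum _ h, vert_eq_sum _ h, vert_eq_sum _ h]
  simp only [add_mul, Finset.sum_add_distrib]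

theorem vert_sub (X Y : MI n → Fin m → F) (g : F) :
    vert (fun σ j => X σ j - Y σ j) g = vert X g - vert Y g := by
  have h : ∀ σ, σ ∉ orders g → ∀ j, du σ j g = 0 := fun σ h j => du_eq_zero h j
  rw [vert_eq_sum _ h, vert_eq_sum _ h, vert_eq_sum _ h]
  simp only [sub_mul, Finset.sum_sub_distrib]

theorem vert_zero (g : F) : vert (fun _ _ => 0 : MI n → Fin m → F) g = 0 := by
  have h : ∀ σ, σ ∉ orders g → ∀ j, du σ j g = 0 := fun σ h j => du_eq_zero h j
  rw [vert_eq_sum _ h]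
  simp

theorem vert_u (X : MI n → Fin m → F) (σ : MI n) (j : Fin m) : vert X (u σ j) = X σ j := by
  rw [vert_eq_sum X (T := {σ}) (fun τ hτ k => by
    rw [du_u, if_neg]; rintro ⟨rfl, -⟩; exact hτ (Finset.mem_singleton_self _))]
  simp [du_u]

/-- A derivation commuting with all `∂/∂u^j_σ` acts on a vertical field through its
components. -/
theorem commute_vert (δ : Derivation ℝ F F) (hδ : ∀ σ j g, δ (du σ j g) = du σ j (δ g))
    (X : MI n → Fin m → F) (g : F) :
    δ (vert X g) = vert (fun σ j => δ (X σ j)) g + vert X (δ g) := by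
  have h : ∀ σ, σ ∉ orders g → ∀ j, du σ j g = 0 := fun σ h j => du_eq_zero h j
  have h' : ∀ σ, σ ∉ orders g → ∀ j, du σ j (δ g) = 0 := fun σ hσ j => by
    rw [← hδ, h σ hσ, map_zero]
  rw [vert_eq_sum _ h, vert_eq_sum _ h, vert_eq_sum _ h']
  simp only [map_sum, Derivation.leibniz, smul_eq_mul, hδ, ← Finset.sum_add_distrib]
  refine Finset.sum_congr rfl fun σ _ => Finset.sum_congr rfl fun j _ => ?_
  ring

/-- The commutator of two vertical fields. -/
theorem vert_vert (X Y : MI n → Fin m → F) (g : F) :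
    vert X (vert Y g) =
      vert Y (vert X g) + vert (fun σ j => vert X (Y σ j) - vert Y (X σ j)) g := by
  have h : ∀ σ, σ ∉ orders g → ∀ j, du σ j g = 0 := fun σ h j => du_eq_zero h j
  have h' : ∀ τ k, ∀ σ, σ ∉ orders g → ∀ j, du σ j (du τ k g) = 0 := fun τ k σ hσ j => by
    rw [du_du, h σ hσ, map_zero]
  -- The first-order part of the composition, and its second-order part, symmetric in `X` and `Y`.
  have key : ∀ X Y : MI n → Fin m → F, vert X (vert Y g) =
      vert (fun σ j => vert X (Y σ j)) g + ∑ σ ∈ orders g, ∑ j, ∑ τ ∈ orders g, ∑ k,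
        Y σ j * X τ k * du τ k (du σ j g) := by
    intro X Y
    rw [vert_eq_sum Y h, vert_eq_sum _ h]
    simp only [map_sum, Derivation.leibniz, smul_eq_mul, ← Finset.sum_add_distrib]
    refine Finset.sum_congr rfl fun σ _ => Finset.sum_congr rfl fun j _ => ?_
    rw [vert_eq_sum X (h' σ j), add_comm, mul_comm (du σ j g)]
    simp only [Finset.mul_sum, mul_assoc]
  have sym : (∑ σ ∈ orders g, ∑ j, ∑ τ ∈ orders g, ∑ k, Y σ j * X τ k * du τ k (du σ j g)) =
      ∑ σ ∈ orders g, ∑ j, ∑ τ ∈ orders g, ∑ k, X σ j * Y τ k * du τ k (du σ j g) := by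
    simp only [← Finset.sum_product' (orders g) Finset.univ]
    rw [Finset.sum_comm]
    refine Finset.sum_congr rfl fun a _ => Finset.sum_congr rfl fun b _ => ?_
    rw [du_du, mul_comm (Y _ _)]
  rw [key X Y, key Y X, vert_sub, sym]
  ring

/-! ### Total derivatives -/

/-- The total derivative `D_i = ∂/∂x_i + ∑ u^j_{σi} ∂/∂u^j_σ`. -/
def D (i : Fin n) : Derivation ℝ F F :=
  dx i + vert (fun σ j => u (σ + Finsupp.single i 1) j)

theorem D_apply (i : Fin n) (g : F) :
    D i g = dx i g + vert (fun σ j => u (σ + Finsupp.single i 1) j) g := rfl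

theorem D_u (i : Fin n) (σ : MI n) (j : Fin m) :
    D i (u σ j : F) = u (σ + Finsupp.single i 1) j := by
  rw [D_apply, dx_u, vert_u, zero_add]

/-- The commutator of a total derivative and a vertical field. -/
theorem D_vert (i : Fin n) (X : MI n → Fin m → F) (g : F) :
    D i (vert X g) = vert X (D i g) +
      vert (fun σ j => D i (X σ j) - X (σ + Finsupp.single i 1) j) g := by
  rw [D_apply, commute_vert (dx i) (dx_du i), vert_vert _ X, D_apply, map_add, vert_sub, vert_sub]
  simp only [D_apply, vert_u, vert_add]
  ring

theorem D_comm (i k : Fin n) (g : F) : D i (D k g) = D k (D i g) := by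
  have hx : ∀ i k : Fin n, D i (dx k g) = dx k (D i g) := by
    intro i k
    rw [D_apply, D_apply, map_add, commute_vert (dx k) (dx_du k), dx_dx i k]
    simp only [dx_u, vert_zero, zero_add]
  rw [D_apply k g, map_add, hx, D_vert, D_apply k (D i g)]
  have : (fun σ j => D i (u (σ + Finsupp.single k 1) j : F) -
      u (σ + Finsupp.single i 1 + Finsupp.single k 1) j) = fun _ _ => 0 := by
    funext σ j
    rw [D_u, add_right_comm, sub_self]
  rw [this, vert_zero, add_zero]

theorem dt_D (i : Fin n) (g : F) : dt (D i g) = D i (dt g) := by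
  rw [D_apply, map_add, commute_vert dt dt_du, dt_dx, D_apply]
  simp only [dt_u, vert_zero, zero_add]

/-- The composition of the powers `(D i)^[σ i]` over a list of indices. -/
def DList (L : List (Fin n)) (σ : MI n) (g : F) : F :=
  L.foldr (fun i G => (⇑(D i : Derivation ℝ F F))^[σ i] G) g

/-- The iterated total derivative `D_σ`. -/
def Dσ (σ : MI n) (g : F) : F := DList (List.finRange n) σ g

theorem D_iterate (i k : Fin n) (r : ℕ) (g : F) :
    D i ((⇑(D k : Derivation ℝ F F))^[r] g) = (⇑(D k : Derivation ℝ F F))^[r] (D i g) :=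
  Function.Commute.iterate_right (fun g => D_comm i k g) r g

theorem D_DList (i : Fin n) (L : List (Fin n)) (σ : MI n) (g : F) :
    D i (DList L σ g) = DList L σ (D i g) := by
  induction L with
  | nil => rfl
  | cons k L ih =>
    change D i ((⇑(D k : Derivation ℝ F F))^[σ k] (DList L σ g)) = _
    rw [D_iterate, ih]
    rfl

theorem DList_add_single_of_notMem (i : Fin n) (L : List (Fin n)) (σ : MI n) (g : F)
    (hi : i ∉ L) : DList L (σ + Finsupp.single i 1) g = DList L σ g := by
  induction L with
  | nil => rfl
  | cons k L ih =>
    rw [List.mem_cons, not_or] at hi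
    change (⇑(D k : Derivation ℝ F F))^[(σ + Finsupp.single i 1 : MI n) k] (DList L _ g) =
      (⇑(D k : Derivation ℝ F F))^[σ k] (DList L _ g)
    rw [ih hi.2, Finsupp.add_apply, Finsupp.single_apply, if_neg hi.1, add_zero]

theorem DList_add_single (i : Fin n) (L : List (Fin n)) (hL : L.Nodup) (σ : MI n) (g : F)
    (hi : i ∈ L) : DList L (σ + Finsupp.single i 1) g = D i (DList L σ g) := by
  induction L with
  | nil => simp at hi
  | cons k L ih =>
    rw [List.nodup_cons] at hL
    change (⇑(D k : Derivation ℝ F F))^[(σ + Finsupp.single i 1 : MI n) k] (DList L _ g) =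
      D i ((⇑(D k : Derivation ℝ F F))^[σ k] (DList L _ g))
    rw [Finsupp.add_apply, Finsupp.single_apply]
    by_cases hik : i = k
    · subst hik
      rw [DList_add_single_of_notMem _ _ _ _ hL.1, if_pos rfl, Function.iterate_succ_apply']
    · rw [if_neg hik, add_zero, ih hL.2 ((List.mem_cons.1 hi).resolve_left hik), D_iterate]

theorem Dσ_add_single (σ : MI n) (i : Fin n) (g : F) :
    Dσ (σ + Finsupp.single i 1) g = D i (Dσ σ g) :=
  DList_add_single i _ (List.nodup_finRange n) σ g (List.mem_finRange i)

theorem Dσ_zero (g : F) : Dσ (0 : MI n) g = g := by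
  unfold Dσ
  induction List.finRange n with
  | nil => rfl
  | cons k L ih => exact ih

/-- Induction on a multi-index, raising one entry at a time. -/
theorem MI.induction {ι : Type*} {P : (ι →₀ ℕ) → Prop} (h0 : P 0)
    (hs : ∀ σ i, P σ → P (σ + Finsupp.single i 1)) (σ : ι →₀ ℕ) : P σ := by
  induction σ using Finsupp.induction with
  | zero => exact h0
  | single_add a b f _ _ ih =>
    clear * - ih hs
    induction b with
    | zero => simpa using ih
    | succ b hb =>
      have : Finsupp.single a (b + 1) + f = Finsupp.single a b + f + Finsupp.single a 1 := by
        rw [Finsupp.single_add]; abel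
      rw [this]
      exact hs _ _ hb

theorem D_Dσ (i : Fin n) (σ : MI n) (g : F) : D i (Dσ σ g) = Dσ σ (D i g) :=
  D_DList i _ σ g

/-- Any additive map commuting with the total derivatives commutes with their iterates. -/
theorem map_Dσ {δ : F → F} (hδ : ∀ i g, δ (D i g) = D i (δ g)) (σ : MI n) (g : F) :
    δ (Dσ σ g) = Dσ σ (δ g) := by
  induction σ using MI.induction with
  | h0 => rw [Dσ_zero, Dσ_zero]
  | hs σ i ih => rw [Dσ_add_single, hδ, ih, Dσ_add_single]

theorem Dσ_add (σ : MI n) (g g' : F) : Dσ σ (g + g') = Dσ σ g + Dσ σ g' := by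
  induction σ using MI.induction with
  | h0 => simp only [Dσ_zero]
  | hs σ i ih => simp only [Dσ_add_single, ih, map_add]

theorem Dσ_apply_zero (σ : MI n) : Dσ σ (0 : F) = 0 := by
  have := Dσ_add σ (0 : F) 0
  simpa using this

theorem Dσ_sub (σ : MI n) (g g' : F) : Dσ σ (g - g') = Dσ σ g - Dσ σ g' :=
  map_sub (⟨⟨Dσ σ, Dσ_apply_zero σ⟩, Dσ_add σ⟩ : F →+ F) g g'

/-! ### Evolutionary derivations -/

/-- The evolutionary derivation `∑ D_σ(φ^j) ∂/∂u^j_σ` of `φ`. -/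
def E (φ : Fin m → F) : Derivation ℝ F F := vert (fun σ j => Dσ σ (φ j))

theorem E_D (φ : Fin m → F) (i : Fin n) (g : F) : E φ (D i g) = D i (E φ g) := by
  unfold E
  rw [D_vert]
  simp only [Dσ_add_single, sub_self, vert_zero, add_zero]

theorem E_Dσ (φ : Fin m → F) (σ : MI n) (g : F) : E φ (Dσ σ g) = Dσ σ (E φ g) :=
  map_Dσ (E_D φ) σ g

theorem E_add (φ χ : Fin m → F) (g : F) : E (φ + χ) g = E φ g + E χ g := by
  unfold E
  simp only [Pi.add_apply, Dσ_add, vert_add]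

theorem E_sub (φ χ : Fin m → F) (g : F) : E (φ - χ) g = E φ g - E χ g := by
  unfold E
  simp only [Pi.sub_apply, Dσ_sub, vert_sub]

/-- The bracket of evolutionary derivations is evolutionary. -/
theorem E_E (φ χ : Fin m → F) (g : F) :
    E φ (E χ g) = E χ (E φ g) + E (fun j => E φ (χ j) - E χ (φ j)) g := by
  have h := vert_vert (fun σ j => Dσ σ (φ j)) (fun σ j => Dσ σ (χ j)) g
  have e : ∀ (φ χ : Fin m → F) (σ : MI n) (j : Fin m),
    vert (fun σ j => Dσ σ (φ j)) (Dσ σ (χ j)) = Dσ σ (E φ (χ j)) := fun φ χ σ j => E_Dσ φ σ (χ j)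
  simp only [e, ← Dσ_sub] at h
  exact h

theorem dt_E (φ : Fin m → F) (g : F) : dt (E φ g) = E φ (dt g) + E (fun j => dt (φ j)) g := by
  unfold E
  rw [commute_vert dt dt_du, add_comm]
  simp only [map_Dσ (δ := (dt : Derivation ℝ F F)) dt_D]

/-- The derivation `D_t` of the evolution equation `u_t = f`. -/
def DT (f : Fin m → F) : Derivation ℝ F F := dt + E f

theorem DT_apply (f : Fin m → F) (g : F) : DT f g = dt g + E f g := rfl

theorem DT_D (f : Fin m → F) (i : Fin n) (g : F) : DT f (D i g) = D i (DT f g) := by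
  rw [DT_apply, DT_apply, dt_D, E_D, map_add]

/-- The commutator of `D_t` and the evolutionary derivation of `φ` is the evolutionary derivation
of `D_t φ - ℓ_f φ`. -/
theorem DT_E (f φ : Fin m → F) (g : F) :
    DT f (E φ g) = E φ (DT f g) + E (fun j => DT f (φ j) - E φ (f j)) g := by
  rw [DT_apply, DT_apply, dt_E, E_E f φ, map_add]
  have : (fun j => DT f (φ j) - E φ (f j)) =
      (fun j => dt (φ j)) + fun j => E f (φ j) - E φ (f j) := by
    funext j
    simp only [DT_apply, Pi.add_apply]
    ring
  rw [this, E_add]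
  ring

/-- The commutator of `∂/∂u^j_σ` and a total derivative. -/
theorem du_D (σ : MI n) (j : Fin m) (i : Fin n) (g : F) :
    du σ j (D i g) = D i (du σ j g) +
      if σ i = 0 then 0 else du (σ - Finsupp.single i 1) j g := by
  rw [D_apply, map_add, commute_vert (du σ j) (fun τ k g => du_du σ j τ k g), ← dx_du, D_apply]
  have h : ∀ σ, σ ∉ orders g → ∀ j, du σ j g = 0 := fun σ h j => du_eq_zero h j
  have : vert (fun τ k => du σ j (u (τ + Finsupp.single i 1) k)) g =
      if σ i = 0 then 0 else du (σ - Finsupp.single i 1) j g := by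
    split_ifs with hi
    · have : (fun τ k => du σ j (u (τ + Finsupp.single i 1) k : F)) = fun _ _ => 0 := by
        funext τ k
        rw [du_u, if_neg]
        rintro ⟨rfl, -⟩
        simp at hi
      rw [this, vert_zero]
    · obtain ⟨τ, rfl⟩ : ∃ τ, σ = τ + Finsupp.single i 1 := by
        refine ⟨σ - Finsupp.single i 1, (tsub_add_cancel_of_le ?_).symm⟩
        rw [Finsupp.single_le_iff]
        omega
      have : (fun ρ k => du (τ + Finsupp.single i 1) j (u (ρ + Finsupp.single i 1) k : F)) =
          fun ρ k => if ρ = τ ∧ k = j then 1 else 0 := by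
        funext ρ k
        simp only [du_u, add_left_inj]
      rw [this, add_tsub_cancel_right, vert_eq_sum (T := insert τ (orders g)) _
        (fun σ hσ j => du_eq_zero (fun h' => hσ (Finset.mem_insert_of_mem h')) j)]
      rw [Finset.sum_eq_single τ, Finset.sum_eq_single j]
      · simp
      · intro k _ hk; simp [hk]
      · simp
      · intro ρ _ hρ; simp [hρ]
      · intro h'; exact absurd (Finset.mem_insert_self _ _) h'
  rw [this]
  ring

end

section

open JetAlgebra

variable {n m : ℕ} {F : Type*} [CommRing F] [Algebra ℝ F] [JetAlgebra n m F]

/-! ### Scalar differential operators and their faithful action on exponentials -/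

/-- If the total derivatives of the generators of a module of maps lie in the module, it is stable
under total derivatives. -/
theorem D_span {Z : Type*} {G : Set (Z → F)}
    (hG : ∀ g ∈ G, ∀ i : Fin n, (fun z => D i (g z)) ∈ Submodule.span F G) {P : Z → F}
    (hP : P ∈ Submodule.span F G) (i : Fin n) : (fun z => D i (P z)) ∈ Submodule.span F G := by
  induction hP using Submodule.span_induction with
  | mem g hg => exact hG g hg i
  | zero =>
    have : (fun z => D i ((0 : Z → F) z)) = 0 := funext fun z => map_zero _
    rw [this]
    exact Submodule.zero_mem _
  | add P Q _ _ hP hQ =>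
    have : (fun z => D i ((P + Q) z)) = (fun z => D i (P z)) + fun z => D i (Q z) :=
      funext fun z => map_add _ _ _
    rw [this]
    exact Submodule.add_mem _ hP hQ
  | smul a P hP' hP =>
    have : (fun z => D i ((a • P) z)) = a • (fun z => D i (P z)) + D i a • P := by
      funext z
      simp only [Pi.smul_apply, Pi.add_apply, smul_eq_mul, Derivation.leibniz]
      ring
    rw [this]
    exact Submodule.add_mem _ (Submodule.smul_mem _ _ hP) (Submodule.smul_mem _ _ hP')

theorem Dσ_span {Z : Type*} {G : Set (Z → F)}
    (hG : ∀ g ∈ G, ∀ i : Fin n, (fun z => D i (g z)) ∈ Submodule.span F G) {P : Z → F}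
    (hP : P ∈ Submodule.span F G) (σ : MI n) : (fun z => Dσ σ (P z)) ∈ Submodule.span F G := by
  induction σ using MI.induction with
  | h0 => simpa only [Dσ_zero] using hP
  | hs σ i ih => simpa only [Dσ_add_single] using D_span hG ih i

/-- The generators `ψ ↦ D_σ(ψ_j)` of the scalar differential operators. -/
def diffGen (F : Type*) [CommRing F] [Algebra ℝ F] [JetAlgebra n m F] (a : MI n × Fin m) :
    (Fin m → F) → F := fun ψ => Dσ a.1 (ψ a.2)

/-- The scalar differential operators, i.e. linear combinations of the `ψ ↦ D_σ(ψ_j)`. -/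
def diffOps (F : Type*) [CommRing F] [Algebra ℝ F] [JetAlgebra n m F] :
    Submodule F ((Fin m → F) → F) := Submodule.span F (range (diffGen F))

theorem diffGen_mem (σ : MI n) (j : Fin m) : (fun ψ : Fin m → F => Dσ σ (ψ j)) ∈ diffOps F :=
  Submodule.subset_span ⟨(σ, j), rfl⟩

theorem Dσ_diffOps {P : (Fin m → F) → F} (hP : P ∈ diffOps F) (σ : MI n) :
    (fun ψ => Dσ σ (P ψ)) ∈ diffOps F := by
  refine Dσ_span ?_ hP σ
  rintro _ ⟨⟨τ, j⟩, rfl⟩ i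
  have : (fun ψ : Fin m → F => D i (diffGen F (τ, j) ψ)) =
      fun ψ => Dσ (τ + Finsupp.single i 1) (ψ j) := funext fun ψ => (Dσ_add_single τ i _).symm
  rw [this]
  exact diffGen_mem _ _

theorem diffOps_mul (a : F) {P : (Fin m → F) → F} (hP : P ∈ diffOps F) :
    (fun ψ => a * P ψ) ∈ diffOps F := Submodule.smul_mem _ a hP

theorem diffOps_sum {ι : Type*} (s : Finset ι) {P : ι → (Fin m → F) → F}
    (hP : ∀ a ∈ s, P a ∈ diffOps F) : (fun ψ => ∑ a ∈ s, P a ψ) ∈ diffOps F := by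
  have : (fun ψ => ∑ a ∈ s, P a ψ) = ∑ a ∈ s, P a := by
    funext ψ
    rw [Finset.sum_apply]
  rw [this]
  exact Submodule.sum_mem _ hP

/-- The monomial `θ^σ`. -/
def mon {ι : Type*} [Fintype ι] (θ : ι → ℝ) (σ : ι →₀ ℕ) : ℝ := ∏ i, θ i ^ σ i

theorem mon_zero {ι : Type*} [Fintype ι] (θ : ι → ℝ) : mon θ 0 = 1 := by simp [mon]

theorem mon_add_single {ι : Type*} [Fintype ι] (θ : ι → ℝ) (σ : ι →₀ ℕ) (i : ι) :
    mon θ (σ + Finsupp.single i 1) = θ i * mon θ σ := by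
  classical
  simp only [mon, Finsupp.add_apply, pow_add, Finset.prod_mul_distrib, Finsupp.single_apply]
  rw [mul_comm]
  congr 1
  simp [pow_ite]

/-- A polynomial function vanishing on a nonempty open set has zero coefficients. -/
theorem coeff_eq_zero_of_sum_mon {ι : Type*} [Fintype ι] (T : Finset (ι →₀ ℕ))
    (r : (ι →₀ ℕ) → ℝ) {u : Set (ι → ℝ)} (hu : IsOpen u) {θ₀ : ι → ℝ} (hθ₀ : θ₀ ∈ u)
    (h : ∀ θ ∈ u, ∑ σ ∈ T, r σ * mon θ σ = 0) : ∀ σ ∈ T, r σ = 0 := by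
  classical
  obtain ⟨ε, hε, hball⟩ := Metric.isOpen_iff.1 hu θ₀ hθ₀
  have hp : (∑ σ ∈ T, MvPolynomial.monomial σ (r σ)) = 0 := by
    refine MvPolynomial.funext_set (fun i => Metric.ball (θ₀ i) ε) (fun i => ?_) fun θ hθ => ?_
    · rw [Real.ball_eq_Ioo]
      exact Set.Ioo_infinite (by linarith)
    · rw [← ball_pi _ hε] at hθ
      rw [map_sum, map_zero, ← h θ (hball hθ)]
      refine Finset.sum_congr rfl fun σ _ => ?_
      rw [MvPolynomial.eval_monomial, Finsupp.prod_fintype _ _ (fun i => pow_zero _)]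
      rfl
  intro σ hσ
  have := congrArg (MvPolynomial.coeff σ) hp
  rw [MvPolynomial.coeff_sum, MvPolynomial.coeff_zero] at this
  simpa [MvPolynomial.coeff_monomial, hσ] using this

theorem D_ex (i : Fin n) (θ : Fin n → ℝ) : D i (ex θ : F) = algebraMap ℝ F (θ i) * ex θ := by
  rw [D_apply, dx_ex, vert_eq_sum _ (T := ∅) (fun σ _ j => du_ex σ j θ), Finset.sum_empty, add_zero]

theorem Dσ_ex (σ : MI n) (θ : Fin n → ℝ) :
    Dσ σ (ex θ : F) = algebraMap ℝ F (mon θ σ) * ex θ := by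
  induction σ using MI.induction with
  | h0 => rw [Dσ_zero, mon_zero, map_one, one_mul]
  | hs σ i ih =>
    rw [Dσ_add_single, ih, Derivation.leibniz, D_ex, Derivation.map_algebraMap, mon_add_single,
      map_mul, smul_zero, add_zero, smul_eq_mul]
    ring

theorem ex_mul_neg (θ : Fin n → ℝ) : (ex θ : F) * ex (-θ) = 1 := by
  rw [← ex_add, add_neg_cancel, ex_zero]

theorem map_ex_ne_zero (ev : F →ₐ[ℝ] ℝ) (θ : Fin n → ℝ) : ev (ex θ) ≠ 0 := by
  intro h
  have := congrArg ev (ex_mul_neg (F := F) θ)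
  rw [map_mul, h, zero_mul, map_one] at this
  exact zero_ne_one this

/-- A differential operator killing all exponentials is zero. -/
theorem diffOps_eq_zero {P : (Fin m → F) → F} (hP : P ∈ diffOps F)
    (h : ∀ θ j, P (Pi.single j (ex θ)) = 0) : P = 0 := by
  classical
  obtain ⟨c, rfl⟩ := (Finsupp.mem_span_range_iff_exists_finsupp).1 hP
  have hc : c = 0 := by
    ext a
    obtain ⟨σ, j⟩ := a
    refine ext_points _ fun ev => ?_
    have key := coeff_eq_zero_of_sum_mon (c.support.image Prod.fst) (fun σ => ev (c (σ, j)))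
      isOpen_univ (mem_univ 0) (fun θ _ => ?_) σ
    · by_cases hσ : (σ, j) ∈ c.support
      · exact key (Finset.mem_image_of_mem _ hσ)
      · rw [Finsupp.notMem_support_iff.1 hσ, map_zero]
    · have := congrArg ev (h θ j)
      rw [map_zero, Finsupp.sum, Finset.sum_apply, map_sum] at this
      refine (mul_eq_zero.1 ?_).resolve_right (map_ex_ne_zero ev θ)
      rw [← this, Finset.sum_mul]
      have hsub : c.support ⊆ (c.support.image Prod.fst) ×ˢ Finset.univ := fun a ha =>
        Finset.mem_product.2 ⟨Finset.mem_image_of_mem _ ha, Finset.mem_univ _⟩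
      rw [Finset.sum_subset hsub (fun a _ ha => by
        rw [Finsupp.notMem_support_iff.1 ha, zero_smul, Pi.zero_apply, map_zero]),
        Finset.sum_product]
      refine Finset.sum_congr rfl fun τ _ => ?_
      rw [Finset.sum_eq_single j]
      · simp [diffGen, Dσ_ex, mul_assoc, AlgHom.commutes]
      · intro k _ hk
        simp [diffGen, Pi.single_eq_of_ne hk, Dσ_apply_zero]
      · simp
  rw [hc, Finsupp.sum_zero_index]

/-! ### Functions modulo total divergences -/

/-- The total divergences `∑ D_i h_i`. -/
def divs (F : Type*) [CommRing F] [Algebra ℝ F] [JetAlgebra n m F] : Submodule ℝ F :=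
  ⨆ i : Fin n, LinearMap.range ((D i : Derivation ℝ F F) : F →ₗ[ℝ] F)

theorem D_mem_divs (i : Fin n) (g : F) : D i g ∈ divs F :=
  Submodule.mem_iSup_of_mem i ⟨g, rfl⟩

/-- An additive map sending each `D_i g` into `p` sends all divergences into `p`. -/
theorem divs_induction {B : Type*} [AddCommGroup B] (δ : F →+ B) (p : AddSubgroup B)
    (h : ∀ (i : Fin n) g, δ (D i g) ∈ p) {g : F} (hg : g ∈ divs F) : δ g ∈ p := by
  unfold divs at hg
  induction hg using Submodule.iSup_induction' with
  | mem i x hx =>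
    obtain ⟨y, rfl⟩ := hx
    exact h i y
  | zero => rw [map_zero]; exact p.zero_mem
  | add x y _ _ hx hy => rw [map_add]; exact p.add_mem hx hy

/-- The Euler operator `δ/δu^j = ∑ (-1)^{|σ|} D_σ ∂/∂u^j_σ`. -/
def euler (j : Fin m) (g : F) : F := ∑ σ ∈ orders g, (-1) ^ σ.degree * Dσ σ (du σ j g)

theorem euler_eq_sum (j : Fin m) {g : F} {T : Finset (MI n)}
    (hT : ∀ σ, σ ∉ T → ∀ j, du σ j g = 0) :
    euler j g = ∑ σ ∈ T, (-1) ^ σ.degree * Dσ σ (du σ j g) := by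
  classical
  have h₁ : euler j g = ∑ σ ∈ orders g ∪ T, (-1) ^ σ.degree * Dσ σ (du σ j g) :=
    Finset.sum_subset Finset.subset_union_left fun σ _ hσ => by
      rw [du_eq_zero hσ, Dσ_apply_zero, mul_zero]
  rw [h₁]
  exact (Finset.sum_subset Finset.subset_union_right fun σ _ hσ => by
    rw [hT σ hσ, Dσ_apply_zero, mul_zero]).symm

theorem euler_add (j : Fin m) (g g' : F) : euler j (g + g') = euler j g + euler j g' := by
  obtain ⟨T, h, h'⟩ := exists_common_orders g g'
  rw [euler_eq_sum j h, euler_eq_sum j h', euler_eq_sum j (T := T)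
    (fun σ hσ j => by rw [map_add, h σ hσ, h' σ hσ, add_zero])]
  simp only [map_add, Dσ_add, mul_add, Finset.sum_add_distrib]

theorem degree_add_single {ι : Type*} (σ : ι →₀ ℕ) (i : ι) :
    (σ + Finsupp.single i 1).degree = σ.degree + 1 := by
  rw [map_add, Finsupp.degree_single]

/-- The Euler operator kills total divergences: by the commutator of `∂/∂u^j_σ` and `D_i` the sum
telescopes. -/
theorem euler_D (j : Fin m) (i : Fin n) (g : F) : euler j (D i g) = 0 := by
  classical
  have h : ∀ σ, σ ∉ orders g → ∀ j, du σ j g = 0 := fun σ h j => du_eq_zero h j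
  set T := orders g ∪ (orders g).image (fun σ => σ + Finsupp.single i 1) with hT
  have hT' : ∀ σ, σ ∉ T → ∀ j, du σ j (D i g) = 0 := by
    intro σ hσ j
    rw [hT, Finset.mem_union, not_or] at hσ
    rw [du_D, h σ hσ.1, map_zero, zero_add]
    split_ifs with h0
    · rfl
    · refine h _ (fun hmem => hσ.2 ?_) j
      refine Finset.mem_image.2 ⟨_, hmem, tsub_add_cancel_of_le ?_⟩
      rw [Finsupp.single_le_iff]
      omega
  rw [euler_eq_sum j hT']
  simp only [du_D, Dσ_add, mul_add, Finset.sum_add_distrib]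
  rw [← Finset.sum_subset (Finset.subset_union_left : orders g ⊆ T) (fun σ _ hσ => by
      rw [h σ hσ, map_zero, Dσ_apply_zero, mul_zero]),
    ← Finset.sum_subset (Finset.subset_union_right : (orders g).image _ ⊆ T) (fun σ _ hσ => ?_),
    Finset.sum_image (fun a _ b _ hab => add_right_cancel hab), ← Finset.sum_add_distrib]
  · refine Finset.sum_eq_zero fun σ _ => ?_
    rw [if_neg (by simp), add_tsub_cancel_right, degree_add_single, Dσ_add_single, ← D_Dσ, pow_succ]
    ring
  · split_ifs with h0
    · rw [Dσ_apply_zero, mul_zero]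
    · have : σ - Finsupp.single i 1 ∉ orders g := by
        intro hmem
        refine hσ (Finset.mem_image.2 ⟨_, hmem, tsub_add_cancel_of_le ?_⟩)
        rw [Finsupp.single_le_iff]
        omega
      rw [h _ this, Dσ_apply_zero, mul_zero]

theorem euler_divs (j : Fin m) {g : F} (hg : g ∈ divs F) : euler j g = 0 := by
  have h0 : euler j (0 : F) = 0 := by
    have := euler_add j (0 : F) 0
    simpa using this
  have := divs_induction (n := n) (⟨⟨euler j, h0⟩, euler_add j⟩ : F →+ F) ⊥
    (fun i g => (AddSubgroup.mem_bot).2 (euler_D j i g)) hg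
  exact (AddSubgroup.mem_bot).1 this

/-- A function all of whose multiples are divergences vanishes. Multiplying by functions of `x`
shows that the operator `g ↦ ∑ (-1)^{|σ|} D_σ(g ∂a/∂u^j_σ)` kills exponentials, hence is zero;
multiplying by `u^j` then gives `a = 0`. -/
theorem eq_zero_of_mul_mem_divs (j : Fin m) {a : F} (ha : ∀ g, a * g ∈ divs F) : a = 0 := by
  classical
  set T := insert 0 (orders a) with hT
  have hTa : ∀ σ, σ ∉ T → ∀ j, du σ j a = 0 := fun σ hσ j =>
    du_eq_zero (fun h => hσ (Finset.mem_insert_of_mem h)) j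
  -- The contribution of the derivatives of `a` to the Euler operator of `a * ψ j`.
  set P : (Fin m → F) → F :=
    fun ψ => ∑ σ ∈ T, (-1) ^ σ.degree * Dσ σ (du σ j a * ψ j) with hP
  have hPmem : P ∈ diffOps F := by
    refine diffOps_sum _ fun σ _ => diffOps_mul _ (Dσ_diffOps (diffOps_mul _ ?_) σ)
    simpa only [Dσ_zero] using diffGen_mem (F := F) 0 j
  have hP0 : P = 0 := by
    refine diffOps_eq_zero hPmem fun θ k => ?_
    rw [← euler_divs j (ha ((Pi.single k (ex θ) : Fin m → F) j))]
    have hd : ∀ σ l, du σ l ((Pi.single k (ex θ) : Fin m → F) j) = 0 := by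
      intro σ l
      by_cases hjk : j = k
      · subst hjk; rw [Pi.single_eq_same, du_ex]
      · rw [Pi.single_eq_of_ne hjk, map_zero]
    rw [euler_eq_sum j (T := T) (fun σ hσ l => by
      rw [Derivation.leibniz, hTa σ hσ, hd, smul_zero, smul_zero, add_zero])]
    refine Finset.sum_congr rfl fun σ _ => ?_
    rw [Derivation.leibniz, hd, smul_zero, zero_add, smul_eq_mul, mul_comm (du σ j a)]
  have hu := euler_divs j (ha (u 0 j))
  rw [euler_eq_sum j (T := T) (fun σ hσ l => by
    rw [Derivation.leibniz, hTa σ hσ, du_u, if_neg, smul_zero, smul_zero, add_zero]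
    rintro ⟨rfl, -⟩
    exact hσ (Finset.mem_insert_self _ _))] at hu
  have hPu := congrFun hP0 (fun _ => u 0 j)
  rw [Pi.zero_apply, hP] at hPu
  simp only [Derivation.leibniz, du_u, smul_eq_mul, Dσ_add, mul_add, Finset.sum_add_distrib] at hu
  simp only [mul_comm (u 0 j : F)] at hu
  rw [show ∑ σ ∈ T, (-1) ^ σ.degree * Dσ σ (du σ j a * u 0 j) = 0 from hPu, add_zero, Finset.sum_eq_single 0] at hu
  · simpa [Dσ_zero] using hu
  · intro σ _ hσ
    rw [if_neg (fun h => hσ h.1.symm), mul_zero, Dσ_apply_zero, mul_zero]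
  · intro h
    exact absurd (Finset.mem_insert_self _ _) h

/-- The pairing of `κ` and `κ̂` with values in functions modulo total divergences. -/
def pair (φ ψ : Fin m → F) : F ⧸ divs F := Submodule.Quotient.mk (∑ i, φ i * ψ i)

theorem pair_comm (φ ψ : Fin m → F) : pair φ ψ = pair ψ φ := by
  unfold pair
  simp only [mul_comm]

theorem pair_add_left (φ χ ψ : Fin m → F) : pair (φ + χ) ψ = pair φ ψ + pair χ ψ := by
  simp only [pair, Pi.add_apply, add_mul, Finset.sum_add_distrib, Submodule.Quotient.mk_add]

theorem pair_sub_left (φ χ ψ : Fin m → F) : pair (φ - χ) ψ = pair φ ψ - pair χ ψ := by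
  simp only [pair, Pi.sub_apply, sub_mul, Finset.sum_sub_distrib, Submodule.Quotient.mk_sub]

theorem pair_neg_left (φ ψ : Fin m → F) : pair (-φ) ψ = -pair φ ψ := by
  simp only [pair, Pi.neg_apply, neg_mul, Finset.sum_neg_distrib, Submodule.Quotient.mk_neg]

theorem pair_add_right (ψ φ χ : Fin m → F) : pair ψ (φ + χ) = pair ψ φ + pair ψ χ := by
  rw [pair_comm, pair_add_left, pair_comm φ, pair_comm χ]

theorem pair_sub_right (ψ φ χ : Fin m → F) : pair ψ (φ - χ) = pair ψ φ - pair ψ χ := by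
  rw [pair_comm, pair_sub_left, pair_comm φ, pair_comm χ]

/-- The pairing modulo total divergences is nondegenerate. -/
theorem eq_zero_of_pair {φ : Fin m → F} (h : ∀ ψ, pair φ ψ = 0) : φ = 0 := by
  classical
  funext j
  refine eq_zero_of_mul_mem_divs j fun g => ?_
  have := h (Pi.single j g)
  rw [pair, Submodule.Quotient.mk_eq_zero, Finset.sum_eq_single j (fun k _ hk => by
    rw [Pi.single_eq_of_ne hk, mul_zero]) (by simp), Pi.single_eq_same] at this
  exact this

theorem map_divs_le (δ : Derivation ℝ F F) (hδ : ∀ (i : Fin n) g, δ (D i g) = D i (δ g)) :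
    divs F ≤ (divs F).comap (δ : F →ₗ[ℝ] F) := fun g hg =>
  divs_induction (n := n) (δ : F →ₗ[ℝ] F).toAddMonoidHom (divs F).toAddSubgroup
    (fun i g => by
      change δ (D i g) ∈ divs F
      rw [hδ]
      exact D_mem_divs i _) hg

/-- A derivation commuting with the total derivatives descends modulo divergences. -/
def quotDer (δ : Derivation ℝ F F) (hδ : ∀ (i : Fin n) g, δ (D i g) = D i (δ g)) :
    F ⧸ divs F →ₗ[ℝ] F ⧸ divs F :=
  (divs F).mapQ (divs F) (δ : F →ₗ[ℝ] F) (map_divs_le δ hδ)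

theorem quotDer_pair (δ : Derivation ℝ F F) (hδ : ∀ (i : Fin n) g, δ (D i g) = D i (δ g))
    (φ ψ : Fin m → F) :
    quotDer δ hδ (pair φ ψ) = pair (fun i => δ (φ i)) ψ + pair φ (fun i => δ (ψ i)) := by
  unfold pair quotDer
  rw [Submodule.mapQ_apply, ← Submodule.Quotient.mk_add]
  congr 1
  change δ _ = _
  rw [map_sum, ← Finset.sum_add_distrib]
  refine Finset.sum_congr rfl fun i _ => ?_
  rw [Derivation.leibniz, smul_eq_mul, smul_eq_mul]
  ring

theorem mk_D_mul (i : Fin n) (g h : F) :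
    (Submodule.Quotient.mk (D i g * h) : F ⧸ divs F) = -Submodule.Quotient.mk (g * D i h) := by
  rw [← Submodule.Quotient.mk_neg, Submodule.Quotient.eq, sub_neg_eq_add]
  have := D_mem_divs (F := F) i (g * h)
  rwa [Derivation.leibniz, smul_eq_mul, smul_eq_mul, add_comm, mul_comm h] at this

/-- Integration by parts. -/
theorem mk_Dσ_mul (σ : MI n) (g h : F) :
    (Submodule.Quotient.mk (Dσ σ g * h) : F ⧸ divs F) =
      Submodule.Quotient.mk (g * ((-1) ^ σ.degree * Dσ σ h)) := by
  induction σ using MI.induction generalizing h with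
  | h0 => simp [Dσ_zero]
  | hs σ i ih =>
    rw [Dσ_add_single, mk_D_mul, ih, degree_add_single, Dσ_add_single, D_Dσ,
      ← Submodule.Quotient.mk_neg, pow_succ]
    congr 1
    ring

end

section

open JetAlgebra

variable {n m : ℕ} {F : Type*} [CommRing F] [Algebra ℝ F] [JetAlgebra n m F]

/-! ### Invariance of the Schouten bracket and of the variational differential -/

/-- The evolutionary derivation of `φ`, componentwise. -/
def EV (φ ψ : Fin m → F) : Fin m → F := fun i => E φ (ψ i)

/-- The derivation `D_t`, componentwise. -/
def DTV (f ψ : Fin m → F) : Fin m → F := fun i => DT f (ψ i)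

theorem EV_add (φ ψ χ : Fin m → F) : EV φ (ψ + χ) = EV φ ψ + EV φ χ :=
  funext fun _ => map_add _ _ _

theorem EV_neg (φ ψ : Fin m → F) : EV φ (-ψ) = -EV φ ψ := funext fun _ => map_neg _ _

theorem DTV_sub (f ψ χ : Fin m → F) : DTV f (ψ - χ) = DTV f ψ - DTV f χ :=
  funext fun _ => map_sub _ _ _

theorem EV_sub_left (φ χ ψ : Fin m → F) : EV (φ - χ) ψ = EV φ ψ - EV χ ψ :=
  funext fun _ => E_sub _ _ _

theorem DTV_EV (f φ ψ : Fin m → F) :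
    DTV f (EV φ ψ) = EV φ (DTV f ψ) + EV (DTV f φ - EV φ f) ψ :=
  funext fun i => DT_E f φ (ψ i)

theorem EV_EV (φ χ ψ : Fin m → F) :
    EV φ (EV χ ψ) = EV χ (EV φ ψ) + EV (EV φ χ - EV χ φ) ψ :=
  funext fun i => E_E φ χ (ψ i)

/-- The variation `A'[φ]ψ = E_φ(Aψ) - A(E_φ ψ)` of an operator along the evolutionary derivation
of `φ`: the coefficients of `A` are differentiated. -/
def vary (A : (Fin m → F) → Fin m → F) (φ ψ : Fin m → F) : Fin m → F :=
  EV φ (A ψ) - A (EV φ ψ)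

/-- The variation of the linearization is the second variation of `f`, a symmetric expression. -/
theorem vary_lin_symm (f φ χ : Fin m → F) :
    vary (fun φ => EV φ f) φ χ = vary (fun φ => EV φ f) χ φ := by
  unfold vary
  rw [EV_EV, EV_sub_left]
  abel

theorem vary_neg (A : (Fin m → F) → Fin m → F) (φ ψ : Fin m → F) :
    vary (fun ψ => -A ψ) φ ψ = -vary A φ ψ := by
  unfold vary
  rw [EV_neg, neg_sub_neg, neg_sub]

/-- If `S₂` is minus the adjoint of `S₁`, so are their variations. -/
theorem pair_vary {S₁ S₂ : (Fin m → F) → Fin m → F}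
    (hS : ∀ X χ, pair (S₂ X) χ = -pair X (S₁ χ)) (φ X χ : Fin m → F) :
    pair (vary S₂ φ X) χ = -pair X (vary S₁ φ χ) := by
  have h := congrArg (quotDer (E φ) (E_D φ)) (hS X χ)
  rw [map_neg, quotDer_pair, quotDer_pair] at h
  change pair (EV φ (S₂ X)) χ + pair (S₂ X) (EV φ χ) =
    -(pair (EV φ X) (S₁ χ) + pair X (EV φ (S₁ χ))) at h
  rw [vary, vary, pair_sub_left, pair_sub_right, hS (EV φ X)]
  rw [hS X (EV φ χ)] at h
  rw [← sub_eq_zero] at h ⊢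
  rw [← h]
  abel

section Invariance

variable {f : Fin m → F} {S₁ S₂ : (Fin m → F) → Fin m → F} {A B : (Fin m → F) → Fin m → F}

/-- If `A` intertwines `D_t + S₁` and `D_t + S₂`, the failure of its variation to be invariant is
given by the variations of `S₁` and `S₂`. -/
theorem lie_vary (hS₂ : ∀ X Y, S₂ (X - Y) = S₂ X - S₂ Y) (hadd : ∀ X Y, A (X + Y) = A X + A Y)
    (hA : ∀ ψ, DTV f (A ψ) + S₂ (A ψ) = A (DTV f ψ + S₁ ψ)) (φ ψ : Fin m → F) :
    DTV f (vary A φ ψ) + S₂ (vary A φ ψ) =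
      vary A (DTV f φ - EV φ f) ψ + vary A φ (DTV f ψ + S₁ ψ)
        - vary S₂ φ (A ψ) + A (vary S₁ φ ψ) := by
  have h1 := congrArg (EV φ) (hA ψ)
  have h2 := hA (EV φ ψ)
  have h3 : A (DTV f (EV φ ψ) + S₁ (EV φ ψ)) + A (vary S₁ φ ψ) =
      A (EV φ (DTV f ψ + S₁ ψ)) + A (EV (DTV f φ - EV φ f) ψ) := by
    rw [← hadd, ← hadd]
    congr 1
    rw [DTV_EV, vary, EV_add]
    abel
  rw [EV_add] at h1
  rw [vary, DTV_sub, hS₂, DTV_EV, vary, vary, vary, ← h1]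
  rw [← h2] at h3
  rw [← sub_eq_zero] at h3 ⊢
  rw [← neg_eq_zero, ← h3]
  abel

/-- `D_t` acts on pairings through the operators `D_t + S₂` and `D_t + S₁`. -/
theorem quotDer_DT_pair (hS : ∀ X χ, pair (S₂ X) χ = -pair X (S₁ χ)) (X χ : Fin m → F) :
    quotDer (DT f) (DT_D f) (pair X χ) =
      pair (DTV f X + S₂ X) χ + pair X (DTV f χ + S₁ χ) := by
  rw [quotDer_pair, pair_add_left, pair_add_right, hS]
  change pair (DTV f X) χ + pair X (DTV f χ) = _
  abel

theorem quotDer_DT_pair_vary (hS : ∀ X χ, pair (S₂ X) χ = -pair X (S₁ χ))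
    (hS₂ : ∀ X Y, S₂ (X - Y) = S₂ X - S₂ Y) (hadd : ∀ X Y, A (X + Y) = A X + A Y)
    (hA : ∀ ψ, DTV f (A ψ) + S₂ (A ψ) = A (DTV f ψ + S₁ ψ))
    (hskew : ∀ X Y, pair (A X) Y = -pair (A Y) X) (φ ψ χ : Fin m → F) :
    quotDer (DT f) (DT_D f) (pair (vary A φ ψ) χ) =
      pair (vary A (DTV f φ - EV φ f) ψ) χ + pair (vary A φ (DTV f ψ + S₁ ψ)) χ
        + pair (vary A φ ψ) (DTV f χ + S₁ χ)
        - pair (vary S₂ φ (A ψ)) χ + pair (vary S₂ φ (A χ)) ψ := by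
  rw [quotDer_DT_pair hS, lie_vary hS₂ hadd hA, pair_add_left, pair_sub_left, pair_add_left,
    hskew (vary S₁ φ ψ), pair_vary hS φ (A χ)]
  abel

/-- A bilinear expression is invariant if its pairings with a third argument are. -/
theorem lie_eq_of_pair (hS : ∀ X χ, pair (S₂ X) χ = -pair X (S₁ χ))
    {C : (Fin m → F) → (Fin m → F) → Fin m → F} (ψ₁ ψ₂ : Fin m → F)
    (h : ∀ ψ₃, quotDer (DT f) (DT_D f) (pair (C ψ₁ ψ₂) ψ₃) =
      pair (C (DTV f ψ₁ + S₁ ψ₁) ψ₂) ψ₃ + pair (C ψ₁ (DTV f ψ₂ + S₁ ψ₂)) ψ₃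
        + pair (C ψ₁ ψ₂) (DTV f ψ₃ + S₁ ψ₃)) :
    DTV f (C ψ₁ ψ₂) + S₂ (C ψ₁ ψ₂) =
      C (DTV f ψ₁ + S₁ ψ₁) ψ₂ + C ψ₁ (DTV f ψ₂ + S₁ ψ₂) := by
  rw [← sub_eq_zero]
  refine eq_zero_of_pair fun ψ₃ => ?_
  have h3 := h ψ₃
  rw [quotDer_DT_pair hS] at h3
  rw [pair_sub_left, pair_add_left (C _ _), sub_eq_zero]
  exact add_right_cancel h3

/-- The Schouten bracket of two invariant bivectors is invariant. The values `wA ψ ψ'` stand for the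
adjoint of `φ ↦ A'[φ]ψ` applied to `ψ'`, and are needed only through their pairings. -/
theorem lie_bracket {S₁ : (Fin m → F) → Fin m → F} {wA wB : (Fin m → F) → (Fin m → F) → Fin m → F}
    (hS : ∀ X χ, pair (EV X f) χ = pair X (S₁ χ))
    (haddA : ∀ X Y, A (X + Y) = A X + A Y) (haddB : ∀ X Y, B (X + Y) = B X + B Y)
    (hA : ∀ ψ, DTV f (A ψ) - EV (A ψ) f = A (DTV f ψ + S₁ ψ))
    (hB : ∀ ψ, DTV f (B ψ) - EV (B ψ) f = B (DTV f ψ + S₁ ψ))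
    (hskewA : ∀ X Y, pair (A X) Y = -pair (A Y) X)
    (hskewB : ∀ X Y, pair (B X) Y = -pair (B Y) X)
    (hwA : ∀ ψ ψ' φ, pair (wA ψ ψ') φ = pair (vary A φ ψ) ψ')
    (hwB : ∀ ψ ψ' φ, pair (wB ψ ψ') φ = pair (vary B φ ψ) ψ')
    {C : (Fin m → F) → (Fin m → F) → Fin m → F}
    (hC : ∀ ψ₁ ψ₂, C ψ₁ ψ₂ = vary A (B ψ₂) ψ₁ - vary A (B ψ₁) ψ₂ + vary B (A ψ₂) ψ₁
      - vary B (A ψ₁) ψ₂ - A (wB ψ₂ ψ₁) - B (wA ψ₂ ψ₁)) (ψ₁ ψ₂ : Fin m → F) :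
    DTV f (C ψ₁ ψ₂) - EV (C ψ₁ ψ₂) f =
      C (DTV f ψ₁ + S₁ ψ₁) ψ₂ + C ψ₁ (DTV f ψ₂ + S₁ ψ₂) := by
  have hS' : ∀ X χ, pair (-EV X f) χ = -pair X (S₁ χ) := fun X χ => by rw [pair_neg_left, hS]
  have hS₂ : ∀ X Y, -EV (X - Y) f = -EV X f - -EV Y f := fun X Y => by
    rw [EV_sub_left]; abel
  have hA' : ∀ ψ, DTV f (A ψ) + -EV (A ψ) f = A (DTV f ψ + S₁ ψ) := fun ψ => by
    rw [← sub_eq_add_neg, hA]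
  have hB' : ∀ ψ, DTV f (B ψ) + -EV (B ψ) f = B (DTV f ψ + S₁ ψ) := fun ψ => by
    rw [← sub_eq_add_neg, hB]
  -- By skewness of `A` and `B`, the adjoints in the bracket turn into variations evaluated on
  -- the third argument.
  have hT : ∀ ψ₁ ψ₂ ψ₃, pair (C ψ₁ ψ₂) ψ₃ =
      pair (vary A (B ψ₂) ψ₁) ψ₃ - pair (vary A (B ψ₁) ψ₂) ψ₃ + pair (vary B (A ψ₂) ψ₁) ψ₃
      - pair (vary B (A ψ₁) ψ₂) ψ₃ + pair (vary B (A ψ₃) ψ₂) ψ₁ + pair (vary A (B ψ₃) ψ₂) ψ₁ := by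
    intro ψ₁ ψ₂ ψ₃
    rw [hC, pair_sub_left, pair_sub_left, pair_sub_left, pair_add_left, pair_sub_left,
      hskewA (wB _ _), hskewB (wA _ _), pair_comm (A ψ₃), pair_comm (B ψ₃), hwA, hwB]
    abel
  rw [sub_eq_add_neg]
  refine lie_eq_of_pair (S₂ := fun X => -EV X f) hS' ψ₁ ψ₂ fun ψ₃ => ?_
  have kA := quotDer_DT_pair_vary hS' hS₂ haddA hA' hskewA
  have kB := quotDer_DT_pair_vary hS' hS₂ haddB hB' hskewB
  have sym : ∀ φ χ, vary (fun X => -EV X f) φ χ = vary (fun X => -EV X f) χ φ := fun φ χ => by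
    rw [vary_neg, vary_neg, vary_lin_symm]
  rw [hT, hT, hT, hT, map_add, map_add, map_sub, map_add, map_sub, kA, kA, kA, kB, kB, kB,
    hA, hA, hA, hB, hB, hB, sym (A ψ₁) (B ψ₂), sym (A ψ₁) (B ψ₃), sym (A ψ₂) (B ψ₁),
    sym (A ψ₂) (B ψ₃), sym (A ψ₃) (B ψ₁), sym (A ψ₃) (B ψ₂)]
  abel

/-- The differential of an invariant 2-form is invariant. As for the bracket, `w ψ ψ'` stands for the
adjoint of `φ ↦ A'[φ]ψ` applied to `ψ'`. -/
theorem lie_diffForm {S₂ : (Fin m → F) → Fin m → F} {w : (Fin m → F) → (Fin m → F) → Fin m → F}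
    (hS : ∀ X χ, pair (EV X f) χ = pair X (S₂ χ)) (hS₂ : ∀ X Y, S₂ (X - Y) = S₂ X - S₂ Y)
    (hadd : ∀ X Y, A (X + Y) = A X + A Y)
    (hA : ∀ φ, DTV f (A φ) + S₂ (A φ) = A (DTV f φ - EV φ f))
    (hskew : ∀ X Y, pair (A X) Y = -pair (A Y) X)
    (hw : ∀ ψ ψ' φ, pair (w ψ ψ') φ = pair (vary A φ ψ) ψ')
    {C : (Fin m → F) → (Fin m → F) → Fin m → F}
    (hC : ∀ φ₁ φ₂, C φ₁ φ₂ = vary A φ₁ φ₂ - vary A φ₂ φ₁ + w φ₁ φ₂) (φ₁ φ₂ : Fin m → F) :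
    DTV f (C φ₁ φ₂) + S₂ (C φ₁ φ₂) =
      C (DTV f φ₁ - EV φ₁ f) φ₂ + C φ₁ (DTV f φ₂ - EV φ₂ f) := by
  have hS' : ∀ X χ, pair (S₂ X) χ = -pair X (-EV χ f) := fun X χ => by
    rw [pair_comm, ← hS, pair_comm X, pair_neg_left, neg_neg]
  have hA' : ∀ ψ, DTV f (A ψ) + S₂ (A ψ) = A (DTV f ψ + -EV ψ f) := fun ψ => by
    rw [← sub_eq_add_neg, hA]
  have hT : ∀ φ₁ φ₂ φ₃, pair (C φ₁ φ₂) φ₃ =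
      pair (vary A φ₁ φ₂) φ₃ - pair (vary A φ₂ φ₁) φ₃ + pair (vary A φ₃ φ₁) φ₂ := by
    intro φ₁ φ₂ φ₃
    rw [hC, pair_add_left, pair_sub_left, hw]
  have h := lie_eq_of_pair (f := f) (S₁ := fun X => -EV X f) (C := C) hS' φ₁ φ₂ fun ψ₃ => ?_
  · simpa only [sub_eq_add_neg] using h
  have k := quotDer_DT_pair_vary hS' hS₂ hadd hA' hskew
  have sym : ∀ φ X χ, pair (vary S₂ φ X) χ = pair X (vary (fun X => EV X f) φ χ) := by
    intro φ X χ
    rw [pair_vary hS', vary_neg, pair_comm, pair_neg_left, neg_neg, pair_comm]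
  rw [hT, hT, hT, hT, map_add, map_sub, k, k, k]
  simp only [sym, sub_eq_add_neg]
  rw [vary_lin_symm f φ₁ φ₂, vary_lin_symm f φ₁ ψ₃, vary_lin_symm f φ₂ ψ₃]
  abel

end Invariance

end

/-! ### Nonsingularity of the symbol of the invariance equation -/

section LinearAlgebra

open Module.End

theorem exists_eigenspace_inf_ne_bot {W : Type*} [AddCommGroup W] [Module ℂ W]
    [FiniteDimensional ℂ W] (X : Module.End ℂ W) {p : Submodule ℂ W} (hp : p ≠ ⊥)
    (hX : ∀ v ∈ p, X v ∈ p) : ∃ μ : ℂ, eigenspace X μ ⊓ p ≠ ⊥ := by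
  have : Nontrivial p := Submodule.nontrivial_iff_ne_bot.2 hp
  obtain ⟨μ, hμ⟩ := exists_eigenvalue (X.restrict hX)
  obtain ⟨v, hv⟩ := hμ.exists_hasEigenvector
  refine ⟨μ, fun h => hv.2 ?_⟩
  have hmem : (v : W) ∈ eigenspace X μ ⊓ p := by
    refine ⟨mem_eigenspace_iff.2 ?_, v.2⟩
    have := congrArg Subtype.val hv.apply_eq_smul
    simpa using this
  rw [h, Submodule.mem_bot] at hmem
  exact Subtype.ext hmem

/-- If a combination of three commuting endomorphisms is not injective, then they have a common
eigenvector in its kernel. -/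
theorem exists_common_eigenvalues {W : Type*} [AddCommGroup W] [Module ℂ W]
    [FiniteDimensional ℂ W] {X Y Z : Module.End ℂ W} (hXY : Commute X Y) (hXZ : Commute X Z)
    (hYZ : Commute Y Z) (a b : ℂ) {v : W} (hv : v ≠ 0) (h : a • Z v - X v - b • Y v = 0) :
    ∃ ξ υ ζ : ℂ, HasEigenvalue X ξ ∧ HasEigenvalue Y υ ∧ HasEigenvalue Z ζ ∧
      a * ζ - ξ - b * υ = 0 := by
  set N : Module.End ℂ W := a • Z - X - b • Y with hN
  have hXN : Commute X N := ((hXZ.smul_right a).sub_right (Commute.refl X)).sub_right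
    (hXY.smul_right b)
  have hYN : Commute Y N := ((hYZ.smul_right a).sub_right hXY.symm).sub_right
    ((Commute.refl Y).smul_right b)
  have hZN : Commute Z N := (((Commute.refl Z).smul_right a).sub_right hXZ.symm).sub_right
    (hYZ.symm.smul_right b)
  have hinv : ∀ {S T : Module.End ℂ W} (_ : Commute S T) (μ : ℂ), ∀ w ∈ eigenspace T μ,
      S w ∈ eigenspace T μ := by
    intro S T hST μ w hw
    rw [mem_eigenspace_iff] at hw ⊢
    rw [← mul_apply, ← hST.eq, mul_apply, hw, map_smul]
  have hker : eigenspace N 0 ≠ ⊥ := by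
    intro h0
    have : v ∈ eigenspace N 0 := by
      rw [mem_eigenspace_iff, zero_smul]
      exact h
    rw [h0] at this
    exact hv ((Submodule.mem_bot ℂ).1 this)
  obtain ⟨ξ, hξ⟩ := exists_eigenspace_inf_ne_bot X hker (hinv hXN 0)
  obtain ⟨υ, hυ⟩ := exists_eigenspace_inf_ne_bot Y hξ
    (fun w hw => ⟨hinv hXY.symm ξ w hw.1, hinv hYN 0 w hw.2⟩)
  obtain ⟨ζ, hζ⟩ := exists_eigenspace_inf_ne_bot Z hυ
    (fun w hw => ⟨hinv hYZ.symm υ w hw.1, hinv hXZ.symm ξ w hw.2.1, hinv hZN 0 w hw.2.2⟩)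
  obtain ⟨w, ⟨hZ, hY, hX, hw⟩, h0⟩ := Submodule.exists_mem_ne_zero_of_ne_bot hζ
  refine ⟨ξ, υ, ζ, hasEigenvalue_of_hasEigenvector ⟨hX, h0⟩,
    hasEigenvalue_of_hasEigenvector ⟨hY, h0⟩, hasEigenvalue_of_hasEigenvector ⟨hZ, h0⟩, ?_⟩
  rw [SetLike.mem_coe, mem_eigenspace_iff] at hX hY hZ
  rw [SetLike.mem_coe, mem_eigenspace_iff, zero_smul, hN] at hw
  simp only [LinearMap.sub_apply, LinearMap.smul_apply, hX, hY, hZ, smul_smul, ← sub_smul] at hw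
  exact (smul_eq_zero.1 hw).resolve_right h0

/-- For `l > 1` the relation `(1+s)^l ζ = ξ + s^l υ` with `ζ ≠ 0` cannot hold for infinitely many
`s`: the coefficient of `s` is `l ζ`. -/
theorem finite_setOf_relation {l : ℕ} (hl : 1 < l) {ξ υ ζ : ℂ} (hζ : ζ ≠ 0) :
    {s : ℂ | (1 + s) ^ l * ζ - ξ - s ^ l * υ = 0}.Finite := by
  by_contra h
  have hp : ((1 + Polynomial.X) ^ l * Polynomial.C ζ - Polynomial.C ξ
      - Polynomial.X ^ l * Polynomial.C υ : Polynomial ℂ) = 0 := by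
    refine Polynomial.eq_zero_of_infinite_isRoot _ (Set.Infinite.mono (fun s hs => ?_) h)
    change Polynomial.eval s _ = 0
    simp only [Polynomial.eval_sub, Polynomial.eval_mul, Polynomial.eval_pow, Polynomial.eval_add,
      Polynomial.eval_one, Polynomial.eval_X, Polynomial.eval_C]
    exact hs
  have hc := congrArg (fun q => Polynomial.coeff q 1) hp
  simp only [Polynomial.coeff_sub, Polynomial.coeff_mul_C, Polynomial.coeff_one_add_X_pow,
    Polynomial.coeff_X_pow, Polynomial.coeff_C, Polynomial.coeff_zero] at hc
  rw [if_neg (by omega), if_neg (by omega)] at hc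
  simp only [Nat.choose_one_right, sub_zero, zero_mul, mul_eq_zero, Nat.cast_eq_zero] at hc
  rcases hc with h0 | h0
  · omega
  · exact hζ h0

theorem exists_det_ne_zero_of_commute {ι : Type*} [Fintype ι] [DecidableEq ι] {l : ℕ} (hl : 1 < l)
    {X Y Z : Matrix ι ι ℂ} (hXY : Commute X Y) (hXZ : Commute X Z) (hYZ : Commute Y Z)
    (hZ : Z.det ≠ 0) :
    ∃ s : ℝ, ((1 + (s : ℂ)) ^ l • Z - X - (s : ℂ) ^ l • Y).det ≠ 0 := by
  by_contra! hdet
  have hcomm : ∀ {S T : Matrix ι ι ℂ}, Commute S T →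
      Commute (Matrix.toLin' S) (Matrix.toLin' T) := fun h => by
    rw [commute_iff_eq, Module.End.mul_eq_comp, Module.End.mul_eq_comp, ← Matrix.toLin'_mul, h.eq,
      Matrix.toLin'_mul]
  have key : ∀ s : ℝ, ∃ ξ υ ζ : ℂ, HasEigenvalue (Matrix.toLin' X) ξ ∧
      HasEigenvalue (Matrix.toLin' Y) υ ∧ HasEigenvalue (Matrix.toLin' Z) ζ ∧
      (1 + (s : ℂ)) ^ l * ζ - ξ - (s : ℂ) ^ l * υ = 0 := by
    intro s
    obtain ⟨v, hv, h⟩ := Matrix.exists_mulVec_eq_zero_iff.2 (hdet s)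
    refine exists_common_eigenvalues (hcomm hXY) (hcomm hXZ) (hcomm hYZ) _ _ hv ?_
    simpa only [Matrix.sub_mulVec, Matrix.smul_mulVec, Matrix.toLin'_apply] using h
  have hζ : ∀ ζ, HasEigenvalue (Matrix.toLin' Z) ζ → ζ ≠ 0 := by
    rintro ζ h rfl
    obtain ⟨v, hv⟩ := h.exists_hasEigenvector
    refine hZ (Matrix.exists_mulVec_eq_zero_iff.1 ⟨v, hv.2, ?_⟩)
    simpa using hv.apply_eq_smul
  have hfin : (⋃ ξ ∈ {ξ | HasEigenvalue (Matrix.toLin' X) ξ},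
      ⋃ υ ∈ {υ | HasEigenvalue (Matrix.toLin' Y) υ},
      ⋃ ζ ∈ {ζ | HasEigenvalue (Matrix.toLin' Z) ζ},
        {s : ℂ | (1 + s) ^ l * ζ - ξ - s ^ l * υ = 0}).Finite :=
    Set.Finite.biUnion (finite_hasEigenvalue _) fun ξ _ =>
      Set.Finite.biUnion (finite_hasEigenvalue _) fun υ _ =>
      Set.Finite.biUnion (finite_hasEigenvalue _) fun ζ h => finite_setOf_relation hl (hζ ζ h)
  have hinf : (range (fun s : ℝ => (s : ℂ))).Infinite :=
    Set.infinite_range_of_injective Complex.ofReal_injective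
  refine hinf (hfin.subset ?_)
  rintro _ ⟨s, rfl⟩
  obtain ⟨ξ, υ, ζ, h1, h2, h3, h4⟩ := key s
  simp only [mem_iUnion, mem_ofPred_eq]
  exact ⟨ξ, h1, υ, h2, ζ, h3, h4⟩

open scoped Kronecker

/-- The matrix of the linear map `c ↦ p c(·,·) - c(r₁ ·, ·) - c(·, r₂ ·)` on bilinear maps `c`. -/
def lieMatrix {m : ℕ} {K : Type*} [CommRing K] (p r₁ r₂ : Matrix (Fin m) (Fin m) K) :
    Matrix (Fin m × Fin m × Fin m) (Fin m × Fin m × Fin m) K :=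
  p ⊗ₖ ((1 : Matrix (Fin m) (Fin m) K) ⊗ₖ (1 : Matrix (Fin m) (Fin m) K))
    - (1 : Matrix (Fin m) (Fin m) K) ⊗ₖ (r₁ᵀ ⊗ₖ (1 : Matrix (Fin m) (Fin m) K))
    - (1 : Matrix (Fin m) (Fin m) K) ⊗ₖ ((1 : Matrix (Fin m) (Fin m) K) ⊗ₖ r₂ᵀ)

theorem lieMatrix_mulVec {m : ℕ} {K : Type*} [CommRing K] (p r₁ r₂ : Matrix (Fin m) (Fin m) K)
    (c : Fin m × Fin m × Fin m → K) (i j k : Fin m) :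
    (lieMatrix p r₁ r₂ *ᵥ c) (i, j, k) = ∑ i', p i i' * c (i', j, k)
      - ∑ j', c (i, j', k) * r₁ j' j - ∑ k', c (i, j, k') * r₂ k' k := by
  simp only [lieMatrix, Matrix.mulVec, dotProduct, Matrix.sub_apply, sub_mul,
    Finset.sum_sub_distrib, Matrix.kroneckerMap_apply, Fintype.sum_prod_type, Matrix.one_apply,
    Matrix.transpose_apply, mul_ite, ite_mul, mul_one, mul_zero, one_mul, zero_mul,
    Finset.sum_ite_eq, Finset.mem_univ, if_true]
  simp [mul_comm]

theorem exists_det_lieMatrix_ne_zero {m l : ℕ} (hl : 1 < l) {p : Matrix (Fin m) (Fin m) ℝ}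
    (hp : p.det ≠ 0) (r : Matrix (Fin m) (Fin m) ℝ) :
    ∃ s : ℝ, (lieMatrix ((1 + s) ^ l • p) r (s ^ l • r)).det ≠ 0 := by
  set P := p.map (algebraMap ℝ ℂ) with hP
  set R := r.map (algebraMap ℝ ℂ) with hR
  obtain ⟨s, hs⟩ := exists_det_ne_zero_of_commute hl
    (X := (1 : Matrix (Fin m) (Fin m) ℂ) ⊗ₖ (Rᵀ ⊗ₖ (1 : Matrix (Fin m) (Fin m) ℂ)))
    (Y := (1 : Matrix (Fin m) (Fin m) ℂ) ⊗ₖ ((1 : Matrix (Fin m) (Fin m) ℂ) ⊗ₖ Rᵀ))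
    (Z := P ⊗ₖ ((1 : Matrix (Fin m) (Fin m) ℂ) ⊗ₖ (1 : Matrix (Fin m) (Fin m) ℂ)))
    (by simp only [commute_iff_eq, ← Matrix.mul_kronecker_mul, mul_one, one_mul])
    (by simp only [commute_iff_eq, ← Matrix.mul_kronecker_mul, mul_one, one_mul])
    (by simp only [commute_iff_eq, ← Matrix.mul_kronecker_mul, mul_one, one_mul])
    (by
      have : P.det ≠ 0 := by
        rw [hP, ← RingHom.mapMatrix_apply, ← RingHom.map_det]
        simpa using hp
      simp [Matrix.det_kronecker, this])
  refine ⟨s, fun h0 => hs ?_⟩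
  have h1 := congrArg (algebraMap ℝ ℂ) h0
  rw [RingHom.map_det, map_zero] at h1
  rw [← h1]
  congr 1
  ext ⟨i, j, k⟩ ⟨i', j', k'⟩
  simp only [lieMatrix, hP, hR, RingHom.mapMatrix_apply, Matrix.map_apply, Matrix.sub_apply,
    Matrix.smul_apply, Matrix.kroneckerMap_apply, Matrix.transpose_apply, smul_eq_mul,
    Matrix.one_apply, map_sub, Complex.coe_algebraMap]
  split_ifs <;> simp

end LinearAlgebra

section

open JetAlgebra

variable {n m : ℕ} {F : Type*} [CommRing F] [Algebra ℝ F] [JetAlgebra n m F]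

/-! ### Symbols through oscillating families -/

/-- The family `ψ s` has the form `exp(s θ·x) P(s)`, where `P` is a polynomial in `s` of degree at
most `d` whose coefficient of degree `d` is `g`. -/
def Growth (θ : Fin n → ℝ) (ψ : ℝ → F) (d : ℕ) (g : F) : Prop :=
  ∃ P : Polynomial F, P.natDegree ≤ d ∧ P.coeff d = g ∧
    ∀ s, ψ s = ex (s • θ) * P.eval (algebraMap ℝ F s)

/-- The leading coefficient is determined by the family, since a polynomial in `s` vanishing for all
real `s` is zero. -/
theorem Growth.unique {θ : Fin n → ℝ} {ψ : ℝ → F} {d : ℕ} {g g' : F} (h : Growth θ ψ d g)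
    (h' : Growth θ ψ d g') : g = g' := by
  obtain ⟨P, -, rfl, hP⟩ := h
  obtain ⟨Q, -, rfl, hQ⟩ := h'
  rw [← sub_eq_zero]
  refine ext_points _ fun ev => ?_
  have : P.map (ev : F →+* ℝ) = Q.map (ev : F →+* ℝ) := by
    refine Polynomial.funext fun s => ?_
    have h := congrArg ev ((hP s).symm.trans (hQ s))
    rw [map_mul, map_mul] at h
    have h := mul_left_cancel₀ (map_ex_ne_zero ev _) h
    have e : ∀ R : Polynomial F, (R.map (ev : F →+* ℝ)).eval s = ev (R.eval (algebraMap ℝ F s)) := by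
      intro R
      have := Polynomial.eval_map_apply (f := (ev : F →+* ℝ)) (p := R) (algebraMap ℝ F s)
      simpa using this
    rw [e, e, h]
  have := congrArg (fun R => Polynomial.coeff R d) this
  simpa [sub_eq_zero] using this

/-- In a higher degree the coefficient is zero. -/
theorem Growth.mono {θ : Fin n → ℝ} {ψ : ℝ → F} {d d' : ℕ} {g : F} (h : Growth θ ψ d g)
    (hd : d < d') : Growth θ ψ d' 0 := by
  obtain ⟨P, hP, -, hψ⟩ := h
  exact ⟨P, hP.trans hd.le, Polynomial.coeff_eq_zero_of_natDegree_lt (hP.trans_lt hd), hψ⟩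

theorem Growth.cast {θ : Fin n → ℝ} {ψ : ℝ → F} {d d' : ℕ} {g g' : F} (h : Growth θ ψ d g)
    (hd : d = d') (hg : g = g') : Growth θ ψ d' g' := by
  subst hd hg
  exact h

theorem growth_zero (θ : Fin n → ℝ) (d : ℕ) : Growth θ (fun _ => (0 : F)) d 0 :=
  ⟨0, by simp, by simp, fun s => by simp⟩

theorem growth_ex_mul (θ : Fin n → ℝ) (g : F) : Growth θ (fun s => ex (s • θ) * g) 0 g :=
  ⟨Polynomial.C g, by simp, by simp, fun s => by simp⟩

theorem Growth.add {θ : Fin n → ℝ} {ψ χ : ℝ → F} {d : ℕ} {g h : F} (hψ : Growth θ ψ d g)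
    (hχ : Growth θ χ d h) : Growth θ (fun s => ψ s + χ s) d (g + h) := by
  obtain ⟨P, hP, rfl, hψ⟩ := hψ
  obtain ⟨Q, hQ, rfl, hχ⟩ := hχ
  refine ⟨P + Q, Polynomial.natDegree_add_le_of_degree_le hP hQ, Polynomial.coeff_add _ _ _,
    fun s => ?_⟩
  beta_reduce
  rw [hψ, hχ, Polynomial.eval_add, mul_add]

theorem Growth.sum {ι : Type*} (S : Finset ι) {θ : Fin n → ℝ} {ψ : ι → ℝ → F} {d : ℕ} {g : ι → F}
    (h : ∀ a ∈ S, Growth θ (ψ a) d (g a)) :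
    Growth θ (fun s => ∑ a ∈ S, ψ a s) d (∑ a ∈ S, g a) := by
  classical
  induction S using Finset.induction_on with
  | empty => simpa using growth_zero θ d
  | insert a S ha ih =>
    simp only [Finset.sum_insert ha]
    exact (h a (Finset.mem_insert_self _ _)).add
      (ih fun b hb => h b (Finset.mem_insert_of_mem hb))

theorem Growth.mul {θ θ' : Fin n → ℝ} {ψ χ : ℝ → F} {d d' : ℕ} {g h : F} (hψ : Growth θ ψ d g)
    (hχ : Growth θ' χ d' h) : Growth (θ + θ') (fun s => ψ s * χ s) (d + d') (g * h) := by
  obtain ⟨P, hP, rfl, hψ⟩ := hψ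
  obtain ⟨Q, hQ, rfl, hχ⟩ := hχ
  refine ⟨P * Q, Polynomial.natDegree_mul_le_of_le hP hQ,
    Polynomial.coeff_mul_add_eq_of_natDegree_le hP hQ, fun s => ?_⟩
  beta_reduce
  rw [hψ, hχ, Polynomial.eval_mul, smul_add, ex_add]
  ring

theorem Growth.const_mul {θ : Fin n → ℝ} {ψ : ℝ → F} {d : ℕ} {g : F} (a : F)
    (h : Growth θ ψ d g) : Growth θ (fun s => a * ψ s) d (a * g) := by
  have h0 : Growth (0 : Fin n → ℝ) (fun _ => a) 0 a := by
    simpa [ex_zero] using growth_ex_mul (0 : Fin n → ℝ) a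
  simpa using h0.mul h

theorem exists_polynomial_der (δ : Derivation ℝ F F) {P : Polynomial F} {d : ℕ}
    (hP : P.natDegree ≤ d) : ∃ Q : Polynomial F, Q.natDegree ≤ d ∧ Q.coeff d = δ (P.coeff d) ∧
      ∀ s, δ (P.eval (algebraMap ℝ F s)) = Q.eval (algebraMap ℝ F s) := by
  refine ⟨∑ k ∈ Finset.range (d + 1), Polynomial.monomial k (δ (P.coeff k)), ?_, ?_, fun s => ?_⟩
  · refine Polynomial.natDegree_sum_le_of_forall_le _ _ fun k hk => ?_
    exact (Polynomial.natDegree_monomial_le _).trans (Nat.lt_succ_iff.1 (Finset.mem_range.1 hk))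
  · simp [Polynomial.finsetSum_coeff, Polynomial.coeff_monomial]
  · rw [Polynomial.eval_eq_sum_range' (Nat.lt_succ_of_le hP), Polynomial.eval_finsetSum, map_sum]
    refine Finset.sum_congr rfl fun k _ => ?_
    rw [Polynomial.eval_monomial, ← map_pow, Derivation.leibniz, Derivation.map_algebraMap,
      smul_zero, zero_add, smul_eq_mul, mul_comm]

/-- A derivation killing the exponentials does not increase the degree. -/
theorem Growth.der {θ : Fin n → ℝ} {ψ : ℝ → F} {d : ℕ} {g : F} (h : Growth θ ψ d g)
    {δ : Derivation ℝ F F} (hδ : ∀ θ, δ (ex θ) = 0) : Growth θ (fun s => δ (ψ s)) d (δ g) := by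
  obtain ⟨P, hP, rfl, hψ⟩ := h
  obtain ⟨Q, hQ, hc, hQe⟩ := exists_polynomial_der δ hP
  refine ⟨Q, hQ, hc, fun s => ?_⟩
  beta_reduce
  rw [hψ, Derivation.leibniz, hδ, smul_zero, add_zero, smul_eq_mul, hQe]

theorem Growth.D {θ : Fin n → ℝ} {ψ : ℝ → F} {d : ℕ} {g : F} (h : Growth θ ψ d g) (i : Fin n) :
    Growth θ (fun s => D i (ψ s)) (d + 1) (algebraMap ℝ F (θ i) * g) := by
  obtain ⟨P, hP, rfl, hψ⟩ := h
  obtain ⟨Q, hQ, hc, hQe⟩ := exists_polynomial_der (VarCalc.D i) hP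
  refine ⟨Q + Polynomial.C (algebraMap ℝ F (θ i)) * P * Polynomial.X, ?_, ?_, fun s => ?_⟩
  · refine Polynomial.natDegree_add_le_of_degree_le (hQ.trans (Nat.le_succ d)) ?_
    refine Polynomial.natDegree_mul_le_of_le ?_ Polynomial.natDegree_X_le
    exact (Polynomial.natDegree_C_mul_le _ _).trans hP
  · rw [Polynomial.coeff_add, Polynomial.coeff_mul_X, Polynomial.coeff_C_mul,
      Polynomial.coeff_eq_zero_of_natDegree_lt (Nat.lt_succ_of_le hQ), zero_add]
  · beta_reduce
    rw [hψ, Derivation.leibniz, hQe, D_ex, smul_eq_mul, smul_eq_mul, Polynomial.eval_add,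
      Polynomial.eval_mul, Polynomial.eval_mul, Polynomial.eval_C, Polynomial.eval_X,
      Pi.smul_apply, smul_eq_mul, map_mul]
    ring

theorem Growth.Dσ {θ : Fin n → ℝ} {ψ : ℝ → F} {d : ℕ} {g : F} (h : Growth θ ψ d g) (σ : MI n) :
    Growth θ (fun s => Dσ σ (ψ s)) (d + σ.degree) (algebraMap ℝ F (mon θ σ) * g) := by
  induction σ using MI.induction with
  | h0 => simpa [Dσ_zero, mon_zero] using h
  | hs σ i ih =>
    simp only [Dσ_add_single]
    refine (ih.D i).cast ?_ ?_
    · rw [degree_add_single, add_assoc]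
    · rw [mon_add_single, map_mul, mul_assoc]

theorem DT_ex (f : Fin m → F) (θ : Fin n → ℝ) : DT f (ex θ) = 0 := by
  rw [DT_apply, dt_ex, E, vert_eq_sum _ (T := ∅) (fun σ _ j => du_ex σ j θ), Finset.sum_empty,
    add_zero]

/-- Componentwise `Growth`. -/
def GrowthV (θ : Fin n → ℝ) (Ψ : ℝ → Fin m → F) (d : ℕ) (g : Fin m → F) : Prop :=
  ∀ i, Growth θ (fun s => Ψ s i) d (g i)

/-- The oscillating family `exp(s θ·x) e_j`. -/
theorem growthV_single (θ : Fin n → ℝ) (j : Fin m) :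
    GrowthV θ (fun s => (Pi.single j (ex (s • θ)) : Fin m → F)) 0 (Pi.single j 1) := by
  intro i
  by_cases hij : i = j
  · subst hij
    simpa using growth_ex_mul θ (1 : F)
  · simpa [Pi.single_eq_of_ne hij] using growth_zero θ 0

/-! ### Differential operators with given coefficients -/

/-- The operator `∑_{σ ∈ T} a_{ij}^σ D_σ`. The finite set `T` is part of the data; coefficients
outside it are ignored. -/
def opAct (T : Finset (MI n)) (a : MI n → Fin m → Fin m → F) (ψ : Fin m → F) : Fin m → F :=
  fun i => ∑ σ ∈ T, ∑ j, a σ i j * Dσ σ (ψ j)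

/-- The adjoint of the operator `∑_{σ ∈ T} a_{ij}^σ D_σ`. -/
def opAdj (T : Finset (MI n)) (a : MI n → Fin m → Fin m → F) (ψ : Fin m → F) : Fin m → F :=
  fun i => ∑ σ ∈ T, ∑ j, (-1) ^ σ.degree * Dσ σ (a σ j i * ψ j)

theorem opAct_add (T : Finset (MI n)) (a : MI n → Fin m → Fin m → F) (ψ χ : Fin m → F) :
    opAct T a (ψ + χ) = opAct T a ψ + opAct T a χ := by
  funext i
  simp only [opAct, Pi.add_apply, Dσ_add, mul_add, Finset.sum_add_distrib]

theorem opAdj_sub (T : Finset (MI n)) (a : MI n → Fin m → Fin m → F) (ψ χ : Fin m → F) :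
    opAdj T a (ψ - χ) = opAdj T a ψ - opAdj T a χ := by
  funext i
  simp only [opAdj, Pi.sub_apply, mul_sub, Dσ_sub, Finset.sum_sub_distrib]

/-- `opAdj` is adjoint to `opAct` modulo total divergences. -/
theorem pair_opAct (T : Finset (MI n)) (a : MI n → Fin m → Fin m → F) (ψ χ : Fin m → F) :
    pair (opAct T a ψ) χ = pair ψ (opAdj T a χ) := by
  have h : ∀ (σ : MI n) i j, (Submodule.Quotient.mk (a σ i j * Dσ σ (ψ j) * χ i) : F ⧸ divs F) =
      Submodule.Quotient.mk (ψ j * ((-1) ^ σ.degree * Dσ σ (a σ i j * χ i))) := by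
    intro σ i j
    rw [← mk_Dσ_mul]
    congr 1
    ring
  have mk_sum : ∀ {ι : Type} (s : Finset ι) (g : ι → F),
      (Submodule.Quotient.mk (∑ a ∈ s, g a) : F ⧸ divs F) =
        ∑ a ∈ s, Submodule.Quotient.mk (g a) := fun s g => map_sum (divs F).mkQ g s
  simp only [pair, opAct, opAdj, Finset.sum_mul, Finset.mul_sum, mk_sum, h]
  rw [Finset.sum_comm]
  conv_rhs => rw [Finset.sum_comm]
  refine Finset.sum_congr rfl fun σ _ => ?_
  rw [Finset.sum_comm]

/-- The symbol of degree `l` of the operator `∑_{σ ∈ T} a_{ij}^σ D_σ`. -/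
def symb (T : Finset (MI n)) (l : ℕ) (a : MI n → Fin m → Fin m → F) (θ : Fin n → ℝ) :
    Matrix (Fin m) (Fin m) F :=
  fun i j => ∑ σ ∈ T with σ.degree = l, algebraMap ℝ F (mon θ σ) * a σ i j

theorem GrowthV.opAct {θ : Fin n → ℝ} {Ψ : ℝ → Fin m → F} {d : ℕ} {g : Fin m → F}
    (h : GrowthV θ Ψ d g) {T : Finset (MI n)} {a : MI n → Fin m → Fin m → F} {l : ℕ}
    (hT : ∀ σ ∈ T, σ.degree ≤ l) :
    GrowthV θ (fun s => opAct T a (Ψ s)) (d + l) (symb T l a θ *ᵥ g) := by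
  intro i
  have key : ∀ σ ∈ T, ∀ j, Growth θ (fun s => a σ i j * VarCalc.Dσ σ (Ψ s j)) (d + l)
      (if σ.degree = l then algebraMap ℝ F (mon θ σ) * a σ i j * g j else 0) := by
    intro σ hσ j
    have hg := ((h j).Dσ σ).const_mul (a σ i j)
    split_ifs with hl
    · exact hg.cast (by rw [hl]) (by ring)
    · exact hg.mono (by have := hT σ hσ; omega)
  refine (Growth.sum T fun σ hσ => Growth.sum Finset.univ fun j _ => key σ hσ j).cast rfl ?_
  simp only [Matrix.mulVec, dotProduct, symb, Finset.sum_mul, Finset.sum_filter]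
  rw [Finset.sum_comm]
  refine Finset.sum_congr rfl fun j _ => Finset.sum_congr rfl fun σ _ => ?_
  rw [ite_mul, zero_mul]

theorem GrowthV.opAdj {θ : Fin n → ℝ} {Ψ : ℝ → Fin m → F} {d : ℕ} {g : Fin m → F}
    (h : GrowthV θ Ψ d g) {T : Finset (MI n)} {a : MI n → Fin m → Fin m → F} {l : ℕ}
    (hT : ∀ σ ∈ T, σ.degree ≤ l) :
    GrowthV θ (fun s => opAdj T a (Ψ s)) (d + l)
      (symb T l (fun σ i j => (-1) ^ l * a σ j i) θ *ᵥ g) := by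
  intro i
  have key : ∀ σ ∈ T, ∀ j, Growth θ
      (fun s => (-1) ^ σ.degree * VarCalc.Dσ σ (a σ j i * Ψ s j)) (d + l)
      (if σ.degree = l then algebraMap ℝ F (mon θ σ) * ((-1) ^ l * a σ j i) * g j else 0) := by
    intro σ hσ j
    have hg := (((h j).const_mul (a σ j i)).Dσ σ).const_mul ((-1) ^ σ.degree)
    split_ifs with hl
    · exact hg.cast (by rw [hl]) (by rw [hl]; ring)
    · exact hg.mono (by have := hT σ hσ; omega)
  refine (Growth.sum T fun σ hσ => Growth.sum Finset.univ fun j _ => key σ hσ j).cast rfl ?_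
  simp only [Matrix.mulVec, dotProduct, symb, Finset.sum_mul, Finset.sum_filter]
  rw [Finset.sum_comm]
  refine Finset.sum_congr rfl fun j _ => Finset.sum_congr rfl fun σ _ => ?_
  rw [ite_mul, zero_mul]

theorem GrowthV.neg {θ : Fin n → ℝ} {Ψ : ℝ → Fin m → F} {d : ℕ} {g : Fin m → F}
    (h : GrowthV θ Ψ d g) : GrowthV θ (fun s => -Ψ s) d (-g) := fun i => by
  simpa using (h i).const_mul (-1)

theorem symb_neg {R : Type*} [CommRing R] [Algebra ℝ R] (T : Finset (MI n)) (l : ℕ)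
    (a : MI n → Fin m → Fin m → R) (θ : Fin n → ℝ) :
    symb T l (fun σ i j => -a σ i j) θ = -symb T l a θ := by
  ext i j
  simp [symb]

theorem GrowthV.DTV {θ : Fin n → ℝ} {Ψ : ℝ → Fin m → F} {d d' : ℕ} {g : Fin m → F}
    (h : GrowthV θ Ψ d g) (f : Fin m → F) (hd : d < d') :
    GrowthV θ (fun s => DTV f (Ψ s)) d' 0 :=
  fun i => ((h i).der (DT_ex f)).mono hd

theorem GrowthV.add {θ : Fin n → ℝ} {Ψ X : ℝ → Fin m → F} {d : ℕ} {g h : Fin m → F}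
    (hΨ : GrowthV θ Ψ d g) (hX : GrowthV θ X d h) :
    GrowthV θ (fun s => Ψ s + X s) d (g + h) :=
  fun i => (hΨ i).add (hX i)

/-! ### Bidifferential operators -/

/-- The generators `(ψ, χ) ↦ D_σ(ψ_j) D_τ(χ_k)` of the bidifferential operators. -/
def bidiffGen (F : Type*) [CommRing F] [Algebra ℝ F] [JetAlgebra n m F]
    (a : (MI n × Fin m) × (MI n × Fin m)) : (Fin m → F) × (Fin m → F) → F :=
  fun ψ => Dσ a.1.1 (ψ.1 a.1.2) * Dσ a.2.1 (ψ.2 a.2.2)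

/-- The scalar bidifferential operators. -/
def bidiffOps (F : Type*) [CommRing F] [Algebra ℝ F] [JetAlgebra n m F] :
    Submodule F ((Fin m → F) × (Fin m → F) → F) := Submodule.span F (range (bidiffGen F))

theorem mul_mem_bidiffOps {P Q : (Fin m → F) → F} (hP : P ∈ diffOps F) (hQ : Q ∈ diffOps F) :
    (fun ψ : (Fin m → F) × (Fin m → F) => P ψ.1 * Q ψ.2) ∈ bidiffOps F := by
  obtain ⟨c, rfl⟩ := (Finsupp.mem_span_range_iff_exists_finsupp).1 hP
  obtain ⟨d, rfl⟩ := (Finsupp.mem_span_range_iff_exists_finsupp).1 hQ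
  have : (fun ψ : (Fin m → F) × (Fin m → F) => (c.sum fun i a => a • diffGen F i) ψ.1 *
      (d.sum fun i a => a • diffGen F i) ψ.2) =
      ∑ a ∈ c.support, ∑ b ∈ d.support, (c a * d b) • bidiffGen F (a, b) := by
    funext ψ
    simp only [Finsupp.sum, Finset.sum_apply, Pi.smul_apply, smul_eq_mul, Finset.sum_mul,
      Finset.mul_sum, diffGen, bidiffGen]
    rw [Finset.sum_comm]
    refine Finset.sum_congr rfl fun a _ => Finset.sum_congr rfl fun b _ => ?_
    ring
  rw [this]
  exact Submodule.sum_mem _ fun a _ => Submodule.sum_mem _ fun b _ =>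
    Submodule.smul_mem _ _ (Submodule.subset_span ⟨_, rfl⟩)

theorem Dσ_bidiffOps {P : (Fin m → F) × (Fin m → F) → F} (hP : P ∈ bidiffOps F) (σ : MI n) :
    (fun ψ => Dσ σ (P ψ)) ∈ bidiffOps F := by
  refine Dσ_span ?_ hP σ
  rintro _ ⟨⟨⟨τ, j⟩, ρ, k⟩, rfl⟩ i
  have : (fun ψ : (Fin m → F) × (Fin m → F) => D i (bidiffGen F ((τ, j), ρ, k) ψ)) =
      bidiffGen F ((τ, j), ρ + Finsupp.single i 1, k) +
      bidiffGen F ((τ + Finsupp.single i 1, j), ρ, k) := by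
    funext ψ
    simp only [bidiffGen, Derivation.leibniz, Pi.add_apply, Dσ_add_single, smul_eq_mul]
    ring
  rw [this]
  exact Submodule.add_mem _ (Submodule.subset_span ⟨_, rfl⟩) (Submodule.subset_span ⟨_, rfl⟩)

theorem bidiffOps_sum {ι : Type*} (s : Finset ι) {P : ι → (Fin m → F) × (Fin m → F) → F}
    (hP : ∀ a ∈ s, P a ∈ bidiffOps F) : (fun ψ => ∑ a ∈ s, P a ψ) ∈ bidiffOps F := by
  have : (fun ψ => ∑ a ∈ s, P a ψ) = ∑ a ∈ s, P a := by
    funext ψ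
    rw [Finset.sum_apply]
  rw [this]
  exact Submodule.sum_mem _ hP

/-- A differential operator applied to a bidifferential expression. -/
theorem opAct_bidiffOps (T : Finset (MI n)) (a : MI n → Fin m → Fin m → F)
    {P : Fin m → (Fin m → F) × (Fin m → F) → F} (hP : ∀ j, P j ∈ bidiffOps F) (i : Fin m) :
    (fun ψ => opAct T a (fun j => P j ψ) i) ∈ bidiffOps F :=
  bidiffOps_sum T fun σ _ => bidiffOps_sum _ fun j _ =>
    Submodule.smul_mem _ _ (Dσ_bidiffOps (hP j) σ)

/-- Bidifferential operators have finitely many coefficients. -/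
theorem exists_coeff_of_bidiffOps {C : (Fin m → F) → (Fin m → F) → Fin m → F}
    (hC : ∀ i, (fun ψ : (Fin m → F) × (Fin m → F) => C ψ.1 ψ.2 i) ∈ bidiffOps F) :
    ∃ (T : Finset (MI n)) (c : Fin m → MI n → Fin m → MI n → Fin m → F), ∀ ψ χ i, C ψ χ i =
      ∑ σ ∈ T, ∑ τ ∈ T, ∑ j, ∑ k, c i σ j τ k * (Dσ σ (ψ j) * Dσ τ (χ k)) := by
  classical
  choose c hc using fun i => (Finsupp.mem_span_range_iff_exists_finsupp).1 (hC i)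
  let T : Finset (MI n) := Finset.univ.biUnion fun i =>
    (c i).support.image (fun a => a.1.1) ∪ (c i).support.image (fun a => a.2.1)
  refine ⟨T, fun i σ j τ k => c i ((σ, j), τ, k), fun ψ χ i => ?_⟩
  have h := congrFun (hc i) (ψ, χ)
  change _ = C ψ χ i at h
  rw [← h, Finsupp.sum, Finset.sum_apply]
  have hsub : (c i).support ⊆ (T ×ˢ Finset.univ) ×ˢ (T ×ˢ Finset.univ) := by
    intro a ha
    simp only [Finset.mem_product, Finset.mem_univ, and_true]
    refine ⟨Finset.mem_biUnion.2 ⟨i, Finset.mem_univ _, Finset.mem_union_left _ ?_⟩,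
      Finset.mem_biUnion.2 ⟨i, Finset.mem_univ _, Finset.mem_union_right _ ?_⟩⟩
    · exact Finset.mem_image_of_mem (fun a : (MI n × Fin m) × (MI n × Fin m) => a.1.1) ha
    · exact Finset.mem_image_of_mem (fun a : (MI n × Fin m) × (MI n × Fin m) => a.2.1) ha
  rw [Finset.sum_subset hsub (fun a _ ha => by
    rw [Finsupp.notMem_support_iff.1 ha, zero_smul, Pi.zero_apply])]
  simp only [Finset.sum_product]
  refine Finset.sum_congr rfl fun σ _ => ?_
  rw [Finset.sum_comm]
  rfl

end

section

open JetAlgebra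

variable {n m : ℕ} {F : Type*} [CommRing F] [Algebra ℝ F] [JetAlgebra n m F]

/-! ### Vanishing of invariant bidifferential operators -/

/-- The symbol of total degree `N` of the bidifferential operator with coefficients `c`, on basis
vectors. -/
def biSymb (T : Finset (MI n)) (c : Fin m → MI n → Fin m → MI n → Fin m → F) (N : ℕ)
    (θ₁ θ₂ : Fin n → ℝ) (i j k : Fin m) : F :=
  ∑ σ ∈ T, ∑ τ ∈ T, if σ.degree + τ.degree = N then
    algebraMap ℝ F (mon θ₁ σ * mon θ₂ τ) * c i σ j τ k else 0

theorem growthV_bidiff {C : (Fin m → F) → (Fin m → F) → Fin m → F} {T : Finset (MI n)}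
    {c : Fin m → MI n → Fin m → MI n → Fin m → F}
    (hC : ∀ ψ χ i, C ψ χ i =
      ∑ σ ∈ T, ∑ τ ∈ T, ∑ j, ∑ k, c i σ j τ k * (Dσ σ (ψ j) * Dσ τ (χ k))) {N : ℕ}
    (hN : ∀ σ ∈ T, ∀ τ ∈ T, N < σ.degree + τ.degree → ∀ i j k, c i σ j τ k = 0)
    {θ₁ θ₂ : Fin n → ℝ} {Ψ X : ℝ → Fin m → F} {d₁ d₂ d : ℕ} {g h : Fin m → F}
    (hΨ : GrowthV θ₁ Ψ d₁ g) (hX : GrowthV θ₂ X d₂ h) (hd : d₁ + d₂ + N = d) :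
    GrowthV (θ₁ + θ₂) (fun s => C (Ψ s) (X s)) d
      (fun i => ∑ j, ∑ k, biSymb T c N θ₁ θ₂ i j k * (g j * h k)) := by
  intro i
  subst hd
  have key : ∀ σ ∈ T, ∀ τ ∈ T, ∀ j k, Growth (θ₁ + θ₂)
      (fun s => c i σ j τ k * (Dσ σ (Ψ s j) * Dσ τ (X s k))) (d₁ + d₂ + N)
      (if σ.degree + τ.degree = N then
        algebraMap ℝ F (mon θ₁ σ * mon θ₂ τ) * c i σ j τ k * (g j * h k) else 0) := by
    intro σ hσ τ hτ j k
    have hg := (((hΨ j).Dσ σ).mul ((hX k).Dσ τ)).const_mul (c i σ j τ k)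
    rcases lt_trichotomy (σ.degree + τ.degree) N with hlt | heq | hgt
    · rw [if_neg hlt.ne]
      exact hg.mono (by omega)
    · rw [if_pos heq]
      exact hg.cast (by omega) (by rw [map_mul]; ring)
    · rw [if_neg hgt.ne', hN σ hσ τ hτ hgt]
      simpa using growth_zero (F := F) (θ₁ + θ₂) (d₁ + d₂ + N)
  simp only [hC]
  refine (Growth.sum T fun σ hσ => Growth.sum T fun τ hτ => Growth.sum Finset.univ fun j _ =>
    Growth.sum Finset.univ fun k _ => key σ hσ τ hτ j k).cast rfl ?_
  simp only [biSymb, Finset.sum_mul, ite_mul, zero_mul]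
  rw [Finset.sum_congr rfl fun σ _ => Finset.sum_comm, Finset.sum_comm]
  refine Finset.sum_congr rfl fun j _ => ?_
  rw [Finset.sum_congr rfl fun σ _ => Finset.sum_comm, Finset.sum_comm]

/-- The real matrix obtained by evaluating a symbol at a point. -/
def symbAt {R : Type*} [CommRing R] [Algebra ℝ R] (ev : R →ₐ[ℝ] ℝ)
    (T : Finset (MI n)) (l : ℕ) (a : MI n → Fin m → Fin m → R)
    (θ : Fin n → ℝ) : Matrix (Fin m) (Fin m) ℝ :=
  (symb T l a θ).map ev

theorem symbAt_apply {R : Type*} [CommRing R] [Algebra ℝ R] (ev : R →ₐ[ℝ] ℝ)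
    (T : Finset (MI n)) (l : ℕ) (a : MI n → Fin m → Fin m → R) (θ : Fin n → ℝ) (i j : Fin m) :
    symbAt ev T l a θ i j = ∑ σ ∈ T with σ.degree = l, mon θ σ * ev (a σ i j) := by
  simp [symbAt, symb]

theorem mon_smul {ι : Type*} [Fintype ι] (s : ℝ) (θ : ι → ℝ) (σ : ι →₀ ℕ) :
    mon (s • θ) σ = s ^ σ.degree * mon θ σ := by
  simp only [mon, Pi.smul_apply, smul_eq_mul, mul_pow, Finset.prod_mul_distrib,
    Finset.prod_pow_eq_pow_sum, Finsupp.degree_eq_sum]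

theorem symbAt_smul {R : Type*} [CommRing R] [Algebra ℝ R] (ev : R →ₐ[ℝ] ℝ)
    (T : Finset (MI n)) (l : ℕ) (a : MI n → Fin m → Fin m → R) (s : ℝ) (θ : Fin n → ℝ) :
    symbAt ev T l a (s • θ) = s ^ l • symbAt ev T l a θ := by
  ext i j
  rw [Matrix.smul_apply, symbAt_apply, symbAt_apply, smul_eq_mul, Finset.mul_sum]
  refine Finset.sum_congr rfl fun σ hσ => ?_
  rw [mon_smul, (Finset.mem_filter.1 hσ).2, mul_assoc]

theorem continuous_symbAt {R : Type*} [CommRing R] [Algebra ℝ R] (ev : R →ₐ[ℝ] ℝ)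
    (T : Finset (MI n)) (l : ℕ) (a : MI n → Fin m → Fin m → R) : Continuous (symbAt ev T l a) := by
  refine continuous_pi fun i => continuous_pi fun j => ?_
  simp only [symbAt_apply, mon]
  fun_prop

theorem continuous_lieMatrix {X : Type*} [TopologicalSpace X]
    {p r₁ r₂ : X → Matrix (Fin m) (Fin m) ℝ} (hp : Continuous p) (hr₁ : Continuous r₁)
    (hr₂ : Continuous r₂) : Continuous fun x => lieMatrix (p x) (r₁ x) (r₂ x) := by
  refine continuous_pi fun a => continuous_pi fun b => ?_
  simp only [lieMatrix, Matrix.sub_apply, Matrix.kroneckerMap_apply, Matrix.transpose_apply]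
  exact (((hp.matrix_elem _ _).mul continuous_const).sub
    (continuous_const.mul ((hr₁.matrix_elem _ _).mul continuous_const))).sub
    (continuous_const.mul (continuous_const.mul (hr₂.matrix_elem _ _)))

/-- The leading symbol of an invariant bidifferential operator vanishes at each point where the
symbol of `S₂` is nonsingular. Comparing the leading terms on `exp(s θ₁·x)`, `exp(s θ₂·x)` gives a
linear system for the values of the symbol at `(θ₁, θ₂)`, whose matrix is nonsingular for some
collinear `θ₁, θ₂` and hence on a nonempty open set. -/
theorem coeff_eq_zero_of_invariant {f : Fin m → F} {S₁ S₂ : (Fin m → F) → Fin m → F} {l : ℕ}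
    (hl : 1 < l) {T₁ T₂ : Finset (MI n)} {a₁ a₂ : MI n → Fin m → Fin m → F}
    (hS₁ : ∀ θ Ψ d g, GrowthV θ Ψ d g →
      GrowthV θ (fun s => S₁ (Ψ s)) (d + l) (symb T₁ l a₁ θ *ᵥ g))
    (hS₂ : ∀ θ Ψ d g, GrowthV θ Ψ d g →
      GrowthV θ (fun s => S₂ (Ψ s)) (d + l) (symb T₂ l a₂ θ *ᵥ g))
    {C : (Fin m → F) → (Fin m → F) → Fin m → F} {T : Finset (MI n)}
    {c : Fin m → MI n → Fin m → MI n → Fin m → F}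
    (hC : ∀ ψ χ i, C ψ χ i =
      ∑ σ ∈ T, ∑ τ ∈ T, ∑ j, ∑ k, c i σ j τ k * (Dσ σ (ψ j) * Dσ τ (χ k)))
    (hinv : ∀ ψ χ, DTV f (C ψ χ) + S₂ (C ψ χ) =
      C (DTV f ψ + S₁ ψ) χ + C ψ (DTV f χ + S₁ χ)) {N : ℕ}
    (hN : ∀ σ ∈ T, ∀ τ ∈ T, N < σ.degree + τ.degree → ∀ i j k, c i σ j τ k = 0)
    (ev : F →ₐ[ℝ] ℝ) (hev : ∃ θ, (symbAt ev T₂ l a₂ θ).det ≠ 0) :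
    ∀ σ ∈ T, ∀ τ ∈ T, σ.degree + τ.degree = N → ∀ i j k, ev (c i σ j τ k) = 0 := by
  classical
  -- The coefficients of `s^(N + l)` on both sides of the invariance equation for the families
  -- `exp(s θ₁·x) e_j` and `exp(s θ₂·x) e_k`; the terms with `D_t` have lower degree.
  have hsys : ∀ θ₁ θ₂ i j k, ∑ i', symb T₂ l a₂ (θ₁ + θ₂) i i' * biSymb T c N θ₁ θ₂ i' j k =
      ∑ j', biSymb T c N θ₁ θ₂ i j' k * symb T₁ l a₁ θ₁ j' j +
        ∑ k', biSymb T c N θ₁ θ₂ i j k' * symb T₁ l a₁ θ₂ k' k := by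
    intro θ₁ θ₂ i j k
    have h₁ := growthV_single (F := F) θ₁ j
    have h₂ := growthV_single (F := F) θ₂ k
    have h₁₂ := growthV_bidiff hC hN h₁ h₂ rfl
    have hL := (h₁₂.DTV f (show 0 + 0 + N < 0 + 0 + N + l by omega)).add (hS₂ _ _ _ _ h₁₂)
    have hr₁ := (h₁.DTV f (show 0 < 0 + l by omega)).add (hS₁ _ _ _ _ h₁)
    have hr₂ := (h₂.DTV f (show 0 < 0 + l by omega)).add (hS₁ _ _ _ _ h₂)
    have hR := (growthV_bidiff hC hN hr₁ h₂ (show 0 + l + 0 + N = 0 + 0 + N + l by omega)).add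
      (growthV_bidiff hC hN h₁ hr₂ (show 0 + (0 + l) + N = 0 + 0 + N + l by omega))
    have e := hL i
    simp only [hinv] at e
    have := e.unique (hR i)
    simpa [Matrix.mulVec, dotProduct, Pi.single_apply, Finset.sum_ite_eq] using this
  -- The same system, evaluated at the point `ev`.
  have hmat : ∀ θ₁ θ₂, lieMatrix (symbAt ev T₂ l a₂ (θ₁ + θ₂)) (symbAt ev T₁ l a₁ θ₁)
      (symbAt ev T₁ l a₁ θ₂) *ᵥ (fun q => ev (biSymb T c N θ₁ θ₂ q.1 q.2.1 q.2.2)) = 0 := by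
    intro θ₁ θ₂
    funext ⟨i, j, k⟩
    rw [lieMatrix_mulVec, Pi.zero_apply, sub_sub, sub_eq_zero]
    simpa [symbAt] using congrArg ev (hsys θ₁ θ₂ i j k)
  obtain ⟨α, hα⟩ := hev
  obtain ⟨s, hs⟩ := exists_det_lieMatrix_ne_zero hl hα (symbAt ev T₁ l a₁ α)
  have hcont : Continuous fun q : (Fin n → ℝ) × (Fin n → ℝ) =>
      (lieMatrix (symbAt ev T₂ l a₂ (q.1 + q.2)) (symbAt ev T₁ l a₁ q.1)
        (symbAt ev T₁ l a₁ q.2)).det := by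
    refine Continuous.matrix_det (continuous_lieMatrix ?_ ?_ ?_)
    · exact (continuous_symbAt ev T₂ l a₂).comp (continuous_fst.add continuous_snd)
    · exact (continuous_symbAt ev T₁ l a₁).comp continuous_fst
    · exact (continuous_symbAt ev T₁ l a₁).comp continuous_snd
  have hopen : IsOpen {q : (Fin n → ℝ) × (Fin n → ℝ) |
      (lieMatrix (symbAt ev T₂ l a₂ (q.1 + q.2)) (symbAt ev T₁ l a₁ q.1)
        (symbAt ev T₁ l a₁ q.2)).det ≠ 0} := isOpen_ne.preimage hcont
  -- The system is nonsingular at `(α, s α)`, hence on a product `u × v` of open sets.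
  obtain ⟨u, v, hu, hv, hαu, hαv, huv⟩ := isOpen_prod_iff.1 hopen α (s • α) (by
    have : α + s • α = (1 + s) • α := by rw [add_smul, one_smul]
    simpa only [mem_ofPred_eq, this, symbAt_smul] using hs)
  intro σ hσ τ hτ hστ i j k
  have hz : ∀ θ₁ ∈ u, ∀ θ₂ ∈ v, ∑ σ ∈ T, (∑ τ ∈ T, (if σ.degree + τ.degree = N then
      ev (c i σ j τ k) else 0) * mon θ₂ τ) * mon θ₁ σ = 0 := by
    intro θ₁ h₁ θ₂ h₂
    have h0 := Matrix.eq_zero_of_mulVec_eq_zero (huv (mk_mem_prod h₁ h₂)) (hmat θ₁ θ₂)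
    have h0 := congrFun h0 (i, j, k)
    simp only [biSymb, map_sum, Pi.zero_apply] at h0
    refine Eq.trans (Finset.sum_congr rfl fun σ _ => ?_) h0
    rw [Finset.sum_mul]
    refine Finset.sum_congr rfl fun τ _ => ?_
    split_ifs
    · rw [map_mul, AlgHom.commutes]
      simp only [Algebra.algebraMap_self, RingHom.id_apply]
      ring
    · simp
  have h1 : ∀ θ₂ ∈ v, ∑ τ ∈ T, (if σ.degree + τ.degree = N then
      ev (c i σ j τ k) else 0) * mon θ₂ τ = 0 := fun θ₂ h₂ =>
    coeff_eq_zero_of_sum_mon T _ hu hαu (fun θ₁ h₁ => hz θ₁ h₁ θ₂ h₂) σ hσ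
  have h2 := coeff_eq_zero_of_sum_mon T _ hv hαv h1 τ hτ
  rwa [if_pos hστ] at h2

/-- A bidifferential operator invariant under the flow vanishes: its leading coefficients vanish
at the points of `U`, hence everywhere, and one descends on the order. -/
theorem eq_zero_of_invariant {f : Fin m → F} {S₁ S₂ : (Fin m → F) → Fin m → F} {l : ℕ}
    (hl : 1 < l) {T₁ T₂ : Finset (MI n)} {a₁ a₂ : MI n → Fin m → Fin m → F}
    (hS₁ : ∀ θ Ψ d g, GrowthV θ Ψ d g →
      GrowthV θ (fun s => S₁ (Ψ s)) (d + l) (symb T₁ l a₁ θ *ᵥ g))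
    (hS₂ : ∀ θ Ψ d g, GrowthV θ Ψ d g →
      GrowthV θ (fun s => S₂ (Ψ s)) (d + l) (symb T₂ l a₂ θ *ᵥ g))
    {C : (Fin m → F) → (Fin m → F) → Fin m → F}
    (hC : ∀ i, (fun ψ : (Fin m → F) × (Fin m → F) => C ψ.1 ψ.2 i) ∈ bidiffOps F)
    (hinv : ∀ ψ χ, DTV f (C ψ χ) + S₂ (C ψ χ) =
      C (DTV f ψ + S₁ ψ) χ + C ψ (DTV f χ + S₁ χ))
    {U : Set (F →ₐ[ℝ] ℝ)} (hU : ∀ g : F, (∀ ev ∈ U, ev g = 0) → g = 0)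
    (hdet : ∀ ev ∈ U, ∃ θ, (symbAt ev T₂ l a₂ θ).det ≠ 0) (ψ χ : Fin m → F) : C ψ χ = 0 := by
  obtain ⟨T, c, hc⟩ := exists_coeff_of_bidiffOps hC
  have hzero : ∀ N, (∀ σ ∈ T, ∀ τ ∈ T, N ≤ σ.degree + τ.degree → ∀ i j k, c i σ j τ k = 0) →
      ∀ σ ∈ T, ∀ τ ∈ T, ∀ i j k, c i σ j τ k = 0 := by
    intro N
    induction N with
    | zero => exact fun h σ hσ τ hτ => h σ hσ τ hτ (Nat.zero_le _)
    | succ N ih =>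
      intro h
      refine ih fun σ hσ τ hτ hN i j k => ?_
      rcases hN.lt_or_eq with hlt | heq
      · exact h σ hσ τ hτ hlt i j k
      · exact hU _ fun ev hev => coeff_eq_zero_of_invariant hl hS₁ hS₂ hc hinv
          (fun σ hσ τ hτ h' => h σ hσ τ hτ h') ev (hdet ev hev) σ hσ τ hτ heq.symm i j k
  have h0 := hzero (T.sup Finsupp.degree + T.sup Finsupp.degree + 1) fun σ hσ τ hτ h => by
    have h1 : σ.degree ≤ T.sup Finsupp.degree := Finset.le_sup hσ
    have h2 : τ.degree ≤ T.sup Finsupp.degree := Finset.le_sup hτ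
    omega
  funext i
  rw [hc, Pi.zero_apply]
  exact Finset.sum_eq_zero fun σ hσ => Finset.sum_eq_zero fun τ hτ =>
    Finset.sum_eq_zero fun j _ => Finset.sum_eq_zero fun k _ => by
      rw [h0 σ hσ τ hτ, zero_mul]

end

open JetAlgebra

section Operators

variable {n m : ℕ} {F : Type*} [CommRing F] [Algebra ℝ F] [JetAlgebra n m F]

/-! ### Linearizations and the vanishing of the bracket and the differential -/

/-- The coefficients of the linearization of `f`. -/
def linCoeff (f : Fin m → F) (σ : MI n) (i j : Fin m) : F := du σ j (f i)

/-- The coefficients of the operator `φ ↦ A'[φ]ψ`, where `A = ∑_{σ ∈ T} a_{ij}^σ D_σ`. -/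
def linOfCoeff (T : Finset (MI n)) (a : MI n → Fin m → Fin m → F) (ψ : Fin m → F)
    (τ : MI n) (i j : Fin m) : F :=
  ∑ σ ∈ T, ∑ k, du τ j (a σ i k) * Dσ σ (ψ k)

theorem EV_eq_opAct {f : Fin m → F} {T : Finset (MI n)}
    (hT : ∀ σ, σ ∉ T → ∀ i j, linCoeff f σ i j = 0) (φ : Fin m → F) :
    EV φ f = opAct T (linCoeff f) φ := by
  funext i
  change vert _ (f i) = _
  rw [vert_eq_sum _ (fun σ hσ j => hT σ hσ i j)]
  simp only [opAct, linCoeff, mul_comm]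

/-- The variation `A'[φ]ψ` is a differential operator in `φ`. -/
theorem vary_opAct {T T' : Finset (MI n)} {a : MI n → Fin m → Fin m → F}
    (hT' : ∀ τ, τ ∉ T' → ∀ σ i j k, du τ j (a σ i k) = 0) (φ ψ : Fin m → F) :
    vary (opAct T a) φ ψ = opAct T' (linOfCoeff T a ψ) φ := by
  funext i
  have h : ∀ σ k, E φ (a σ i k) = ∑ τ ∈ T', ∑ j, Dσ τ (φ j) * du τ j (a σ i k) :=
    fun σ k => vert_eq_sum _ (fun τ hτ j => hT' τ hτ σ i j k)
  simp only [vary, Pi.sub_apply, EV, opAct, linOfCoeff, map_sum, Derivation.leibniz, smul_eq_mul,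
    E_Dσ, ← Finset.sum_sub_distrib, add_sub_cancel_left, h, Finset.mul_sum, Finset.sum_mul]
  rw [Finset.sum_congr rfl fun σ _ => Finset.sum_comm, Finset.sum_comm]
  refine Finset.sum_congr rfl fun τ _ => ?_
  rw [Finset.sum_congr rfl fun σ _ => Finset.sum_comm, Finset.sum_comm]
  refine Finset.sum_congr rfl fun j _ => Finset.sum_congr rfl fun σ _ =>
    Finset.sum_congr rfl fun k _ => ?_
  ring

theorem exists_orders_coeff (T : Finset (MI n)) {a : MI n → Fin m → Fin m → F}
    (ha : ∀ σ, σ ∉ T → ∀ i j, a σ i j = 0) :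
    ∃ T' : Finset (MI n), ∀ τ, τ ∉ T' → ∀ σ i j k, du τ j (a σ i k) = 0 := by
  classical
  refine ⟨T.biUnion fun σ => Finset.univ.biUnion fun i => Finset.univ.biUnion fun k =>
    orders (a σ i k), fun τ hτ σ i j k => ?_⟩
  by_cases hσ : σ ∈ T
  · refine du_eq_zero (fun h => hτ ?_) j
    simp only [Finset.mem_biUnion, Finset.mem_univ, true_and]
    exact ⟨σ, hσ, i, k, h⟩
  · rw [ha σ hσ, map_zero]

theorem opAct_mem_diffOps (T : Finset (MI n)) (a : MI n → Fin m → Fin m → F) (i : Fin m) :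
    (fun ψ => opAct T a ψ i) ∈ diffOps F :=
  diffOps_sum T fun σ _ => diffOps_sum _ fun j _ => diffOps_mul _ (diffGen_mem σ j)

theorem linOfCoeff_mem_diffOps (T : Finset (MI n)) (a : MI n → Fin m → Fin m → F) (τ : MI n)
    (i j : Fin m) : (fun ψ => linOfCoeff T a ψ τ i j) ∈ diffOps F :=
  diffOps_sum T fun σ _ => diffOps_sum _ fun k _ => diffOps_mul _ (diffGen_mem σ k)

/-- Exchanging the two arguments preserves bidifferential operators. -/
theorem swap_mem_bidiffOps {P : (Fin m → F) × (Fin m → F) → F} (hP : P ∈ bidiffOps F) :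
    (fun ψ => P ψ.swap) ∈ bidiffOps F := by
  obtain ⟨c, rfl⟩ := (Finsupp.mem_span_range_iff_exists_finsupp).1 hP
  have : (fun ψ : (Fin m → F) × (Fin m → F) => (c.sum fun i a => a • bidiffGen F i) ψ.swap) =
      ∑ a ∈ c.support, c a • bidiffGen F a.swap := by
    funext ψ
    simp only [Finsupp.sum, Finset.sum_apply, Pi.smul_apply, bidiffGen, Prod.fst_swap,
      Prod.snd_swap]
    exact Finset.sum_congr rfl fun a _ => by rw [mul_comm (Dσ _ _)]
  rw [this]
  exact Submodule.sum_mem _ fun a _ => Submodule.smul_mem _ _ (Submodule.subset_span ⟨_, rfl⟩)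

/-- The expression `(ψ, χ) ↦ A'[Bχ]ψ` is bidifferential if `B` is a differential operator. -/
theorem linOf_act_mem (T T' : Finset (MI n)) (a : MI n → Fin m → Fin m → F)
    {B : (Fin m → F) → Fin m → F} (hB : ∀ j, (fun χ => B χ j) ∈ diffOps F) (i : Fin m) :
    (fun ψ : (Fin m → F) × (Fin m → F) => opAct T' (linOfCoeff T a ψ.1) (B ψ.2) i) ∈
      bidiffOps F :=
  bidiffOps_sum T' fun τ _ => bidiffOps_sum _ fun j _ =>
    mul_mem_bidiffOps (linOfCoeff_mem_diffOps T a τ i j) (Dσ_diffOps (hB j) τ)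

/-- The expression `(ψ, χ) ↦ (A'[·]ψ)^* χ` is bidifferential. -/
theorem linOf_adj_mem (T T' : Finset (MI n)) (a : MI n → Fin m → Fin m → F) (i : Fin m) :
    (fun ψ : (Fin m → F) × (Fin m → F) => opAdj T' (linOfCoeff T a ψ.1) ψ.2 i) ∈
      bidiffOps F :=
  bidiffOps_sum T' fun τ _ => bidiffOps_sum _ fun j _ =>
    Submodule.smul_mem _ ((-1) ^ τ.degree) (Dσ_bidiffOps (mul_mem_bidiffOps
      (linOfCoeff_mem_diffOps T a τ j i) (by
        have h := diffGen_mem (F := F) 0 j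
        simpa only [Dσ_zero] using h)) τ)

theorem symb_adj {R : Type*} [CommRing R] [Algebra ℝ R] (T : Finset (MI n)) (l : ℕ)
    (a : MI n → Fin m → Fin m → R) (θ : Fin n → ℝ) :
    symb T l (fun σ i j => (-1) ^ l * a σ j i) θ = (-1 : R) ^ l • (symb T l a θ)ᵀ := by
  ext i j
  simp only [symb, Matrix.smul_apply, Matrix.transpose_apply, smul_eq_mul, Finset.mul_sum]
  exact Finset.sum_congr rfl fun σ _ => by ring

variable {f : Fin m → F} {l : ℕ} {Tf : Finset (MI n)}

/-- The symbol of `-ℓ_f`. -/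
theorem growthV_neg_EV (hTf : ∀ σ, σ ∉ Tf → ∀ i j, linCoeff f σ i j = 0)
    (hdeg : ∀ σ ∈ Tf, σ.degree ≤ l) (θ : Fin n → ℝ) (Ψ : ℝ → Fin m → F) (d : ℕ) (g : Fin m → F)
    (h : GrowthV θ Ψ d g) : GrowthV θ (fun s => -EV (Ψ s) f) (d + l)
      (symb Tf l (fun σ i j => -linCoeff f σ i j) θ *ᵥ g) := by
  rw [symb_neg, Matrix.neg_mulVec]
  simp only [EV_eq_opAct hTf]
  exact (h.opAct hdeg).neg

/-- The Schouten bracket of two invariant bivectors vanishes. -/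
theorem bracket_eq_zero (hl : 1 < l) (hTf : ∀ σ, σ ∉ Tf → ∀ i j, linCoeff f σ i j = 0)
    (hdeg : ∀ σ ∈ Tf, σ.degree ≤ l)
    {U : Set (F →ₐ[ℝ] ℝ)} (hU : ∀ g : F, (∀ ev ∈ U, ev g = 0) → g = 0)
    (hdet : ∀ ev ∈ U, ∃ θ, (symbAt ev Tf l (linCoeff f) θ).det ≠ 0)
    {T₁ T₁' T₂ T₂' : Finset (MI n)} {a b : MI n → Fin m → Fin m → F}
    (ha : ∀ τ, τ ∉ T₁' → ∀ σ i j k, du τ j (a σ i k) = 0)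
    (hb : ∀ τ, τ ∉ T₂' → ∀ σ i j k, du τ j (b σ i k) = 0)
    (hskewA : ∀ ψ, opAdj T₁ a ψ = -opAct T₁ a ψ) (hskewB : ∀ ψ, opAdj T₂ b ψ = -opAct T₂ b ψ)
    (hA : ∀ ψ, DTV f (opAct T₁ a ψ) - EV (opAct T₁ a ψ) f =
      opAct T₁ a (DTV f ψ + opAdj Tf (linCoeff f) ψ))
    (hB : ∀ ψ, DTV f (opAct T₂ b ψ) - EV (opAct T₂ b ψ) f =
      opAct T₂ b (DTV f ψ + opAdj Tf (linCoeff f) ψ)) (ψ₁ ψ₂ : Fin m → F) :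
    opAct T₁' (linOfCoeff T₁ a ψ₁) (opAct T₂ b ψ₂) - opAct T₁' (linOfCoeff T₁ a ψ₂) (opAct T₂ b ψ₁)
      + opAct T₂' (linOfCoeff T₂ b ψ₁) (opAct T₁ a ψ₂)
      - opAct T₂' (linOfCoeff T₂ b ψ₂) (opAct T₁ a ψ₁)
      - opAct T₁ a (opAdj T₂' (linOfCoeff T₂ b ψ₂) ψ₁)
      - opAct T₂ b (opAdj T₁' (linOfCoeff T₁ a ψ₂) ψ₁) = 0 := by
  have hpair : ∀ {T : Finset (MI n)} {a : MI n → Fin m → Fin m → F},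
      (∀ ψ, opAdj T a ψ = -opAct T a ψ) → ∀ X Y, pair (opAct T a X) Y = -pair (opAct T a Y) X := by
    intro T a h X Y
    rw [pair_opAct, h, pair_comm, pair_neg_left]
  have hw : ∀ {T T' : Finset (MI n)} {a : MI n → Fin m → Fin m → F},
      (∀ τ, τ ∉ T' → ∀ σ i j k, du τ j (a σ i k) = 0) → ∀ ψ ψ' φ : Fin m → F,
      pair (opAdj T' (linOfCoeff T a ψ) ψ') φ = pair (vary (opAct T a) φ ψ) ψ' := by
    intro T T' a h ψ ψ' φ
    rw [vary_opAct h, pair_opAct, pair_comm]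
  have hS : ∀ X χ, pair (EV X f) χ = pair X (opAdj Tf (linCoeff f) χ) := fun X χ => by
    rw [EV_eq_opAct hTf, pair_opAct]
  have hinv := lie_bracket hS (opAct_add T₁ a) (opAct_add T₂ b) hA hB (hpair hskewA)
    (hpair hskewB) (hw ha) (hw hb) (fun _ _ => rfl)
  simp only [vary_opAct ha, vary_opAct hb, sub_eq_add_neg (DTV f _) (EV _ f)] at hinv
  have hdet' : ∀ ev ∈ U, ∃ θ,
      (symbAt ev Tf l (fun σ i j => -linCoeff f σ i j) θ).det ≠ 0 := by
    intro ev hev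
    obtain ⟨θ, hθ⟩ := hdet ev hev
    refine ⟨θ, ?_⟩
    have : symbAt ev Tf l (fun σ i j => -linCoeff f σ i j) θ =
        -symbAt ev Tf l (linCoeff f) θ := by
      ext i j
      simp [symbAt, symb_neg]
    rw [this, Matrix.det_neg]
    exact mul_ne_zero (pow_ne_zero _ (by norm_num)) hθ
  refine eq_zero_of_invariant (S₁ := opAdj Tf (linCoeff f)) (S₂ := fun X => -EV X f) hl
    (fun θ Ψ d g h => h.opAdj hdeg) (growthV_neg_EV hTf hdeg) (fun i => ?_) hinv hU hdet' ψ₁ ψ₂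
  have m₁ := linOf_act_mem T₁ T₁' a (opAct_mem_diffOps T₂ b) i
  have m₂ := linOf_act_mem T₂ T₂' b (opAct_mem_diffOps T₁ a) i
  have m₃ := opAct_bidiffOps T₁ a (fun j => swap_mem_bidiffOps (linOf_adj_mem T₂ T₂' b j)) i
  have m₄ := opAct_bidiffOps T₂ b (fun j => swap_mem_bidiffOps (linOf_adj_mem T₁ T₁' a j)) i
  exact Submodule.sub_mem _ (Submodule.sub_mem _ (Submodule.sub_mem _ (Submodule.add_mem _
    (Submodule.sub_mem _ m₁ (swap_mem_bidiffOps m₁)) m₂) (swap_mem_bidiffOps m₂)) m₃) m₄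

/-- The differential of an invariant 2-form vanishes. -/
theorem diffForm_eq_zero (hl : 1 < l) (hTf : ∀ σ, σ ∉ Tf → ∀ i j, linCoeff f σ i j = 0)
    (hdeg : ∀ σ ∈ Tf, σ.degree ≤ l)
    {U : Set (F →ₐ[ℝ] ℝ)} (hU : ∀ g : F, (∀ ev ∈ U, ev g = 0) → g = 0)
    (hdet : ∀ ev ∈ U, ∃ θ, (symbAt ev Tf l (linCoeff f) θ).det ≠ 0)
    {T T' : Finset (MI n)} {a : MI n → Fin m → Fin m → F}
    (ha : ∀ τ, τ ∉ T' → ∀ σ i j k, du τ j (a σ i k) = 0)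
    (hskew : ∀ ψ, opAdj T a ψ = -opAct T a ψ)
    (hA : ∀ φ, DTV f (opAct T a φ) + opAdj Tf (linCoeff f) (opAct T a φ) =
      opAct T a (DTV f φ - EV φ f)) (φ₁ φ₂ : Fin m → F) :
    opAct T' (linOfCoeff T a φ₂) φ₁ - opAct T' (linOfCoeff T a φ₁) φ₂
      + opAdj T' (linOfCoeff T a φ₁) φ₂ = 0 := by
  have hpair : ∀ X Y, pair (opAct T a X) Y = -pair (opAct T a Y) X := by
    intro X Y
    rw [pair_opAct, hskew, pair_comm, pair_neg_left]
  have hw : ∀ ψ ψ' φ : Fin m → F,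
      pair (opAdj T' (linOfCoeff T a ψ) ψ') φ = pair (vary (opAct T a) φ ψ) ψ' := by
    intro ψ ψ' φ
    rw [vary_opAct ha, pair_opAct, pair_comm]
  have hS : ∀ X χ, pair (EV X f) χ = pair X (opAdj Tf (linCoeff f) χ) := fun X χ => by
    rw [EV_eq_opAct hTf, pair_opAct]
  have hinv := lie_diffForm hS (opAdj_sub Tf (linCoeff f)) (opAct_add T a) hA hpair hw
    (fun _ _ => rfl)
  simp only [vary_opAct ha, sub_eq_add_neg (DTV f _) (EV _ f)] at hinv
  have hdet' : ∀ ev ∈ U, ∃ θ,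
      (symbAt ev Tf l (fun σ i j => (-1) ^ l * linCoeff f σ j i) θ).det ≠ 0 := by
    intro ev hev
    obtain ⟨θ, hθ⟩ := hdet ev hev
    refine ⟨θ, ?_⟩
    have : symbAt ev Tf l (fun σ i j => (-1) ^ l * linCoeff f σ j i) θ =
        (-1 : ℝ) ^ l • (symbAt ev Tf l (linCoeff f) θ)ᵀ := by
      ext i j
      simp [symbAt, symb_adj]
    rw [this, Matrix.det_smul, Matrix.det_transpose]
    exact mul_ne_zero (pow_ne_zero _ (pow_ne_zero _ (by norm_num))) hθ
  refine eq_zero_of_invariant (S₁ := fun X => -EV X f) (S₂ := opAdj Tf (linCoeff f)) hl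
    (growthV_neg_EV hTf hdeg) (fun θ Ψ d g h => h.opAdj hdeg) (fun i => ?_) hinv hU hdet' φ₁ φ₂
  have m₁ := linOf_act_mem T T' a (B := fun χ => χ) (fun j => by
    have h := diffGen_mem (F := F) 0 j
    simpa only [Dσ_zero] using h) i
  exact Submodule.add_mem _ (Submodule.sub_mem _ (swap_mem_bidiffOps m₁) m₁)
    (linOf_adj_mem T T' a i)

end Operators

open JetAlgebra

/-! ### The jet algebra of a coordinate domain -/

section Bridge

variable {n m : ℕ} {Ω : TopologicalSpace.Opens (EuclideanSpace ℝ (Fin n))}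

/-- Evaluation of smooth functions at a point. -/
def evalPt (p : {p : Pt n m // p.1 ∈ Ω}) : jetFun m Ω →ₐ[ℝ] ℝ :=
  (Pi.evalAlgHom ℝ (fun _ => ℝ) p).comp (jetFun m Ω).val

theorem evalPt_apply (p : {p : Pt n m // p.1 ∈ Ω}) (g : jetFun m Ω) : evalPt p g = g.1 p := rfl

/-- The smooth functions over an open set form a jet algebra. -/
instance : JetAlgebra n m (jetFun m Ω) where
  dx i := jetDeriv (EuclideanSpace.single i 1, 0, 0)
  dt := jetDeriv (0, 0, 1)
  du σ j := jetDeriv (0, Pi.single (j, σ) 1, 0)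
  u σ j := jetCoord (j, σ)
  ex := jetExp
  dx_dx _ _ g := jetDeriv_comm _ _ g
  dt_dx _ g := jetDeriv_comm _ _ g
  dx_du _ _ _ g := jetDeriv_comm _ _ g
  dt_du _ _ g := jetDeriv_comm _ _ g
  du_du _ _ _ _ g := jetDeriv_comm _ _ g
  exists_du_eq_zero g := by
    classical
    refine ⟨(jetDeriv_single_finite g).toFinset.image Prod.snd, fun σ hσ j => ?_⟩
    by_contra h
    exact hσ (Finset.mem_image.2 ⟨(j, σ), (Set.Finite.mem_toFinset _).2 h, rfl⟩)
  dx_u _ _ _ := by rw [jetDeriv_jetCoord]; simp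
  dt_u _ _ := by rw [jetDeriv_jetCoord]; simp
  du_u σ j τ k := by
    rw [jetDeriv_jetCoord]
    by_cases h : τ = σ ∧ k = j
    · rw [if_pos h, h.1, h.2]; simp
    · have : (k, τ) ≠ (j, σ) := fun e => h ⟨congrArg Prod.snd e, congrArg Prod.fst e⟩
      rw [if_neg h]; simp [Pi.single_eq_of_ne this]
  dx_ex i θ := by
    rw [jetDeriv_jetExp]
    congr 2
    simp
  dt_ex _ := by rw [jetDeriv_jetExp]; simp
  du_ex _ _ _ := by rw [jetDeriv_jetExp]; simp
  ex_add θ θ' := by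
    refine Subtype.ext (funext fun p => ?_)
    change Real.exp _ = Real.exp _ * Real.exp _
    rw [← Real.exp_add, ← Finset.sum_add_distrib]
    simp only [Pi.add_apply, add_mul]
  ex_zero := by
    refine Subtype.ext (funext fun p => ?_)
    change Real.exp _ = 1
    simp
  ext_points g h := Subtype.ext (funext fun p => h (evalPt p))

theorem Represents.congr {F F' : Pt n m → ℝ} {g : jetFun m Ω} (h : Represents F g)
    (hF : ∀ p : Pt n m, p.1 ∈ Ω → F' p = F p) : Represents F' g :=
  fun p => (hF p p.2).trans (h p)

theorem Represents.finsum {ι : Type*} {F : ι → Pt n m → ℝ} {g : ι → jetFun m Ω}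
    (h : ∀ a, Represents (F a) (g a)) {T : Finset ι} (hT : ∀ a, a ∉ T → g a = 0) :
    Represents (fun p => ∑ᶠ a, F a p) (∑ a ∈ T, g a) := by
  refine (Represents.sum T fun a _ => h a).congr fun p hp => ?_
  refine finsum_eq_sum_of_support_subset _ fun a ha => ?_
  by_contra haT
  refine ha ?_
  have := h a ⟨p, hp⟩
  rwa [hT a haT] at this

theorem Represents.dU {F : Pt n m → ℝ} {g : jetFun m Ω} (h : Represents F g) (j : Fin m)
    (σ : MI n) : Represents (dU j σ F) (du σ j g) := by
  have := h.lineDeriv (0, Pi.single (j, σ) 1, 0)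
  exact this.congr fun p _ => dU_eq_lineDeriv j σ F p

theorem Represents.vert {F : Pt n m → ℝ} {g : jetFun m Ω} (h : Represents F g)
    {A : MI n → Fin m → Pt n m → ℝ} {X : MI n → Fin m → jetFun m Ω}
    (hX : ∀ σ j, Represents (A σ j) (X σ j)) :
    Represents (fun p => ∑ᶠ σ : MI n, ∑ j, A σ j p * VarCalc.dU j σ F p) (vert X g) := by
  rw [vert_eq_sum X (T := orders g) fun σ hσ j => du_eq_zero hσ j]
  refine Represents.finsum (F := fun σ p => ∑ j, A σ j p * VarCalc.dU j σ F p)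
    (g := fun σ => ∑ j, X σ j * du σ j g)
    (fun σ => Represents.sum _ fun j _ => (hX σ j).mul (h.dU j σ)) fun σ hσ => ?_
  exact Finset.sum_eq_zero fun j _ => by rw [du_eq_zero hσ, mul_zero]

/-- The total derivative on functions of the jet coordinates is the one of the jet algebra. -/
theorem Represents.totalD {F : Pt n m → ℝ} {g : jetFun m Ω} (h : Represents F g) (i : Fin n) :
    Represents (totalD i F) (D i g) := by
  have h₁ := h.lineDeriv (EuclideanSpace.single i 1, 0, 0)
  have h₂ := h.vert (A := fun σ j p => p.2.1 (j, σ + Finsupp.single i 1))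
    (X := fun σ j => u (σ + Finsupp.single i 1) j) fun _ _ _ => rfl
  refine (h₁.add h₂).congr fun p _ => ?_
  rw [← dX_eq_lineDeriv]
  rfl

theorem Represents.totalDσ {F : Pt n m → ℝ} {g : jetFun m Ω} (h : Represents F g) (σ : MI n) :
    Represents (totalDσ σ F) (Dσ σ g) := by
  have hpow : ∀ (i : Fin n) (r : ℕ) {F : Pt n m → ℝ} {g : jetFun m Ω}, Represents F g →
      Represents ((VarCalc.totalD i)^[r] F)
        ((⇑(D i : Derivation ℝ (jetFun m Ω) (jetFun m Ω)))^[r] g) := by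
    intro i r
    induction r with
    | zero => exact fun h => h
    | succ r ih => exact fun h => ih (h.totalD i)
  unfold VarCalc.totalDσ iter VarCalc.Dσ DList
  induction List.finRange n with
  | nil => exact h
  | cons k L ih => exact hpow k (σ k) ih

/-- Componentwise `Represents`. -/
def RepresentsV (φ : Field n m) (ψ : Fin m → jetFun m Ω) : Prop :=
  ∀ i, Represents (fun p => φ p i) (ψ i)

theorem SmoothField.exists_representsV {φ : Field n m} (h : SmoothField (Ω : Set _) φ) :
    ∃ ψ : Fin m → jetFun m Ω, RepresentsV φ ψ :=
  ⟨fun i => (h i).exists_represents.choose, fun i => (h i).exists_represents.choose_spec⟩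

theorem exists_representsV (ψ : Fin m → jetFun m Ω) :
    ∃ φ : Field n m, SmoothField (Ω : Set _) φ ∧ RepresentsV φ ψ :=
  ⟨fun p i => (exists_represents (ψ i)).choose p,
    fun i => (exists_represents (ψ i)).choose_spec.smoothOver,
    fun i => (exists_represents (ψ i)).choose_spec⟩

theorem RepresentsV.unique {φ φ' : Field n m} {ψ ψ' : Fin m → jetFun m Ω} (h : RepresentsV φ ψ)
    (h' : RepresentsV φ' ψ') (hφ : ∀ p : Pt n m, p.1 ∈ Ω → φ p = φ' p) : ψ = ψ' :=
  funext fun i => (h i).unique ((h' i).congr fun p hp => congrFun (hφ p hp) i)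

theorem RepresentsV.eq_zero {φ : Field n m} (h : RepresentsV φ (0 : Fin m → jetFun m Ω))
    {p : Pt n m} (hp : p.1 ∈ Ω) : φ p = 0 :=
  funext fun i => h i ⟨p, hp⟩

theorem RepresentsV.add {φ φ' : Field n m} {ψ ψ' : Fin m → jetFun m Ω} (h : RepresentsV φ ψ)
    (h' : RepresentsV φ' ψ') : RepresentsV (φ + φ') (ψ + ψ') := fun i => (h i).add (h' i)

theorem RepresentsV.neg {φ : Field n m} {ψ : Fin m → jetFun m Ω} (h : RepresentsV φ ψ) :
    RepresentsV (-φ) (-ψ) := fun i p => congrArg Neg.neg (h i p)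

theorem RepresentsV.sub {φ φ' : Field n m} {ψ ψ' : Fin m → jetFun m Ω} (h : RepresentsV φ ψ)
    (h' : RepresentsV φ' ψ') : RepresentsV (φ - φ') (ψ - ψ') := by
  rw [sub_eq_add_neg, sub_eq_add_neg]
  exact h.add h'.neg

theorem RepresentsV.evol {φ : Field n m} {ψ : Fin m → jetFun m Ω} (h : RepresentsV φ ψ)
    {F : Pt n m → ℝ} {g : jetFun m Ω} (hF : Represents F g) : Represents (evol φ F) (E ψ g) :=
  hF.vert fun σ j => (h j).totalDσ σ

theorem RepresentsV.Dt {f φ : Field n m} {f' ψ : Fin m → jetFun m Ω} (hf : RepresentsV f f')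
    (h : RepresentsV φ ψ) : RepresentsV (Dt f φ) (DTV f' ψ) := by
  intro i
  refine (((h i).lineDeriv (0, 0, 1)).add (hf.evol (h i))).congr fun p _ => ?_
  rw [← dT_eq_lineDeriv]
  rfl

/-- The matrix operator `A` has over `Ω` the coefficients `a`, which vanish outside `T`. -/
def RepresentsOp (A : COp n m) (T : Finset (MI n)) (a : MI n → Fin m → Fin m → jetFun m Ω) :
    Prop :=
  (∀ σ i j, Represents (A σ i j) (a σ i j)) ∧ ∀ σ, σ ∉ T → ∀ i j, a σ i j = 0

theorem COp.IsCDiffOver.exists_representsOp {A : COp n m} (h : A.IsCDiffOver (Ω : Set _)) :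
    ∃ (T : Finset (MI n)) (a : MI n → Fin m → Fin m → jetFun m Ω), RepresentsOp A T a := by
  obtain ⟨⟨T, hT⟩, hs⟩ := h
  choose a ha using fun σ i j => (hs σ i j).exists_represents
  refine ⟨T, a, ha, fun σ hσ i j => (ha σ i j).unique fun p => ?_⟩
  exact hT σ hσ i j p p.2

theorem RepresentsOp.act {A : COp n m} {T : Finset (MI n)}
    {a : MI n → Fin m → Fin m → jetFun m Ω} (hA : RepresentsOp A T a) {φ : Field n m}
    {ψ : Fin m → jetFun m Ω} (h : RepresentsV φ ψ) : RepresentsV (A.act φ) (opAct T a ψ) := by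
  intro i
  refine Represents.finsum (F := fun σ p => ∑ j, A σ i j p * VarCalc.totalDσ σ (fun q => φ q j) p)
    (g := fun σ => ∑ j, a σ i j * Dσ σ (ψ j))
    (fun σ => Represents.sum _ fun j _ => (hA.1 σ i j).mul ((h j).totalDσ σ)) fun σ hσ => ?_
  exact Finset.sum_eq_zero fun j _ => by rw [hA.2 σ hσ, zero_mul]

theorem RepresentsOp.adj {A : COp n m} {T : Finset (MI n)}
    {a : MI n → Fin m → Fin m → jetFun m Ω} (hA : RepresentsOp A T a) {φ : Field n m}
    {ψ : Fin m → jetFun m Ω} (h : RepresentsV φ ψ) : RepresentsV (A.adj φ) (opAdj T a ψ) := by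
  intro i
  refine Represents.finsum
    (F := fun σ p => ∑ j, (-1 : ℝ) ^ σ.degree *
      VarCalc.totalDσ σ (fun q => A σ j i q * φ q j) p)
    (g := fun σ => ∑ j, (-1) ^ σ.degree * Dσ σ (a σ j i * ψ j))
    (fun σ => Represents.sum _ fun j _ => ?_) fun σ hσ => ?_
  · have hc : Represents (fun _ : Pt n m => (-1 : ℝ) ^ σ.degree)
        ((-1) ^ σ.degree : jetFun m Ω) := by
      have := Represents.const (m := m) (Ω := Ω) ((-1 : ℝ) ^ σ.degree)
      rwa [map_pow, map_neg, map_one] at this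
    exact hc.mul (((hA.1 σ j i).mul (h j)).totalDσ σ)
  · exact Finset.sum_eq_zero fun j _ => by
      rw [hA.2 σ hσ, zero_mul, Dσ_apply_zero, mul_zero]

theorem RepresentsV.lin {φ : Field n m} {ψ : Fin m → jetFun m Ω} (h : RepresentsV φ ψ)
    {T : Finset (MI n)} (hT : ∀ σ, σ ∉ T → ∀ i j, linCoeff ψ σ i j = 0) :
    RepresentsOp (lin φ) T (linCoeff ψ) :=
  ⟨fun σ i j => (h i).dU j σ, hT⟩

theorem RepresentsOp.linOf {A : COp n m} {T T' : Finset (MI n)}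
    {a : MI n → Fin m → Fin m → jetFun m Ω} (hA : RepresentsOp A T a)
    (hT' : ∀ τ, τ ∉ T' → ∀ σ i j k, du τ j (a σ i k) = 0) {φ : Field n m}
    {ψ : Fin m → jetFun m Ω} (h : RepresentsV φ ψ) :
    RepresentsOp (linOf A φ) T' (linOfCoeff T a ψ) := by
  refine ⟨fun τ i j => ?_, fun τ hτ i j => ?_⟩
  · refine Represents.finsum
      (F := fun σ p => ∑ k, VarCalc.dU j τ (A σ i k) p * VarCalc.totalDσ σ (fun q => φ q k) p)
      (g := fun σ => ∑ k, du τ j (a σ i k) * Dσ σ (ψ k))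
      (fun σ => Represents.sum _ fun k _ => ((hA.1 σ i k).dU j τ).mul ((h k).totalDσ σ))
      fun σ hσ => ?_
    exact Finset.sum_eq_zero fun k _ => by rw [hA.2 σ hσ, map_zero, zero_mul]
  · exact Finset.sum_eq_zero fun σ _ => Finset.sum_eq_zero fun k _ => by
      rw [hT' τ hτ, zero_mul]

/-- A smooth function vanishing on a dense set of points over `Ω` is zero. -/
theorem eq_zero_of_dense {U : Set (Pt n m)} (hUΩ : U ⊆ {p | p.1 ∈ (Ω : Set _)})
    (hU : {p : Pt n m | p.1 ∈ (Ω : Set _)} ⊆ closure U) (g : jetFun m Ω)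
    (h : ∀ p : {p : Pt n m // p.1 ∈ Ω}, p.1 ∈ U → g.1 p = 0) : g = 0 := by
  obtain ⟨F, hF⟩ := exists_represents g
  have heq : EqOn F (fun _ => 0) U := fun p hp => (hF ⟨p, hUΩ hp⟩).trans (h ⟨p, hUΩ hp⟩ hp)
  have := heq.of_subset_closure hF.smoothOver.continuousOn continuousOn_const hUΩ hU
  exact Subtype.ext (funext fun p => (hF p).symm.trans (this p.2))

/-- The symbol of the linearization at a point, as a sum over all multi-indices of length `l`, agrees
with the sum over the supporting set `T`. -/
theorem symbol_eq_symbAt {φ : Field n m} {ψ : Fin m → jetFun m Ω} (h : RepresentsV φ ψ)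
    {T : Finset (MI n)} (hT : ∀ σ, σ ∉ T → ∀ i j, linCoeff ψ σ i j = 0) (l : ℕ)
    (p : {p : Pt n m // p.1 ∈ Ω}) (θ : Fin n → ℝ) :
    (lin φ).symbol l p θ = symbAt (evalPt p) T l (linCoeff ψ) θ := by
  ext i j
  rw [symbAt_apply, COp.symbol]
  have hterm : ∀ σ : MI n, lin φ σ i j p * ∏ k, θ k ^ σ k =
      mon θ σ * evalPt p (linCoeff ψ σ i j) := by
    intro σ
    rw [mul_comm, evalPt_apply, ← (h.lin hT).1 σ i j p]
    rfl
  simp only [hterm]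
  refine (Finset.sum_subset (fun σ hσ => ?_) fun σ hσ hσ' => ?_).symm
  · rw [Finset.mem_finsuppAntidiag']
    refine ⟨?_, Finset.subset_univ _⟩
    have := (Finset.mem_filter.1 hσ).2
    rwa [Finsupp.degree] at this
  · have : σ ∉ T := by
      intro hmem
      refine hσ' (Finset.mem_filter.2 ⟨hmem, ?_⟩)
      exact (Finset.mem_finsuppAntidiag'.1 hσ).1
    rw [hT σ this, map_zero, mul_zero]

end Bridge

/-! ### Bivectors and 2-forms on an evolution equation -/

section Final

variable {n m : ℕ} {M : Type*} [TopologicalSpace M] [ChartedSpace (EuclideanSpace ℝ (Fin n)) M]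
  {E : M → Type*} [TopologicalSpace (TotalSpace (Fin m → ℝ) E)] [∀ x, TopologicalSpace (E x)]
  [FiberBundle (Fin m → ℝ) E]

theorem BundleChart.isOpen_Ω (c : BundleChart n m E) : IsOpen c.Ω :=
  c.base.isOpen_image_of_subset_source (c.base.open_source.inter c.triv.open_baseSet)
    inter_subset_left

/-- The image of the coordinate domain, as an open set. -/
def BundleChart.opens (c : BundleChart n m E) :
    TopologicalSpace.Opens (EuclideanSpace ℝ (Fin n)) := ⟨c.Ω, c.isOpen_Ω⟩

/-- The right-hand side of the equation in the coordinates `c`, with finitely many multi-indices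
of length at most `l` supporting its linearization. -/
theorem EvolutionEq.exists_representsV (f : EvolutionEq n m E) {l : ℕ} (hord : f.HasOrder l)
    (c : BundleChart n m E) :
    ∃ (g : Fin m → jetFun m c.opens) (T : Finset (MI n)), RepresentsV (f.rhs c) g ∧
      (∀ σ, σ ∉ T → ∀ i j, linCoeff g σ i j = 0) ∧ ∀ σ ∈ T, σ.degree ≤ l := by
  classical
  obtain ⟨g, hg⟩ := SmoothField.exists_representsV (Ω := c.opens) (f.smooth c)
  refine ⟨g, (Finset.univ.biUnion fun i => orders (g i)).filter (fun σ => σ.degree ≤ l), hg,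
    fun σ hσ i j => ?_, fun σ hσ => (Finset.mem_filter.1 hσ).2⟩
  by_cases hmem : σ ∈ Finset.univ.biUnion fun i => orders (g i)
  · have hdeg : ¬ σ.degree ≤ l := fun h => hσ (Finset.mem_filter.2 ⟨hmem, h⟩)
    refine Subtype.ext (funext fun p => ?_)
    by_contra h0
    refine hdeg (hord.2 ⟨c, σ, i, j, p, p.2, rfl, ?_⟩)
    intro h1
    apply h0
    exact ((hg i).dU j σ p).symm.trans h1
  · refine du_eq_zero (fun h => hmem ?_) j
    exact Finset.mem_biUnion.2 ⟨i, Finset.mem_univ _, h⟩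

/-- The points over which the symbol is nonsingular, as evaluations, separate functions. -/
theorem EvolutionEq.exists_points (f : EvolutionEq n m E) {l : ℕ}
    (hsymb : f.GenericallyNondegenerate l) (c : BundleChart n m E) {g : Fin m → jetFun m c.opens}
    {T : Finset (MI n)} (hg : RepresentsV (f.rhs c) g)
    (hT : ∀ σ, σ ∉ T → ∀ i j, linCoeff g σ i j = 0) :
    ∃ U : Set (jetFun m c.opens →ₐ[ℝ] ℝ), (∀ h, (∀ ev ∈ U, ev h = 0) → h = 0) ∧
      ∀ ev ∈ U, ∃ θ, (symbAt ev T l (linCoeff g) θ).det ≠ 0 := by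
  obtain ⟨U, -, hUΩ, hU, hdet⟩ := hsymb c
  refine ⟨{ev | ∃ p : {p : Pt n m // p.1 ∈ c.opens}, p.1 ∈ U ∧ ev = evalPt p}, fun h hh => ?_, ?_⟩
  · exact eq_zero_of_dense hUΩ hU h fun p hp => hh _ ⟨p, hp, rfl⟩
  · rintro _ ⟨p, hp, rfl⟩
    obtain ⟨θ, hθ⟩ := hdet p hp
    exact ⟨θ, by rwa [← symbol_eq_symbAt hg hT]⟩

/-- Skew-adjointness on smooth fields is skew-adjointness in the jet algebra. -/
theorem opAdj_eq_neg {Ω : TopologicalSpace.Opens (EuclideanSpace ℝ (Fin n))} {A : COp n m}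
    {T : Finset (MI n)} {a : MI n → Fin m → Fin m → jetFun m Ω} (hA : RepresentsOp A T a)
    (hskew : ∀ ψ, SmoothField (Ω : Set _) ψ → ∀ p : Pt n m, p.1 ∈ Ω →
      A.adj ψ p = -A.act ψ p) (ψ : Fin m → jetFun m Ω) : opAdj T a ψ = -opAct T a ψ := by
  obtain ⟨φ, hφ, hψ⟩ := exists_representsV ψ
  exact (hA.adj hψ).unique (hA.act hψ).neg fun p hp => hskew φ hφ p hp

/-- The invariance of a bivector, as an identity in the jet algebra. -/
theorem Bivector.IsOn.opAct_eq {f : EvolutionEq n m E} {A : Bivector n m E} (hA : A.IsOn f)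
    {c : BundleChart n m E} {g : Fin m → jetFun m c.opens} {Tf T : Finset (MI n)}
    {a : MI n → Fin m → Fin m → jetFun m c.opens} (hg : RepresentsV (f.rhs c) g)
    (hTf : ∀ σ, σ ∉ Tf → ∀ i j, linCoeff g σ i j = 0) (ha : RepresentsOp (A.op c) T a)
    (ψ : Fin m → jetFun m c.opens) :
    DTV g (opAct T a ψ) - EV (opAct T a ψ) g = opAct T a (DTV g ψ + opAdj Tf (linCoeff g) ψ) := by
  obtain ⟨φ, hφ, hψ⟩ := exists_representsV ψ
  rw [EV_eq_opAct hTf]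
  refine ((hg.Dt (ha.act hψ)).sub ((hg.lin hTf).act (ha.act hψ))).unique
    (ha.act ((hg.Dt hψ).add ((hg.lin hTf).adj hψ))) fun p hp => ?_
  exact sub_eq_zero.1 (hA c φ hφ p hp)

/-- The invariance of a 2-form, as an identity in the jet algebra. -/
theorem TwoForm.IsOn.opAct_eq {f : EvolutionEq n m E} {A : TwoForm n m E} (hA : A.IsOn f)
    {c : BundleChart n m E} {g : Fin m → jetFun m c.opens} {Tf T : Finset (MI n)}
    {a : MI n → Fin m → Fin m → jetFun m c.opens} (hg : RepresentsV (f.rhs c) g)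
    (hTf : ∀ σ, σ ∉ Tf → ∀ i j, linCoeff g σ i j = 0) (ha : RepresentsOp (A.op c) T a)
    (ψ : Fin m → jetFun m c.opens) :
    DTV g (opAct T a ψ) + opAdj Tf (linCoeff g) (opAct T a ψ) = opAct T a (DTV g ψ - EV ψ g) := by
  obtain ⟨φ, hφ, hψ⟩ := exists_representsV ψ
  rw [EV_eq_opAct hTf]
  refine ((hg.Dt (ha.act hψ)).add ((hg.lin hTf).adj (ha.act hψ))).unique
    (ha.act ((hg.Dt hψ).sub ((hg.lin hTf).act hψ))) fun p hp => ?_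
  exact sub_eq_zero.1 (hA c φ hφ p hp)

/-- Any two bivectors on the equation have vanishing Schouten bracket. -/
theorem Bivector.IsOn.compatible {f : EvolutionEq n m E} {l : ℕ} (hord : f.HasOrder l)
    (hl : 1 < l) (hsymb : f.GenericallyNondegenerate l) {A B : Bivector n m E} (hA : A.IsOn f)
    (hB : B.IsOn f) : A.Compatible B := by
  intro c ψ₁ ψ₂ h₁ h₂ p hp
  obtain ⟨g, Tf, hg, hTf, hdeg⟩ := f.exists_representsV hord c
  obtain ⟨U, hU, hdet⟩ := f.exists_points hsymb c hg hTf
  obtain ⟨T₁, a, ha⟩ := COp.IsCDiffOver.exists_representsOp (Ω := c.opens) (A.isCDiff c)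
  obtain ⟨T₂, b, hb⟩ := COp.IsCDiffOver.exists_representsOp (Ω := c.opens) (B.isCDiff c)
  obtain ⟨T₁', ha'⟩ := exists_orders_coeff T₁ ha.2
  obtain ⟨T₂', hb'⟩ := exists_orders_coeff T₂ hb.2
  obtain ⟨χ₁, h₁⟩ := SmoothField.exists_representsV (Ω := c.opens) h₁
  obtain ⟨χ₂, h₂⟩ := SmoothField.exists_representsV (Ω := c.opens) h₂
  have hzero := bracket_eq_zero hl hTf hdeg hU hdet ha' hb' (opAdj_eq_neg ha (A.skew c))
    (opAdj_eq_neg hb (B.skew c)) (hA.opAct_eq hg hTf ha) (hB.opAct_eq hg hTf hb) χ₁ χ₂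
  have hrep := (((((ha.linOf ha' h₁).act (hb.act h₂)).sub ((ha.linOf ha' h₂).act (hb.act h₁))).add
    ((hb.linOf hb' h₁).act (ha.act h₂))).sub ((hb.linOf hb' h₂).act (ha.act h₁))).sub
    (ha.act ((hb.linOf hb' h₂).adj h₁)) |>.sub (hb.act ((ha.linOf ha' h₂).adj h₁))
  rw [hzero] at hrep
  exact hrep.eq_zero hp

/-- A 2-form on the equation is closed. -/
theorem TwoForm.IsOn.isClosed {f : EvolutionEq n m E} {l : ℕ} (hord : f.HasOrder l)
    (hl : 1 < l) (hsymb : f.GenericallyNondegenerate l) {A : TwoForm n m E} (hA : A.IsOn f) :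
    A.IsClosed := by
  intro c φ₁ φ₂ h₁ h₂ p hp
  obtain ⟨g, Tf, hg, hTf, hdeg⟩ := f.exists_representsV hord c
  obtain ⟨U, hU, hdet⟩ := f.exists_points hsymb c hg hTf
  obtain ⟨T, a, ha⟩ := COp.IsCDiffOver.exists_representsOp (Ω := c.opens) (A.isCDiff c)
  obtain ⟨T', ha'⟩ := exists_orders_coeff T ha.2
  obtain ⟨χ₁, h₁⟩ := SmoothField.exists_representsV (Ω := c.opens) h₁
  obtain ⟨χ₂, h₂⟩ := SmoothField.exists_representsV (Ω := c.opens) h₂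
  have hzero := diffForm_eq_zero hl hTf hdeg hU hdet ha' (opAdj_eq_neg ha (A.skew c))
    (hA.opAct_eq hg hTf ha) χ₁ χ₂
  have hrep := (((ha.linOf ha' h₂).act h₁).sub ((ha.linOf ha' h₁).act h₂)).add
    ((ha.linOf ha' h₁).adj h₂)
  rw [hzero] at hrep
  exact hrep.eq_zero hp

end Final

end VarCalc

end

theorem mainTheorem2 {n m : ℕ} {M : Type*} [TopologicalSpace M]
    [ChartedSpace (EuclideanSpace ℝ (Fin n)) M] [IsManifold (𝓡 n) ∞ M]
    {E : M → Type*} [TopologicalSpace (TotalSpace (Fin m → ℝ) E)]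
    [∀ x, AddCommGroup (E x)] [∀ x, Module ℝ (E x)] [∀ x, TopologicalSpace (E x)]
    [FiberBundle (Fin m → ℝ) E] [VectorBundle ℝ (Fin m → ℝ) E]
    [ContMDiffVectorBundle ∞ (Fin m → ℝ) E (𝓡 n)]
    (f : VarCalc.EvolutionEq n m E) (l : ℕ) (hord : f.HasOrder l) (hl : 1 < l)
    (hsymb : f.GenericallyNondegenerate l) :
    (∀ A : VarCalc.Bivector n m E, A.IsOn f → A.IsHamiltonian f) ∧
    (∀ A B : VarCalc.Bivector n m E,
      A.IsHamiltonian f → B.IsHamiltonian f → A.Compatible B) ∧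
    (∀ Φ : VarCalc.TwoForm n m E, Φ.IsOn f → Φ.IsSymplectic f) :=
  ⟨fun _ hA => ⟨hA, hA.compatible hord hl hsymb hA⟩,
    fun _ _ hA hB => hA.1.compatible hord hl hsymb hB.1,
    fun _ hΦ => ⟨hΦ, hΦ.isClosed hord hl hsymb⟩⟩
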